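/- Let $n\ge 0$ be an integer and $\lambda\in\mathbb R$. Put $e(t)=e^{2\pi i t}$, $\bar e(t)=e^{-2\pi i t}$, $\eta_\lambda(r)=\frac{e^{2\lambda r}-1}{2\lambda}$ for $\lambda\neq0$ and $\eta_0(r)=r$, let $\beta$ be the inner product of $\mathbb R^n$, and let $\mathcal H=L^2(\mathbb R^n\times\mathbb R^n\times\mathbb R)$ in the variables $(x,y,r)$; $\mathcal H\otimes\mathcal H$ is the $L^2$-space in the variables $(x,y,r;x',y',r')$, and so on. Let $\Sigma$ be the flip of $\mathcal H\otimes\mathcal H$, and define on $\mathcal H$ the conjugate-linear operators $$J\xi(x,y,r)=\bar e[\eta_\lambda(r)\beta(x,y)]\,\overline{\xi(-x,-y,r)},\qquad \hat J\xi(x,y,r)=(e^{\lambda r})^n\,\overline{\xi(e^{\lambda r}x,e^{\lambda r}y,-r)},$$ $j=\hat JJ$, and on $\mathcal H\otimes\mathcal H$ the unitary operators $$U_A\xi(x,y,r;x',y',r')=(e^{-\lambda r'})^n\,\bar e[\eta_\lambda(r')\beta(e^{-\lambda r'}x,y'-e^{-\lambda r'}y)]\,\xi(e^{-\lambda r'}x,e^{-\lambda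 r'}y,r+r';x'-e^{-\lambda r'}x,y'-e^{-\lambda r'}y,r'),$$ $$Y=\Sigma(j\otimes1)U_A(j\otimes1)\Sigma,\qquad X=\Sigma Y^*\Sigma,\qquad Z=Y^*(j\otimes j)Y(j\otimes j).$$ Let $V_D=Z_{12}Y_{24}Z_{12}^*X_{13}\in\mathcal B(\mathcal H^{\otimes4})$, let $$A_D=\overline{\{(\mathrm{id}\otimes\mathrm{id}\otimes\Omega)(V_D):\Omega\in\mathcal B(\mathcal H\otimes\mathcal H)_*\}}^{\|\cdot\|}\subseteq\mathcal B(\mathcal H\otimes\mathcal H),$$ $\Delta_D(x)=V_D^*(1\otimes1\otimes x)V_D$, and $\Delta_D^{\rm cop}=\chi\circ\Delta_D$, where $\chi$ is the flip of the legs $1\leftrightarrow3$, $2\leftrightarrow4$. For Schwartz functions $f,\phi$ of $(x,y,r)$ with compact support in $r$ let $L_f,\lambda_\phi\in\mathcal B(\mathcal H)$ be given by $$L_f\xi(x,y,r)=\int f(\tilde x,\tilde y,r)\,\xi(x-\tilde x,y-\tilde y,r)\,\bar e[\eta_\lambda(r)\beta(\tilde x,y-\tilde y)]\,d\tilde x\,d\tilde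 y,$$ $$\lambda_\phi\xi(x,y,r)=\int\phi(e^{\lambda\tilde r}x,e^{\lambda\tilde r}y,r-\tilde r)\,\xi(x,y,\tilde r)\,d\tilde r,$$ and put $\pi(a)=Z(1\otimes a)Z^*$, $\pi'(b)=b\otimes1$, $\Pi(\phi\otimes f)=\pi'(\lambda_\phi)\pi(L_f)$, $S(a)=\hat Ja^*\hat J$, $\hat S(b)=Jb^*J$ for bounded operators $a,b$ on $\mathcal H$. Finally let $\widehat{J_D}=J\otimes\hat J$ (a conjugate-linear operator on $\mathcal H\otimes\mathcal H$), $S_D(x)=\widehat{J_D}\,x^*\,\widehat{J_D}$, and let $S_D\otimes S_D$ denote the map $T\mapsto(\widehat{J_D}\otimes\widehat{J_D})T^*(\widehat{J_D}\otimes\widehat{J_D})$ on $\mathcal B(\mathcal H^{\otimes4})$, which sends $a\otimes b$ to $S_D(a)\otimes S_D(b)$. Then $\widehat{J_D}^2=1$; $A_D$ is a $C^*$-algebra (a norm closed $*$-subalgebra of $\mathcal B(\mathcal H\otimes\mathcal H)$), and $S_D$ restricts to a ($*$-preserving) anti-automorphism of $A_D$. For all $f,\phi$ as above, $\Pi(\phi\otimes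 f)\in A_D$ and $$S_D(\Pi(\phi\otimes f))=\pi(S(L_f))\,\pi'(\hat S(\lambda_\phi)).$$ For all $x\in A_D$ one has $S_D(S_D(x)^*)^*=x$ and $(S_D\otimes S_D)(\Delta_D(x))=\Delta_D^{\rm cop}(S_D(x))$. -/

import Mathlib

open MeasureTheory Filter
open scoped ENNReal NNReal TensorProduct ComplexConjugate InnerProductSpace

set_option linter.unusedSectionVars false

namespace QDouble

noncomputable section

/-- The Hilbert space `L²(α)` of complex valued functions. -/
abbrev L2 (α : Type) [MeasureSpace α] : Type := Lp ℂ 2 (volume : Measure α)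

/-- Bounded operators on `L²(α)`. -/
abbrev Op (α : Type) [MeasureSpace α] : Type := L2 α →L[ℂ] L2 α

/-- Bounded conjugate-linear operators on `L²(α)`. -/
abbrev AntiOp (α : Type) [MeasureSpace α] : Type := L2 α →L⋆[ℂ] L2 α

section tensor

variable {α β : Type} [MeasureSpace α] [MeasureSpace β]
  [SigmaFinite (volume : Measure α)] [SigmaFinite (volume : Measure β)]

theorem memLp_tensor (f : L2 α) (g : L2 β) :
    MemLp (fun p : α × β => f p.1 * g p.2) 2 (volume : Measure (α × β)) := by
  have hf := Lp.memLp f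
  have hg := Lp.memLp g
  have hm : AEStronglyMeasurable (fun p : α × β => f p.1 * g p.2) (volume : Measure (α × β)) :=
    (hf.1.comp_fst).mul (hg.1.comp_snd)
  refine (memLp_two_iff_integrable_sq_norm hm).2 ?_
  have h1 := (memLp_two_iff_integrable_sq_norm hf.1).1 hf
  have h2 := (memLp_two_iff_integrable_sq_norm hg.1).1 hg
  refine (h1.mul_prod h2).congr (Eventually.of_forall fun p => ?_)
  simp [mul_pow]

/-- The elementary tensor `(f ⊗ g)(a, b) = f(a) g(b)` in `L²(α × β)`. -/
def tmulL2 (f : L2 α) (g : L2 β) : L2 (α × β) := (memLp_tensor f g).toLp _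

theorem coeFn_tmulL2 (f : L2 α) (g : L2 β) :
    tmulL2 f g =ᵐ[volume] fun p : α × β => f p.1 * g p.2 := (memLp_tensor f g).coeFn_toLp

theorem inner_tmulL2 (f f' : L2 α) (g g' : L2 β) :
    ⟪tmulL2 f g, tmulL2 f' g'⟫_ℂ = ⟪f, f'⟫_ℂ * ⟪g, g'⟫_ℂ := by
  simp only [L2.inner_def]
  rw [← integral_prod_mul (μ := (volume : Measure α)) (ν := (volume : Measure β))]
  refine integral_congr_ae ?_
  filter_upwards [coeFn_tmulL2 f g, coeFn_tmulL2 f' g'] with p h1 h2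
  simp only [h1, h2, RCLike.inner_apply, map_mul]
  ring

theorem ae_fst_of_ae {P : α → Prop} (h : ∀ᵐ a, P a) : ∀ᵐ p : α × β, P p.1 :=
  Measure.quasiMeasurePreserving_fst.ae h

theorem ae_snd_of_ae {P : β → Prop} (h : ∀ᵐ a, P a) : ∀ᵐ p : α × β, P p.2 :=
  Measure.quasiMeasurePreserving_snd.ae h

/-- The bilinear map `(f, g) ↦ f ⊗ g`. -/
def tmulBilin : L2 α →ₗ[ℂ] L2 β →ₗ[ℂ] L2 (α × β) :=
  LinearMap.mk₂ ℂ tmulL2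
    (fun f f' g => by
      apply Lp.ext
      filter_upwards [coeFn_tmulL2 (f + f') g, coeFn_tmulL2 f g, coeFn_tmulL2 f' g,
        Lp.coeFn_add (tmulL2 f g) (tmulL2 f' g), ae_fst_of_ae (β := β) (Lp.coeFn_add f f')]
        with p h1 h2 h3 h4 h5
      rw [h1, h4, Pi.add_apply, h2, h3, h5, Pi.add_apply, add_mul])
    (fun c f g => by
      apply Lp.ext
      filter_upwards [coeFn_tmulL2 (c • f) g, coeFn_tmulL2 f g,
        Lp.coeFn_smul c (tmulL2 f g), ae_fst_of_ae (β := β) (Lp.coeFn_smul c f)]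
        with p h1 h2 h4 h5
      rw [h1, h4, Pi.smul_apply, h2, h5, Pi.smul_apply, smul_eq_mul, smul_eq_mul, mul_assoc])
    (fun f g g' => by
      apply Lp.ext
      filter_upwards [coeFn_tmulL2 f (g + g'), coeFn_tmulL2 f g, coeFn_tmulL2 f g',
        Lp.coeFn_add (tmulL2 f g) (tmulL2 f g'), ae_snd_of_ae (α := α) (Lp.coeFn_add g g')]
        with p h1 h2 h3 h4 h5
      rw [h1, h4, Pi.add_apply, h2, h3, h5, Pi.add_apply, mul_add])
    (fun c f g => by
      apply Lp.ext
      filter_upwards [coeFn_tmulL2 f (c • g), coeFn_tmulL2 f g,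
        Lp.coeFn_smul c (tmulL2 f g), ae_snd_of_ae (α := α) (Lp.coeFn_smul c g)]
        with p h1 h2 h4 h5
      rw [h1, h4, Pi.smul_apply, h2, h5, Pi.smul_apply, smul_eq_mul, smul_eq_mul]
      ring)

/-- The canonical isometric embedding of the algebraic tensor product `L²(α) ⊗ L²(β)`
into `L²(α × β)`. -/
def tensorEmb : L2 α ⊗[ℂ] L2 β →ₗᵢ[ℂ] L2 (α × β) :=
  (TensorProduct.lift tmulBilin).isometryOfInner (fun x y => by
    induction x using TensorProduct.induction_on with
    | zero => simp
    | add x x' hx hx' => simp only [map_add, inner_add_left, hx, hx']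
    | tmul f g =>
      induction y using TensorProduct.induction_on with
      | zero => simp
      | add x x' hx hx' => simp only [map_add, inner_add_right, hx, hx']
      | tmul f' g' => exact inner_tmulL2 f f' g g')

@[simp] theorem tensorEmb_tmul (f : L2 α) (g : L2 β) : tensorEmb (f ⊗ₜ[ℂ] g) = tmulL2 f g := rfl

theorem ae_zero_of_rect {h : α × β → ℂ} (hh : MemLp h 2 (volume : Measure (α × β)))
    (H : ∀ (s : Set α) (t : Set β), MeasurableSet s → MeasurableSet t → volume s < ∞ →
      volume t < ∞ → ∫ p in s ×ˢ t, h p = 0) : h =ᵐ[volume] 0 := by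
  have key : ∀ (s : Set α) (t : Set β), MeasurableSet s → MeasurableSet t → volume s < ∞ →
      volume t < ∞ → ∀ᵐ p, p ∈ s ×ˢ t → h p = 0 := by
    intro s t hs ht hsf htf
    have hst : MeasurableSet (s ×ˢ t) := hs.prod ht
    have hfin : volume (s ×ˢ t : Set (α × β)) < ∞ := by
      rw [Measure.volume_eq_prod, Measure.prod_prod]; exact ENNReal.mul_lt_top hsf htf
    have : IsFiniteMeasure ((volume : Measure (α × β)).restrict (s ×ˢ t)) :=
      ⟨by rwa [Measure.restrict_apply_univ]⟩
    have hi : Integrable h ((volume : Measure (α × β)).restrict (s ×ˢ t)) :=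
      (hh.restrict _).integrable (by norm_num)
    rw [← ae_restrict_iff' hst]
    refine hi.ae_eq_zero_of_forall_setIntegral_eq_zero ?_
    intro E hE _
    induction E, hE using MeasurableSpace.induction_on_inter generateFrom_prod.symm
      isPiSystem_prod with
    | empty => simp
    | basic E hE =>
      obtain ⟨a, ha, b, hb, rfl⟩ := hE
      rw [Measure.restrict_restrict (MeasurableSet.prod ha hb), Set.prod_inter_prod]
      exact H _ _ (MeasurableSet.inter ha hs) (MeasurableSet.inter hb ht)
        ((measure_mono Set.inter_subset_right).trans_lt hsf)
        ((measure_mono Set.inter_subset_right).trans_lt htf)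
    | compl E hE ih =>
      have h1 := integral_add_compl hE hi
      have h2 := H s t hs ht hsf htf
      have h3 := ih (measure_lt_top _ _)
      rw [h2, h3, zero_add] at h1
      exact h1
    | iUnion F hd hF ih =>
      rw [integral_iUnion hF hd hi.integrableOn]
      simp [ih _ (measure_lt_top _ _)]
  have hcov : ∀ᵐ p : α × β, ∀ i j : ℕ, p ∈ spanningSets (volume : Measure α) i ×ˢ
      spanningSets (volume : Measure β) j → h p = 0 := by
    rw [ae_all_iff]; intro i; rw [ae_all_iff]; intro j
    exact key _ _ (measurableSet_spanningSets _ _) (measurableSet_spanningSets _ _)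
      (measure_spanningSets_lt_top _ _) (measure_spanningSets_lt_top _ _)
  filter_upwards [hcov] with p hp
  obtain ⟨i, hi⟩ := Set.mem_iUnion.1 ((iUnion_spanningSets (volume : Measure α)).symm ▸
    Set.mem_univ p.1)
  obtain ⟨j, hj⟩ := Set.mem_iUnion.1 ((iUnion_spanningSets (volume : Measure β)).symm ▸
    Set.mem_univ p.2)
  exact hp i j ⟨hi, hj⟩

theorem denseRange_tensorEmb : DenseRange (tensorEmb : L2 α ⊗[ℂ] L2 β →ₗᵢ[ℂ] L2 (α × β)) := by
  have : (LinearMap.range (tensorEmb : L2 α ⊗[ℂ] L2 β →ₗᵢ[ℂ] L2 (α × β)).toLinearMap).topologicalClosure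
      = ⊤ := by
    rw [Submodule.topologicalClosure_eq_top_iff, Submodule.eq_bot_iff]
    intro h hh
    rw [Submodule.mem_orthogonal] at hh
    have : (h : α × β → ℂ) =ᵐ[volume] 0 := by
      refine ae_zero_of_rect (Lp.memLp h) ?_
      intro s t hs ht hsf htf
      have h0 := hh _ ⟨indicatorConstLp 2 hs hsf.ne (1 : ℂ) ⊗ₜ indicatorConstLp 2 ht htf.ne (1 : ℂ),
        rfl⟩
      change ⟪tmulL2 _ _, h⟫_ℂ = 0 at h0
      rw [L2.inner_def] at h0
      rw [← h0, ← integral_indicator (hs.prod ht)]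
      refine integral_congr_ae ?_
      filter_upwards [coeFn_tmulL2 (indicatorConstLp 2 hs hsf.ne (1 : ℂ))
        (indicatorConstLp 2 ht htf.ne (1 : ℂ)),
        ae_fst_of_ae (β := β) (indicatorConstLp_coeFn (p := 2) (hs := hs) (hμs := hsf.ne) (c := (1 : ℂ))),
        ae_snd_of_ae (α := α) (indicatorConstLp_coeFn (p := 2) (hs := ht) (hμs := htf.ne) (c := (1 : ℂ)))]
        with p h1 h2 h3
      rw [h1, h2, h3]
      by_cases ha : p.1 ∈ s <;> by_cases hb : p.2 ∈ t <;>
        simp [Set.indicator, ha, hb, Set.mem_prod]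
    exact (Lp.eq_zero_iff_ae_eq_zero).2 this
  have h2 := Submodule.dense_iff_topologicalClosure_eq_top.2 this
  exact h2

/-- The operator `T ⊗ S` on `L²(α × β)`: the unique bounded extension of the algebraic tensor
product. -/
def tensorOp (T : Op α) (S : Op β) : Op (α × β) :=
  ((tensorEmb : L2 α ⊗[ℂ] L2 β →ₗᵢ[ℂ] L2 (α × β)).toContinuousLinearMap.comp
    (TensorProduct.mapL T S)).extend tensorEmb.toContinuousLinearMap

theorem tensorOp_tmulL2 (T : Op α) (S : Op β) (f : L2 α) (g : L2 β) :
    tensorOp T S (tmulL2 f g) = tmulL2 (T f) (S g) := by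
  have := ContinuousLinearMap.extend_eq
    (((tensorEmb : L2 α ⊗[ℂ] L2 β →ₗᵢ[ℂ] L2 (α × β)).toContinuousLinearMap.comp
    (TensorProduct.mapL T S))) (e := tensorEmb.toContinuousLinearMap) denseRange_tensorEmb
    tensorEmb.isometry.isUniformInducing (f ⊗ₜ g)
  simpa [tensorOp] using this

theorem ext_tmulL2 {σ : ℂ →+* ℂ} {E : Type*} [NormedAddCommGroup E] [NormedSpace ℂ E]
    {T S : L2 (α × β) →SL[σ] E}
    (h : ∀ f g, T (tmulL2 f g) = S (tmulL2 f g)) : T = S := by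
  have : (T : L2 (α × β) → E) = S := by
    refine denseRange_tensorEmb.equalizer T.continuous S.continuous ?_
    funext x
    induction x using TensorProduct.induction_on with
    | zero => simp
    | add x y hx hy => simp only [Function.comp_apply, map_add] at *; rw [hx, hy]
    | tmul f g => exact h f g
  exact DFunLike.coe_injective this

/-- `ζ ↦ ζ ⊗ η`. -/
def ketR (η : L2 β) : L2 α →L[ℂ] L2 (α × β) :=
  (tensorEmb : L2 α ⊗[ℂ] L2 β →ₗᵢ[ℂ] L2 (α × β)).toContinuousLinearMap.comp
    ((TensorProduct.mkL ℂ (L2 α) (L2 β)).flip η)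

@[simp] theorem ketR_apply (η : L2 β) (ζ : L2 α) : ketR η ζ = tmulL2 ζ η := rfl

/-- The right slice `(id ⊗ ω_{ξ,η})(V)` by the vector functional `ω_{ξ,η}(T) = ⟪ξ, T η⟫`. -/
def vecSlice (V : Op (α × β)) (ξ η : L2 β) : Op α :=
  (ContinuousLinearMap.adjoint (ketR (α := α) ξ)).comp (V.comp (ketR η))

theorem inner_vecSlice (V : Op (α × β)) (ξ η : L2 β) (ζ ζ' : L2 α) :
    ⟪ζ, vecSlice V ξ η ζ'⟫_ℂ = ⟪tmulL2 ζ ξ, V (tmulL2 ζ' η)⟫_ℂ := by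
  simp [vecSlice, ContinuousLinearMap.adjoint_inner_right]

/-- The set of all right slices `(id ⊗ ω)(V)` by normal functionals `ω ∈ B(L²(β))_*`, that is by
the functionals `ω = ∑ ω_{ξᵢ,ηᵢ}` with `∑ ‖ξᵢ‖² < ∞` and `∑ ‖ηᵢ‖² < ∞`. -/
def rightSlices (V : Op (α × β)) : Set (Op α) :=
  {T | ∃ ξ η : ℕ → L2 β, Summable (fun i => ‖ξ i‖ ^ 2) ∧ Summable (fun i => ‖η i‖ ^ 2) ∧
    HasSum (fun i => vecSlice V (ξ i) (η i)) T}

end tensor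

section conjugation
variable {α β : Type} [MeasureSpace α] [MeasureSpace β]
  [SigmaFinite (volume : Measure α)] [SigmaFinite (volume : Measure β)]

/-- Pointwise complex conjugation on `L²(α)`. -/
def conjL2 : AntiOp α :=
  LinearMap.mkContinuous
    { toFun := fun ξ => star ξ
      map_add' := fun ξ η => by
        apply Lp.ext
        filter_upwards [Lp.coeFn_star (ξ + η), Lp.coeFn_star ξ, Lp.coeFn_star η, Lp.coeFn_add ξ η,
          Lp.coeFn_add (star ξ) (star η)] with p h1 h2 h3 h4 h5
        rw [h1, h5, Pi.star_apply, h4, Pi.add_apply, Pi.add_apply, h2, h3, Pi.star_apply, Pi.star_apply,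
          star_add]
      map_smul' := fun c ξ => by
        apply Lp.ext
        filter_upwards [Lp.coeFn_star (c • ξ), Lp.coeFn_star ξ, Lp.coeFn_smul c ξ,
          Lp.coeFn_smul (conj c) (star ξ)] with p h1 h2 h3 h4
        rw [h1, h4, Pi.star_apply, h3, Pi.smul_apply, Pi.smul_apply, h2, Pi.star_apply, star_smul]
        rfl } 1 (fun ξ => by
    rw [one_mul]
    refine Lp.norm_le_norm_of_ae_le ?_
    filter_upwards [Lp.coeFn_star ξ] with p h1
    simp [h1])

theorem coeFn_conjL2 (ξ : L2 α) : conjL2 ξ =ᵐ[volume] fun p => conj (ξ p) := Lp.coeFn_star ξ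

@[simp] theorem conjL2_conjL2 (ξ : L2 α) : conjL2 (conjL2 ξ) = ξ := star_star ξ

theorem conjL2_tmulL2 (f : L2 α) (g : L2 β) :
    conjL2 (tmulL2 f g) = tmulL2 (conjL2 f) (conjL2 g) := by
  apply Lp.ext
  filter_upwards [coeFn_conjL2 (tmulL2 f g), coeFn_tmulL2 f g,
    coeFn_tmulL2 (conjL2 f) (conjL2 g), ae_fst_of_ae (β := β) (coeFn_conjL2 f),
    ae_snd_of_ae (α := α) (coeFn_conjL2 g)] with p h1 h2 h3 h4 h5
  rw [h1, h2, h3, h4, h5, map_mul]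

/-- The tensor product `A ⊗ B` of two conjugate-linear operators. -/
def tensorAnti (A : AntiOp α) (B : AntiOp β) : AntiOp (α × β) :=
  (tensorOp (A.comp conjL2) (B.comp conjL2)).comp conjL2

theorem tensorAnti_tmulL2 (A : AntiOp α) (B : AntiOp β) (f : L2 α) (g : L2 β) :
    tensorAnti A B (tmulL2 f g) = tmulL2 (A f) (B g) := by
  simp [tensorAnti, conjL2_tmulL2, tensorOp_tmulL2]

end conjugation

section weighted

variable {α β : Type} [MeasureSpace α] [MeasureSpace β]

/-- The condition under which `ξ ↦ c · (ξ ∘ τ)` is an isometry `L²(β) → L²(α)`: it says that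
`τ` maps the measure `|c|² dp` to the measure of `β`, and `c` has no zeros. -/
structure IsWeighted (c : α → ℂ) (τ : α → β) : Prop where
  meas_c : Measurable c
  meas_τ : Measurable τ
  ne_zero : ∀ p, c p ≠ 0
  lintegral : ∀ g : β → ℝ≥0∞, Measurable g → ∫⁻ p, ‖c p‖ₑ ^ 2 * g (τ p) = ∫⁻ q, g q

theorem IsWeighted.qmp {c : α → ℂ} {τ : α → β} (h : IsWeighted c τ) :
    Measure.QuasiMeasurePreserving τ := by
  refine ⟨h.meas_τ, Measure.AbsolutelyContinuous.mk fun s hs h0 => ?_⟩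
  rw [Measure.map_apply h.meas_τ hs]
  have h1 := h.lintegral (s.indicator 1) (measurable_one.indicator hs)
  rw [lintegral_indicator_one hs, h0] at h1
  have h2 := (lintegral_eq_zero_iff (f := fun p => ‖c p‖ₑ ^ 2 * s.indicator 1 (τ p))
    ((h.meas_c.enorm.pow_const 2).mul ((measurable_one.indicator hs).comp h.meas_τ))).1 h1
  refine measure_mono_null ?_ (ae_iff.1 h2)
  intro p hp
  have : τ p ∈ s := hp
  simp [this, h.ne_zero p]

theorem IsWeighted.memLp {c : α → ℂ} {τ : α → β} (h : IsWeighted c τ) (ξ : L2 β) :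
    MemLp (fun p => c p * ξ (τ p)) 2 (volume : Measure α) ∧
      eLpNorm (fun p => c p * ξ (τ p)) 2 volume = eLpNorm ξ 2 volume := by
  have hm : Measurable fun p => c p * ξ (τ p) :=
    h.meas_c.mul ((Lp.stronglyMeasurable ξ).measurable.comp h.meas_τ)
  have : eLpNorm (fun p => c p * ξ (τ p)) 2 volume = eLpNorm ξ 2 volume := by
    rw [eLpNorm_eq_lintegral_rpow_enorm_toReal (by norm_num) (by norm_num),
      eLpNorm_eq_lintegral_rpow_enorm_toReal (by norm_num) (by norm_num)]
    congr 1
    have := h.lintegral (fun q => ‖ξ q‖ₑ ^ 2)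
      ((Lp.stronglyMeasurable ξ).measurable.enorm.pow_const 2)
    simpa [mul_pow] using this
  exact ⟨⟨hm.aestronglyMeasurable, this ▸ (Lp.memLp ξ).2⟩, this⟩

/-- The operator `(T ξ)(p) = c(p) ξ(τ(p))`. -/
def weightedComp (c : α → ℂ) (τ : α → β) (h : IsWeighted c τ) : L2 β →L[ℂ] L2 α :=
  LinearMap.mkContinuous
    { toFun := fun ξ => (h.memLp ξ).1.toLp _
      map_add' := fun ξ η => by
        apply Lp.ext
        filter_upwards [(h.memLp (ξ + η)).1.coeFn_toLp, (h.memLp ξ).1.coeFn_toLp,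
          (h.memLp η).1.coeFn_toLp, h.qmp.ae (Lp.coeFn_add ξ η),
          Lp.coeFn_add ((h.memLp ξ).1.toLp _) ((h.memLp η).1.toLp _)] with p h1 h2 h3 h4 h5
        rw [h1, h5, Pi.add_apply, h2, h3, h4, Pi.add_apply, mul_add]
      map_smul' := fun a ξ => by
        apply Lp.ext
        filter_upwards [(h.memLp (a • ξ)).1.coeFn_toLp, (h.memLp ξ).1.coeFn_toLp,
          h.qmp.ae (Lp.coeFn_smul a ξ),
          Lp.coeFn_smul a ((h.memLp ξ).1.toLp _)] with p h1 h2 h3 h4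
        rw [h1, RingHom.id_apply, h4, Pi.smul_apply, h2, h3, Pi.smul_apply, smul_eq_mul,
          smul_eq_mul]
        ring } 1 (fun ξ => by
      rw [one_mul, LinearMap.coe_mk, AddHom.coe_mk, Lp.norm_toLp, (h.memLp ξ).2, Lp.norm_def])

theorem coeFn_weightedComp (c : α → ℂ) (τ : α → β) (h : IsWeighted c τ) (ξ : L2 β) :
    weightedComp c τ h ξ =ᵐ[volume] fun p => c p * ξ (τ p) := (h.memLp ξ).1.coeFn_toLp

theorem IsWeighted.of_measurePreserving {c : α → ℂ} {τ : α → β} (hc : Measurable c)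
    (h1 : ∀ p, ‖c p‖ = 1) (hτ : MeasurePreserving τ) : IsWeighted c τ where
  meas_c := hc
  meas_τ := hτ.measurable
  ne_zero p := by rw [← norm_ne_zero_iff, h1]; exact one_ne_zero
  lintegral g hg := by
    have : ∀ p, ‖c p‖ₑ = 1 := fun p => by rw [← ofReal_norm, h1, ENNReal.ofReal_one]
    simp only [this, one_pow, one_mul]
    exact hτ.lintegral_comp hg

/-- `ξ ↦ ξ ∘ τ` for a measure preserving `τ`. -/
def compMP (τ : α → β) (h : MeasurePreserving τ) : L2 β →L[ℂ] L2 α :=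
  weightedComp (fun _ => 1) τ (.of_measurePreserving measurable_const (by simp) h)

end weighted

section legs

variable (α : Type) [MeasureSpace α] [SigmaFinite (volume : Measure α)]

/-- The flip `Σ` on `L²(α) ⊗ L²(α)`. -/
def flip : Op (α × α) := compMP Prod.swap Measure.measurePreserving_swap

/-- `((1, 2), (3, 4)) ↦ ((1, 3), (2, 4))` -/
def mid (p : (α × α) × (α × α)) : (α × α) × (α × α) := ((p.1.1, p.2.1), (p.1.2, p.2.2))

theorem measurePreserving_mid : MeasurePreserving (mid α) := by
  have hI : MeasurePreserving (id : α → α) := MeasurePreserving.id _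
  have hs : MeasurePreserving (Prod.swap : α × α → α × α) := Measure.measurePreserving_swap
  have ha := measurePreserving_prodAssoc (volume : Measure α) (volume : Measure α)
    (volume : Measure (α × α))
  have hb := measurePreserving_prodAssoc (volume : Measure α) (volume : Measure α)
    (volume : Measure α)
  have h1 := (hI.prod (hb.symm _))
  have h2 := (hI.prod (hs.prod hI))
  have h3 := (hI.prod hb)
  exact (ha.symm _).comp (h3.comp (h2.comp (h1.comp ha)))

/-- The unitary exchanging the second and the third leg of `L²(α)^{⊗ 4}`. -/
def midFlip : Op ((α × α) × (α × α)) := compMP (mid α) (measurePreserving_mid α)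

variable {α}

/-- `T₁₂` -/
def leg12 (T : Op (α × α)) : Op ((α × α) × (α × α)) := tensorOp T 1

/-- `T₁₃` -/
def leg13 (T : Op (α × α)) : Op ((α × α) × (α × α)) := midFlip α * tensorOp T 1 * midFlip α

/-- `T₂₄` -/
def leg24 (T : Op (α × α)) : Op ((α × α) × (α × α)) := midFlip α * tensorOp 1 T * midFlip α

end legs

section heisenberg

/-- Euclidean `n`-space. -/
abbrev Vec (n : ℕ) : Type := EuclideanSpace ℝ (Fin n)

/-- The space of the variables `(x, y, r)`. -/
abbrev Pt (n : ℕ) : Type := Vec n × Vec n × ℝ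

instance instMeasureSpacePt (n : ℕ) : MeasureSpace (Pt n) := inferInstance

instance instSigmaFinitePt (n : ℕ) : SigmaFinite (volume : Measure (Pt n)) := inferInstance

variable (n : ℕ) (lam : ℝ)

/-- `e(t) = exp(2πit)` -/
def e (t : ℝ) : ℂ := Complex.exp (2 * Real.pi * Complex.I * t)

/-- `ē(t) = exp(-2πit)` -/
def ebar (t : ℝ) : ℂ := e (-t)

/-- `η_λ(r) = (e^{2λr} - 1) / (2λ)`, and `η_0(r) = r`. -/
def eta (r : ℝ) : ℝ := if lam = 0 then r else (Real.exp (2 * lam * r) - 1) / (2 * lam)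

variable {n}

/-- `β`, the usual inner product. -/
def beta (x y : Vec n) : ℝ := ⟪x, y⟫_ℝ

theorem norm_e (t : ℝ) : ‖e t‖ = 1 := by
  have : 2 * (Real.pi : ℂ) * Complex.I * t = ((2 * Real.pi * t : ℝ) : ℂ) * Complex.I := by
    push_cast; ring
  rw [e, this, Complex.norm_exp_ofReal_mul_I]

theorem norm_ebar (t : ℝ) : ‖ebar t‖ = 1 := norm_e _

@[fun_prop] theorem continuous_e : Continuous e := by unfold e; fun_prop

@[fun_prop] theorem continuous_ebar : Continuous ebar := by unfold ebar; fun_prop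

@[fun_prop] theorem continuous_eta : Continuous (eta lam) := by
  unfold eta; split_ifs <;> fun_prop

@[fun_prop] theorem continuous_beta {X : Type*} [TopologicalSpace X] {f g : X → Vec n}
    (hf : Continuous f) (hg : Continuous g) : Continuous fun p => beta (f p) (g p) := by
  unfold beta; exact hf.inner hg

variable (n)

theorem lintegral_scale {a : ℝ} (ha : 0 < a) (g : Vec n → ℝ≥0∞) (hg : Measurable g) :
    ENNReal.ofReal (a ^ n) * ∫⁻ x : Vec n, g (a • x) = ∫⁻ x, g x := by
  have h := Measure.map_addHaar_smul (volume : Measure (Vec n)) ha.ne'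
  have h1 : ∫⁻ x, g (a • x) = ∫⁻ x, g x ∂(Measure.map (a • ·) (volume : Measure (Vec n))) :=
    (lintegral_map hg (measurable_const_smul a)).symm
  rw [h1, h, lintegral_smul_measure, finrank_euclideanSpace_fin, smul_eq_mul, ← mul_assoc,
    ← ENNReal.ofReal_mul (by positivity), abs_of_pos (by positivity), mul_inv_cancel₀ (by positivity),
    ENNReal.ofReal_one, one_mul]

variable {n}

theorem lintegral_pt (g : Pt n → ℝ≥0∞) (hg : Measurable g) :
    ∫⁻ p, g p = ∫⁻ r, ∫⁻ x, ∫⁻ y, g (x, y, r) := by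
  rw [Measure.volume_eq_prod, lintegral_prod _ hg.aemeasurable]
  have : ∀ x : Vec n, ∫⁻ q : Vec n × ℝ, g (x, q) = ∫⁻ r, ∫⁻ y, g (x, y, r) := by
    intro x
    rw [Measure.volume_eq_prod, lintegral_prod_symm (fun q : Vec n × ℝ => g (x, q)) (by fun_prop)]
  simp only [this]
  rw [lintegral_lintegral_swap]
  exact (Measurable.lintegral_prod_right' (f := fun z : (Vec n × ℝ) × Vec n => g (z.1.1, z.2, z.1.2))
    (by fun_prop)).aemeasurable

theorem lintegral_pt_scale (g : Pt n → ℝ≥0∞) (hg : Measurable g) (a : ℝ → ℝ) (ha : ∀ r, 0 < a r)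
    (ham : Measurable a) :
    ∫⁻ p : Pt n, ENNReal.ofReal (a p.2.2 ^ n) ^ 2 * g (a p.2.2 • p.1, a p.2.2 • p.2.1, p.2.2)
      = ∫⁻ p, g p := by
  rw [lintegral_pt _ (by fun_prop), lintegral_pt _ hg]
  refine lintegral_congr fun r => ?_
  dsimp only
  have h1 : ∀ x : Vec n, ∫⁻ y : Vec n, ENNReal.ofReal (a r ^ n) ^ 2 * g (a r • x, a r • y, r)
      = ENNReal.ofReal (a r ^ n) * ∫⁻ y : Vec n, g (a r • x, y, r) := by
    intro x
    rw [lintegral_const_mul _ (by fun_prop), ← lintegral_scale n (ha r) (fun y => g (a r • x, y, r))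
      (by fun_prop), sq, mul_assoc]
  simp only [h1]
  rw [lintegral_const_mul _ (by fun_prop),
    lintegral_scale n (ha r) (fun x => ∫⁻ y : Vec n, g (x, y, r)) (by fun_prop)]

theorem isAddRightInvariant_pt : (volume : Measure (Pt n)).IsAddRightInvariant := by
  have h1 : (volume : Measure (Vec n × ℝ)).IsAddHaarMeasure :=
    Measure.prod.instIsAddHaarMeasure _ _
  have h2 : (volume : Measure (Pt n)).IsAddHaarMeasure :=
    Measure.prod.instIsAddHaarMeasure _ _
  infer_instance

variable (n)

/-- The phase and the change of variables of `J`. -/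
def cJ (p : Pt n) : ℂ := ebar (eta lam p.2.2 * beta p.1 p.2.1)

def tJ (p : Pt n) : Pt n := (-p.1, -p.2.1, p.2.2)

theorem isWeighted_J : IsWeighted (cJ n lam) (tJ n) := by
  refine .of_measurePreserving ?_ (fun p => norm_ebar _) ?_
  · unfold cJ; exact Continuous.measurable (by fun_prop)
  · have h := Measure.measurePreserving_neg (volume : Measure (Vec n))
    exact h.prod (h.prod (MeasurePreserving.id _))

/-- `J ξ(x, y, r) = ē[η_λ(r) β(x, y)] conj ξ(-x, -y, r)`. -/
def J : AntiOp (Pt n) := (weightedComp (cJ n lam) (tJ n) (isWeighted_J n lam)).comp conjL2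

def cJhat (p : Pt n) : ℂ := ((Real.exp (lam * p.2.2) ^ n : ℝ) : ℂ)

def tJhat (p : Pt n) : Pt n :=
  (Real.exp (lam * p.2.2) • p.1, Real.exp (lam * p.2.2) • p.2.1, -p.2.2)

theorem isWeighted_Jhat : IsWeighted (cJhat n lam) (tJhat n lam) where
  meas_c := by unfold cJhat; exact Continuous.measurable (by fun_prop)
  meas_τ := by unfold tJhat; exact Continuous.measurable (by fun_prop)
  ne_zero p := by simp [cJhat, Complex.exp_ne_zero]
  lintegral g hg := by
    have h : ∀ p, ‖cJhat n lam p‖ₑ = ENNReal.ofReal (Real.exp (lam * p.2.2) ^ n) := by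
      intro p
      rw [cJhat, ← ofReal_norm, Complex.norm_real, Real.norm_of_nonneg (by positivity)]
    simp only [h, tJhat]
    have h2 := lintegral_pt_scale (fun p => g (p.1, p.2.1, -p.2.2)) (by fun_prop)
      (fun r => Real.exp (lam * r)) (fun r => Real.exp_pos _) (by fun_prop)
    refine h2.trans ?_
    have hI : MeasurePreserving (id : Vec n → Vec n) := MeasurePreserving.id _
    have h3 := hI.prod (hI.prod (Measure.measurePreserving_neg (volume : Measure ℝ)))
    exact h3.lintegral_comp hg

/-- `Ĵ ξ(x, y, r) = (e^{λr})^n conj ξ(e^{λr}x, e^{λr}y, -r)`. -/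
def Jhat : AntiOp (Pt n) :=
  (weightedComp (cJhat n lam) (tJhat n lam) (isWeighted_Jhat n lam)).comp conjL2

/-- The unitary `j = Ĵ J`. -/
def jOp : Op (Pt n) := (Jhat n lam).comp (J n lam)

def cU (p : Pt n × Pt n) : ℂ :=
  ((Real.exp (-lam * p.2.2.2) ^ n : ℝ) : ℂ) *
    ebar (eta lam p.2.2.2 * beta (Real.exp (-lam * p.2.2.2) • p.1.1)
      (p.2.2.1 - Real.exp (-lam * p.2.2.2) • p.1.2.1))

def tU (p : Pt n × Pt n) : Pt n × Pt n :=
  ((Real.exp (-lam * p.2.2.2) • p.1.1, Real.exp (-lam * p.2.2.2) • p.1.2.1, p.1.2.2 + p.2.2.2),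
   (p.2.1 - Real.exp (-lam * p.2.2.2) • p.1.1, p.2.2.1 - Real.exp (-lam * p.2.2.2) • p.1.2.1,
    p.2.2.2))

theorem isWeighted_U : IsWeighted (cU n lam) (tU n lam) where
  meas_c := by unfold cU; exact Continuous.measurable (by fun_prop)
  meas_τ := by unfold tU; exact Continuous.measurable (by fun_prop)
  ne_zero p := by
    rw [← norm_ne_zero_iff, cU, norm_mul, norm_ebar, mul_one, Complex.norm_real]
    exact norm_ne_zero_iff.2 (pow_ne_zero _ (Real.exp_ne_zero _))
  lintegral g hg := by
    have h : ∀ p, ‖cU n lam p‖ₑ = ENNReal.ofReal (Real.exp (-lam * p.2.2.2) ^ n) := by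
      intro p
      rw [cU, ← ofReal_norm, norm_mul, norm_ebar, mul_one, Complex.norm_real,
        Real.norm_of_nonneg (by positivity)]
    have := isAddRightInvariant_pt (n := n)
    simp only [h, tU]
    have hg1 : Measurable fun p : Pt n × Pt n => g (p.1, p.2 - (p.1.1, p.1.2.1, 0)) :=
      hg.comp (Continuous.measurable (by fun_prop))
    have hg2 : Measurable fun p : Pt n × Pt n =>
        g ((p.1.1, p.1.2.1, p.1.2.2 + p.2.2.2), p.2 - (p.1.1, p.1.2.1, 0)) :=
      hg.comp (Continuous.measurable (by fun_prop))
    have hg3 : Measurable fun p : Pt n × Pt n =>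
        ENNReal.ofReal (Real.exp (-lam * p.2.2.2) ^ n) ^ 2 *
          g ((Real.exp (-lam * p.2.2.2) • p.1.1, Real.exp (-lam * p.2.2.2) • p.1.2.1,
            p.1.2.2 + p.2.2.2), (p.2.1 - Real.exp (-lam * p.2.2.2) • p.1.1,
            p.2.2.1 - Real.exp (-lam * p.2.2.2) • p.1.2.1, p.2.2.2)) := by
      refine Measurable.mul (by fun_prop) (hg.comp (Continuous.measurable (by fun_prop)))
    calc _ = ∫⁻ q : Pt n, ∫⁻ p : Pt n, ENNReal.ofReal (Real.exp (-lam * q.2.2) ^ n) ^ 2 *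
          g ((Real.exp (-lam * q.2.2) • p.1, Real.exp (-lam * q.2.2) • p.2.1,
            p.2.2 + q.2.2), (q.1 - Real.exp (-lam * q.2.2) • p.1,
            q.2.1 - Real.exp (-lam * q.2.2) • p.2.1, q.2.2)) :=
          lintegral_prod_symm _ hg3.aemeasurable
      _ = ∫⁻ q : Pt n, ∫⁻ p : Pt n, g ((p.1, p.2.1, p.2.2 + q.2.2), q - (p.1, p.2.1, 0)) := by
          refine lintegral_congr fun q => ?_
          have := lintegral_pt_scale
            (fun p : Pt n => g ((p.1, p.2.1, p.2.2 + q.2.2), q - (p.1, p.2.1, 0)))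
            (hg2.comp (measurable_id.prodMk measurable_const))
            (fun _ => Real.exp (-lam * q.2.2)) (fun _ => Real.exp_pos _) measurable_const
          rw [← this]
          refine lintegral_congr fun p => ?_
          congr 3
          refine Prod.ext rfl (Prod.ext rfl ?_)
          exact (sub_zero _).symm
      _ = ∫⁻ q : Pt n, ∫⁻ p : Pt n, g (p, q - (p.1, p.2.1, 0)) := by
          refine lintegral_congr fun q => ?_
          rw [← lintegral_add_right_eq_self (fun p : Pt n => g (p, q - (p.1, p.2.1, 0)))
            ((0, 0, q.2.2) : Pt n)]
          refine lintegral_congr fun p => ?_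
          simp [Prod.add_def]
      _ = ∫⁻ p : Pt n, ∫⁻ q : Pt n, g (p, q - (p.1, p.2.1, 0)) :=
          lintegral_lintegral_swap (f := fun q p : Pt n => g (p, q - (p.1, p.2.1, 0)))
            (hg1.comp measurable_swap).aemeasurable
      _ = ∫⁻ p : Pt n, ∫⁻ q : Pt n, g (p, q) :=
          lintegral_congr fun p => lintegral_sub_right_eq_self (fun q : Pt n => g (p, q)) _
      _ = ∫⁻ p, g p := (lintegral_prod _ hg.aemeasurable).symm

/-- The multiplicative unitary `U_A`. -/
def UA : Op (Pt n × Pt n) := weightedComp (cU n lam) (tU n lam) (isWeighted_U n lam)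

end heisenberg

section kernels

variable {α Q : Type} [MeasureSpace α] [MeasureSpace Q] [SFinite (volume : Measure α)]
  [SFinite (volume : Measure Q)]

/-- Bounds (Schur test) under which `(T ξ)(p) = ∫ k(p, q) ξ(τ(p, q)) dq` is a bounded operator
on `L²(α)`. -/
structure IsSchur (k : α → Q → ℂ) (τ : α → Q → α) (C D : ℝ≥0) : Prop where
  meas_k : Measurable (Function.uncurry k)
  meas_τ : Measurable (Function.uncurry τ)
  row : ∀ p, ∫⁻ q, ‖k p q‖ₑ ≤ C
  col : ∀ g : α → ℝ≥0∞, Measurable g → ∫⁻ p, ∫⁻ q, ‖k p q‖ₑ * g (τ p q) ≤ D * ∫⁻ p, g p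

variable {k : α → Q → ℂ} {τ : α → Q → α} {C D : ℝ≥0}

theorem lintegral_mul_sq_le {f g : Q → ℝ≥0∞} (hf : Measurable f) (hg : Measurable g) :
    (∫⁻ q, f q * g q) ^ 2 ≤ (∫⁻ q, f q) * ∫⁻ q, f q * g q ^ 2 := by
  have h := ENNReal.lintegral_mul_le_Lp_mul_Lq (volume : Measure Q)
    (p := 2) (q := 2) Real.HolderConjugate.two_two (f := fun q => f q ^ (1 / 2 : ℝ))
    (g := fun q => f q ^ (1 / 2 : ℝ) * g q) (by fun_prop) (by fun_prop)
  have e1 : ∀ x : ℝ≥0∞, (x ^ (1 / 2 : ℝ)) ^ (2 : ℝ) = x := fun x => by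
    rw [← ENNReal.rpow_mul]; norm_num
  have e2 : ∀ x : ℝ≥0∞, x ^ (1 / 2 : ℝ) * x ^ (1 / 2 : ℝ) = x := fun x => by
    rw [← ENNReal.rpow_add_of_nonneg _ _ (by norm_num) (by norm_num)]; norm_num
  simp only [Pi.mul_apply, ← mul_assoc, e2, ENNReal.mul_rpow_of_nonneg _ _ (zero_le_two), e1] at h
  calc (∫⁻ q, f q * g q) ^ 2 ≤ _ := pow_le_pow_left₀ (bot_le) h 2
    _ = _ := by
      rw [mul_pow, ← ENNReal.rpow_two, ← ENNReal.rpow_two, e1, e1]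
      simp only [ENNReal.rpow_two]

theorem IsSchur.col_sq (h : IsSchur k τ C D) (ξ : L2 α) :
    ∫⁻ p, ∫⁻ q, ‖k p q‖ₑ * ‖ξ (τ p q)‖ₑ ^ 2 ≤ D * ∫⁻ p, ‖ξ p‖ₑ ^ 2 :=
  h.col _ ((Lp.stronglyMeasurable ξ).measurable.enorm.pow_const 2)

theorem L2_lintegral_lt_top (ξ : L2 α) : ∫⁻ p, ‖ξ p‖ₑ ^ 2 < ∞ := by
  have := (Lp.memLp ξ).eLpNorm_lt_top
  rw [eLpNorm_lt_top_iff_lintegral_rpow_enorm_lt_top (by norm_num) (by norm_num)] at this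
  simpa using this

theorem IsSchur.meas_integrand (h : IsSchur k τ C D) (ξ : L2 α) :
    Measurable (Function.uncurry fun p q => k p q * ξ (τ p q)) :=
  h.meas_k.mul ((Lp.stronglyMeasurable ξ).measurable.comp h.meas_τ)

theorem IsSchur.sq_le (h : IsSchur k τ C D) (ξ : L2 α) (p : α) :
    (∫⁻ q, ‖k p q * ξ (τ p q)‖ₑ) ^ 2 ≤ C * ∫⁻ q, ‖k p q‖ₑ * ‖ξ (τ p q)‖ₑ ^ 2 := by
  simp only [enorm_mul]
  refine (lintegral_mul_sq_le (f := fun q => ‖k p q‖ₑ) (g := fun q => ‖ξ (τ p q)‖ₑ)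
    (h.meas_k.comp measurable_prodMk_left).enorm
    ((Lp.stronglyMeasurable ξ).measurable.comp (h.meas_τ.comp measurable_prodMk_left)).enorm).trans
    ?_
  gcongr
  exact h.row p

theorem IsSchur.integrable (h : IsSchur k τ C D) (ξ : L2 α) :
    ∀ᵐ p, Integrable fun q => k p q * ξ (τ p q) := by
  have h1 : ∀ᵐ p, ∫⁻ q, ‖k p q‖ₑ * ‖ξ (τ p q)‖ₑ ^ 2 < ∞ := by
    refine ae_lt_top ?_ ((h.col_sq ξ).trans_lt
      (ENNReal.mul_lt_top ENNReal.coe_lt_top (L2_lintegral_lt_top ξ))).ne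
    exact Measurable.lintegral_prod_right' (f := fun z : α × Q =>
      ‖k z.1 z.2‖ₑ * ‖ξ (τ z.1 z.2)‖ₑ ^ 2) (h.meas_k.enorm.mul
      (((Lp.stronglyMeasurable ξ).measurable.comp h.meas_τ).enorm.pow_const 2))
  filter_upwards [h1] with p hp
  refine ⟨((h.meas_integrand ξ).comp measurable_prodMk_left).aestronglyMeasurable, ?_⟩
  have h2 := (h.sq_le ξ p).trans_lt (ENNReal.mul_lt_top ENNReal.coe_lt_top hp)
  simpa [HasFiniteIntegral] using h2

theorem IsSchur.eLpNorm_le (h : IsSchur k τ C D) (ξ : L2 α) :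
    eLpNorm (fun p => ∫ q, k p q * ξ (τ p q)) 2 volume
      ≤ ENNReal.ofReal (Real.sqrt (C * D)) * eLpNorm ξ 2 volume := by
  have key : ∫⁻ p, ‖∫ q, k p q * ξ (τ p q)‖ₑ ^ 2 ≤ (C * D : ℝ≥0) * ∫⁻ p, ‖ξ p‖ₑ ^ 2 := by
    calc ∫⁻ p, ‖∫ q, k p q * ξ (τ p q)‖ₑ ^ 2
        ≤ ∫⁻ p, C * ∫⁻ q, ‖k p q‖ₑ * ‖ξ (τ p q)‖ₑ ^ 2 := by
          refine lintegral_mono fun p => ?_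
          exact (pow_le_pow_left₀ (bot_le) (enorm_integral_le_lintegral_enorm _) 2).trans
            (h.sq_le ξ p)
      _ = C * ∫⁻ p, ∫⁻ q, ‖k p q‖ₑ * ‖ξ (τ p q)‖ₑ ^ 2 := lintegral_const_mul' _ _ (by simp)
      _ ≤ C * (D * ∫⁻ p, ‖ξ p‖ₑ ^ 2) := by gcongr; exact h.col_sq ξ
      _ = _ := by rw [← mul_assoc, ENNReal.coe_mul]
  rw [eLpNorm_eq_lintegral_rpow_enorm_toReal (by norm_num) (by norm_num),
    eLpNorm_eq_lintegral_rpow_enorm_toReal (by norm_num) (by norm_num)]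
  simp only [ENNReal.toReal_ofNat, ENNReal.rpow_two]
  refine (ENNReal.rpow_le_rpow key (by norm_num)).trans ?_
  rw [ENNReal.mul_rpow_of_nonneg _ _ (by norm_num), Real.sqrt_eq_rpow,
    ← ENNReal.ofReal_rpow_of_nonneg (by positivity) (by norm_num), ← NNReal.coe_mul,
    ENNReal.ofReal_coe_nnreal]

theorem IsSchur.memLp (h : IsSchur k τ C D) (ξ : L2 α) :
    MemLp (fun p => ∫ q, k p q * ξ (τ p q)) 2 (volume : Measure α) := by
  refine ⟨?_, (h.eLpNorm_le ξ).trans_lt (ENNReal.mul_lt_top ENNReal.ofReal_lt_top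
    (Lp.memLp ξ).2)⟩
  exact ((h.meas_integrand ξ).stronglyMeasurable.integral_prod_right').aestronglyMeasurable

theorem IsSchur.ae (h : IsSchur k τ C D) {P : α → Prop} (hP : ∀ᵐ a, P a) :
    ∀ᵐ p, ∀ᵐ q, k p q = 0 ∨ P (τ p q) := by
  obtain ⟨s, hs, hsm, hs0⟩ := exists_measurable_superset_of_null (ae_iff.1 hP)
  have h1 := h.col (s.indicator 1) (measurable_one.indicator hsm)
  rw [lintegral_indicator_one hsm, hs0, mul_zero, nonpos_iff_eq_zero] at h1
  have hm : Measurable fun z : α × Q => ‖k z.1 z.2‖ₑ * s.indicator 1 (τ z.1 z.2) :=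
    h.meas_k.enorm.mul ((measurable_one.indicator hsm).comp h.meas_τ)
  have h2 := (lintegral_eq_zero_iff hm.lintegral_prod_right').1 h1
  filter_upwards [h2] with p hp
  have h3 := (lintegral_eq_zero_iff (hm.comp measurable_prodMk_left)).1 hp
  filter_upwards [h3] with q hq
  by_contra hcon
  push Not at hcon
  have : τ p q ∈ s := hs hcon.2
  simp [this, hcon.1] at hq

/-- The operator `(T ξ)(p) = ∫ k(p, q) ξ(τ(p, q)) dq`. -/
def kernelOp (k : α → Q → ℂ) (τ : α → Q → α) {C D : ℝ≥0} (h : IsSchur k τ C D) : Op α :=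
  LinearMap.mkContinuous
    { toFun := fun ξ => (h.memLp ξ).toLp _
      map_add' := fun ξ η => by
        apply Lp.ext
        filter_upwards [(h.memLp (ξ + η)).coeFn_toLp, (h.memLp ξ).coeFn_toLp,
          (h.memLp η).coeFn_toLp, h.ae (Lp.coeFn_add ξ η), h.integrable ξ, h.integrable η,
          Lp.coeFn_add ((h.memLp ξ).toLp _) ((h.memLp η).toLp _)] with p h1 h2 h3 h4 h6 h7 h5
        rw [h1, h5, Pi.add_apply, h2, h3, ← integral_add h6 h7]
        refine integral_congr_ae ?_
        filter_upwards [h4] with q hq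
        rcases hq with hq | hq
        · simp [hq]
        · rw [hq, Pi.add_apply, mul_add]
      map_smul' := fun a ξ => by
        apply Lp.ext
        filter_upwards [(h.memLp (a • ξ)).coeFn_toLp, (h.memLp ξ).coeFn_toLp,
          h.ae (Lp.coeFn_smul a ξ),
          Lp.coeFn_smul a ((h.memLp ξ).toLp _)] with p h1 h2 h3 h4
        rw [h1, RingHom.id_apply, h4, Pi.smul_apply, h2, smul_eq_mul, ← integral_const_mul]
        refine integral_congr_ae ?_
        filter_upwards [h3] with q hq
        rcases hq with hq | hq
        · simp [hq]
        · rw [hq, Pi.smul_apply, smul_eq_mul]; ring } (Real.sqrt (C * D)) (fun ξ => by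
      rw [LinearMap.coe_mk, AddHom.coe_mk, Lp.norm_toLp, Lp.norm_def,
        ← ENNReal.toReal_ofReal (Real.sqrt_nonneg (C * D)), ← ENNReal.toReal_mul]
      exact ENNReal.toReal_mono (ENNReal.mul_lt_top ENNReal.ofReal_lt_top (Lp.memLp ξ).2).ne
        (h.eLpNorm_le ξ))

theorem coeFn_kernelOp (h : IsSchur k τ C D) (ξ : L2 α) :
    kernelOp k τ h ξ =ᵐ[volume] fun p => ∫ q, k p q * ξ (τ p q) := (h.memLp ξ).coeFn_toLp

end kernels

section functions

open scoped SchwartzMap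

variable (n : ℕ) (lam : ℝ)

/-- The space `𝒜` (which is also `𝒜̂`) of Schwartz functions in `(x, y, r)` with compact support
in the variable `r`. -/
def FunAlg : Set 𝓢(Pt n, ℂ) := {f | ∃ R : ℝ, ∀ x y r, R < |r| → f (x, y, r) = 0}

variable {n}

theorem schwartz_bound {E : Type} [NormedAddCommGroup E] [NormedSpace ℝ E] (f : 𝓢(E, ℂ)) (m : ℕ) :
    ∃ C : ℝ, 0 ≤ C ∧ ∀ p, ‖f p‖ ≤ C * (1 + ‖p‖) ^ (-(m : ℝ)) := by
  obtain ⟨C, hC⟩ : ∃ C : ℝ, ∀ p, (1 + ‖p‖) ^ m * ‖f p‖ ≤ C := by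
    have h := fun p => SchwartzMap.one_add_le_sup_seminorm_apply (𝕜 := ℝ) (m := (m, 0)) (k := m)
      (n := 0) le_rfl le_rfl f p
    simp only [norm_iteratedFDeriv_zero] at h
    exact ⟨_, h⟩
  have h0 : 0 ≤ C := le_trans (by positivity) (hC 0)
  refine ⟨C, h0, fun p => ?_⟩
  rw [Real.rpow_neg (by positivity), Real.rpow_natCast, ← div_eq_mul_inv,
    le_div_iff₀ (by positivity), mul_comm]
  exact hC p

theorem lintegral_decay {E : Type} [NormedAddCommGroup E] [NormedSpace ℝ E] [FiniteDimensional ℝ E]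
    [MeasureSpace E] [BorelSpace E] (hE : (volume : Measure E).IsAddHaarMeasure) (C : ℝ)
    (hC : 0 ≤ C) (m : ℕ) (hm : Module.finrank ℝ E < m) :
    ∃ D : ℝ≥0, ∫⁻ q : E, ENNReal.ofReal (C * (1 + ‖q‖) ^ (-(m : ℝ))) = D := by
  have h : ∫⁻ q : E, ENNReal.ofReal (C * (1 + ‖q‖) ^ (-(m : ℝ))) < ∞ := by
    simp only [ENNReal.ofReal_mul hC]
    rw [lintegral_const_mul' _ _ ENNReal.ofReal_ne_top]
    exact ENNReal.mul_lt_top ENNReal.ofReal_lt_top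
      (finite_integral_one_add_norm (by exact_mod_cast hm))
  exact ⟨_, (ENNReal.coe_toNNReal h.ne).symm⟩

theorem decay_mono {C a b : ℝ} (hC : 0 ≤ C) (ha : 0 ≤ a) (hab : a ≤ b) (m : ℕ) :
    C * (1 + b) ^ (-(m : ℝ)) ≤ C * (1 + a) ^ (-(m : ℝ)) := by
  refine mul_le_mul_of_nonneg_left ?_ hC
  exact Real.rpow_le_rpow_of_nonpos (by positivity) (by linarith) (by simp)

def kL (f : 𝓢(Pt n, ℂ)) (p : Pt n) (q : Vec n × Vec n) : ℂ :=
  f (q.1, q.2, p.2.2) * ebar (eta lam p.2.2 * beta q.1 (p.2.1 - q.2))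

def tL (p : Pt n) (q : Vec n × Vec n) : Pt n := (p.1 - q.1, p.2.1 - q.2, p.2.2)

theorem isSchur_L (f : 𝓢(Pt n, ℂ)) : ∃ C D : ℝ≥0, IsSchur (kL lam f) (tL (n := n)) C D := by
  obtain ⟨C, hC, hf⟩ := schwartz_bound f (Module.finrank ℝ (Vec n × Vec n) + 1)
  obtain ⟨D, hD⟩ := lintegral_decay (E := Vec n × Vec n)
    (Measure.prod.instIsAddHaarMeasure _ _) C hC _ (Nat.lt_succ_self _)
  have hb : ∀ (p : Pt n) (q : Vec n × Vec n), ‖kL lam f p q‖ₑ ≤ ENNReal.ofReal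
      (C * (1 + ‖q‖) ^ (-((Module.finrank ℝ (Vec n × Vec n) + 1 : ℕ) : ℝ))) := by
    intro p q
    rw [kL, ← ofReal_norm, norm_mul, norm_ebar, mul_one]
    refine ENNReal.ofReal_le_ofReal ((hf _).trans (decay_mono hC (norm_nonneg _) ?_ _))
    rw [Prod.norm_def, Prod.norm_def, Prod.norm_def]
    exact sup_le_sup le_rfl le_sup_left
  have hR := isAddRightInvariant_pt (n := n)
  refine ⟨D, D, ⟨?_, ?_, fun p => ?_, fun g hg => ?_⟩⟩
  · unfold kL Function.uncurry
    exact Continuous.measurable (by have := f.continuous; fun_prop)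
  · unfold tL Function.uncurry
    exact Continuous.measurable (by fun_prop)
  · exact (lintegral_mono (hb p)).trans hD.le
  · calc ∫⁻ p, ∫⁻ q, ‖kL lam f p q‖ₑ * g (tL p q)
        ≤ ∫⁻ p : Pt n, ∫⁻ q : Vec n × Vec n, ENNReal.ofReal
          (C * (1 + ‖q‖) ^ (-((Module.finrank ℝ (Vec n × Vec n) + 1 : ℕ) : ℝ))) * g (tL p q) :=
          lintegral_mono fun p => lintegral_mono fun q => mul_le_mul_left (hb p q) _
      _ = ∫⁻ q : Vec n × Vec n, ∫⁻ p : Pt n, ENNReal.ofReal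
          (C * (1 + ‖q‖) ^ (-((Module.finrank ℝ (Vec n × Vec n) + 1 : ℕ) : ℝ))) * g (tL p q) := by
          refine lintegral_lintegral_swap (Measurable.aemeasurable ?_)
          refine Measurable.mul (by fun_prop) (hg.comp ?_)
          unfold tL; exact Continuous.measurable (by fun_prop)
      _ = ∫⁻ q : Vec n × Vec n, ENNReal.ofReal
          (C * (1 + ‖q‖) ^ (-((Module.finrank ℝ (Vec n × Vec n) + 1 : ℕ) : ℝ))) * ∫⁻ p, g p := by
          refine lintegral_congr fun q => ?_
          rw [lintegral_const_mul' _ _ ENNReal.ofReal_ne_top,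
            ← lintegral_sub_right_eq_self g ((q.1, q.2, 0) : Pt n)]
          simp [tL, Prod.sub_def]
      _ ≤ D * ∫⁻ p, g p := by
          rw [lintegral_mul_const _ (by fun_prop), hD]

/-- `(L_f ξ)(x, y, r) = ∫ f(x̃, ỹ, r) ξ(x - x̃, y - ỹ, r) ē[η_λ(r) β(x̃, y - ỹ)] dx̃ dỹ`. -/
def Lrep (f : 𝓢(Pt n, ℂ)) : Op (Pt n) :=
  kernelOp (kL lam f) tL (isSchur_L lam f).choose_spec.choose_spec

def kLam (φ : 𝓢(Pt n, ℂ)) (p : Pt n) (s : ℝ) : ℂ :=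
  φ (Real.exp (lam * s) • p.1, Real.exp (lam * s) • p.2.1, p.2.2 - s)

def tLam (p : Pt n) (s : ℝ) : Pt n := (p.1, p.2.1, s)

theorem isSchur_Lam (φ : 𝓢(Pt n, ℂ)) : ∃ C D : ℝ≥0, IsSchur (kLam lam φ) (tLam (n := n)) C D := by
  obtain ⟨C, hC, hf⟩ := schwartz_bound φ 2
  obtain ⟨D, hD⟩ := lintegral_decay (E := ℝ) inferInstance C hC 2 (by simp)
  have hb : ∀ (p : Pt n) (s : ℝ), ‖kLam lam φ p s‖ₑ ≤ ENNReal.ofReal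
      (C * (1 + ‖p.2.2 - s‖) ^ (-((2 : ℕ) : ℝ))) := by
    intro p q
    rw [kLam, ← ofReal_norm]
    refine ENNReal.ofReal_le_ofReal ((hf _).trans (decay_mono hC (norm_nonneg _) ?_ _))
    rw [Prod.norm_def, Prod.norm_def]
    exact le_sup_of_le_right le_sup_right
  refine ⟨D, D, ⟨?_, ?_, fun p => ?_, fun g hg => ?_⟩⟩
  · unfold kLam Function.uncurry
    exact Continuous.measurable (by have := φ.continuous; fun_prop)
  · unfold tLam Function.uncurry
    exact Continuous.measurable (by fun_prop)
  · refine (lintegral_mono (hb p)).trans (le_of_eq ?_)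
    rw [← hD]
    exact lintegral_sub_left_eq_self
      (fun t : ℝ => ENNReal.ofReal (C * (1 + ‖t‖) ^ (-((2 : ℕ) : ℝ)))) p.2.2
  · have hm : Measurable fun t : ℝ => ENNReal.ofReal (C * (1 + ‖t‖) ^ (-((2 : ℕ) : ℝ))) := by
      fun_prop
    have hm1 : Measurable fun p : Pt n => ∫⁻ s : ℝ, ENNReal.ofReal
        (C * (1 + ‖p.2.2 - s‖) ^ (-((2 : ℕ) : ℝ))) * g (tLam p s) := by
      refine Measurable.lintegral_prod_right' (f := fun z : Pt n × ℝ => ENNReal.ofReal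
        (C * (1 + ‖z.1.2.2 - z.2‖) ^ (-((2 : ℕ) : ℝ))) * g (tLam z.1 z.2)) ?_
      refine Measurable.mul (by fun_prop) (hg.comp ?_)
      unfold tLam; exact Continuous.measurable (by fun_prop)
    calc ∫⁻ p, ∫⁻ s, ‖kLam lam φ p s‖ₑ * g (tLam p s)
        ≤ ∫⁻ p : Pt n, ∫⁻ s : ℝ, ENNReal.ofReal
          (C * (1 + ‖p.2.2 - s‖) ^ (-((2 : ℕ) : ℝ))) * g (tLam p s) :=
          lintegral_mono fun p => lintegral_mono fun q => mul_le_mul_left (hb p q) _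
      _ = ∫⁻ x : Vec n, ∫⁻ y : Vec n, ∫⁻ r : ℝ, ∫⁻ s : ℝ, ENNReal.ofReal
          (C * (1 + ‖r - s‖) ^ (-((2 : ℕ) : ℝ))) * g (x, y, s) := by
          refine (lintegral_prod (fun p : Pt n => ∫⁻ s : ℝ, ENNReal.ofReal
            (C * (1 + ‖p.2.2 - s‖) ^ (-((2 : ℕ) : ℝ))) * g (p.1, p.2.1, s))
            hm1.aemeasurable).trans (lintegral_congr fun x => ?_)
          exact lintegral_prod (fun q : Vec n × ℝ => ∫⁻ s : ℝ, ENNReal.ofReal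
            (C * (1 + ‖q.2 - s‖) ^ (-((2 : ℕ) : ℝ))) * g (x, q.1, s))
            (hm1.comp measurable_prodMk_left).aemeasurable
      _ = ∫⁻ x : Vec n, ∫⁻ y : Vec n, ∫⁻ s : ℝ, D * g (x, y, s) := by
          refine lintegral_congr fun x => lintegral_congr fun y => ?_
          rw [lintegral_lintegral_swap (Measurable.aemeasurable (by fun_prop))]
          refine lintegral_congr fun s => ?_
          rw [lintegral_mul_const _ (by fun_prop), ← hD]
          congr 1
          exact lintegral_sub_right_eq_self
            (fun t : ℝ => ENNReal.ofReal (C * (1 + ‖t‖) ^ (-((2 : ℕ) : ℝ)))) s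
      _ = ∫⁻ x : Vec n, ∫⁻ q : Vec n × ℝ, D * g (x, q) := by
          refine lintegral_congr fun x => ?_
          exact (lintegral_prod (fun q : Vec n × ℝ => (D : ℝ≥0∞) * g (x, q))
            (Measurable.aemeasurable (by fun_prop))).symm
      _ = ∫⁻ p : Pt n, D * g p :=
          (lintegral_prod (fun q : Pt n => (D : ℝ≥0∞) * g q)
            (hg.const_mul _).aemeasurable).symm
      _ ≤ D * ∫⁻ p, g p := (lintegral_const_mul' _ _ ENNReal.coe_ne_top).le

/-- `(λ_φ ξ)(x, y, r) = ∫ φ(e^{λs}x, e^{λs}y, r - s) ξ(x, y, s) ds`. -/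
def lamRep (φ : 𝓢(Pt n, ℂ)) : Op (Pt n) :=
  kernelOp (kLam lam φ) tLam (isSchur_Lam lam φ).choose_spec.choose_spec

end functions

section double

open scoped SchwartzMap

variable (n : ℕ) (lam : ℝ)

/-- The unitary `j ⊗ 1`. -/
def j1 : Op (Pt n × Pt n) := tensorOp (jOp n lam) 1

/-- The unitary `j ⊗ j`. -/
def jj : Op (Pt n × Pt n) := tensorOp (jOp n lam) (jOp n lam)

/-- `Y = Û_A = Σ (j ⊗ 1) U_A (j ⊗ 1) Σ`. -/
def Yop : Op (Pt n × Pt n) := flip (Pt n) * j1 n lam * UA n lam * j1 n lam * flip (Pt n)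

/-- `X = Σ Û_A^* Σ`. -/
def Xop : Op (Pt n × Pt n) := flip (Pt n) * star (Yop n lam) * flip (Pt n)

/-- `Z = Y^* (j ⊗ j) Y (j ⊗ j)`. -/
def Zop : Op (Pt n × Pt n) := star (Yop n lam) * (jj n lam * Yop n lam * jj n lam)

/-- The multiplicative unitary `V_D = Z₁₂ Y₂₄ Z₁₂^* X₁₃` of the quantum double. -/
def VD : Op ((Pt n × Pt n) × (Pt n × Pt n)) :=
  leg12 (Zop n lam) * leg24 (Yop n lam) * star (leg12 (Zop n lam)) * leg13 (Xop n lam)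

/-- `A_D`, the norm closure of the set of right slices of `V_D`. -/
def AD : Set (Op (Pt n × Pt n)) := closure (rightSlices (VD n lam))

/-- `Δ_D(x) = V_D^* (1 ⊗ 1 ⊗ x) V_D`. -/
def DeltaD (x : Op (Pt n × Pt n)) : Op ((Pt n × Pt n) × (Pt n × Pt n)) :=
  star (VD n lam) * tensorOp 1 x * VD n lam

/-- `Δ_D^cop = χ ∘ Δ_D`, where `χ` flips legs `1 ↔ 3` and `2 ↔ 4`. -/
def DeltaDcop (x : Op (Pt n × Pt n)) : Op ((Pt n × Pt n) × (Pt n × Pt n)) :=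
  flip (Pt n × Pt n) * DeltaD n lam x * flip (Pt n × Pt n)

/-- `S(a) = Ĵ a^* Ĵ`. -/
def S (a : Op (Pt n)) : Op (Pt n) := (Jhat n lam).comp ((star a).comp (Jhat n lam))

/-- `Ŝ(b) = J b^* J`. -/
def Shat (b : Op (Pt n)) : Op (Pt n) := (J n lam).comp ((star b).comp (J n lam))

/-- `π(a) = Z (1 ⊗ a) Z^*`. -/
def piA (a : Op (Pt n)) : Op (Pt n × Pt n) := Zop n lam * tensorOp 1 a * star (Zop n lam)

/-- `π'(b) = b ⊗ 1`. -/
def piAhat (b : Op (Pt n)) : Op (Pt n × Pt n) := tensorOp b 1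

variable {n} in
/-- `Π(φ ⊗ f) = π'(λ_φ) π(L_f)`. -/
def PiD (φ f : 𝓢(Pt n, ℂ)) : Op (Pt n × Pt n) := piAhat n (lamRep lam φ) * piA n lam (Lrep lam f)

/-- `Ĵ_D = J ⊗ Ĵ`. -/
def JDhat : AntiOp (Pt n × Pt n) := tensorAnti (J n lam) (Jhat n lam)

/-- `S_D(x) = Ĵ_D x^* Ĵ_D`. -/
def SD (x : Op (Pt n × Pt n)) : Op (Pt n × Pt n) :=
  (JDhat n lam).comp ((star x).comp (JDhat n lam))

/-- The map `S_D ⊗ S_D`, implemented spatially by `T ↦ (Ĵ_D ⊗ Ĵ_D) T^* (Ĵ_D ⊗ Ĵ_D)`. -/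
def SDtensorSD (T : Op ((Pt n × Pt n) × (Pt n × Pt n))) : Op ((Pt n × Pt n) × (Pt n × Pt n)) :=
  (tensorAnti (JDhat n lam) (JDhat n lam)).comp
    ((star T).comp (tensorAnti (JDhat n lam) (JDhat n lam)))

theorem star_tensorOp {α β : Type} [MeasureSpace α] [MeasureSpace β]
    [SigmaFinite (volume : Measure α)] [SigmaFinite (volume : Measure β)] (a : Op α) (b : Op β) :
    star (tensorOp a b) = tensorOp (star a) (star b) := by
  refine ext_tmulL2 fun f g => ?_
  rw [tensorOp_tmulL2]
  have h : innerSL ℂ (star (tensorOp a b) (tmulL2 f g))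
      = innerSL ℂ (tmulL2 (star a f) (star b g)) := by
    refine ext_tmulL2 fun f' g' => ?_
    simp only [innerSL_apply_apply, ContinuousLinearMap.star_eq_adjoint,
      ContinuousLinearMap.adjoint_inner_left, tensorOp_tmulL2, inner_tmulL2]
  exact (innerSL ℂ).toLinearMap.ker_eq_bot.1 (by
    rw [LinearMap.ker_eq_bot']; intro m hm
    have := DFunLike.congr_fun hm m
    simpa using this) h

/-- The map `S_D ⊗ S_D` acts on elementary tensors as its name says. -/
theorem SDtensorSD_tensorOp (a b : Op (Pt n × Pt n)) :
    SDtensorSD n lam (tensorOp a b) = tensorOp (SD n lam a) (SD n lam b) := by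
  refine ext_tmulL2 fun f g => ?_
  simp only [SDtensorSD, SD, star_tensorOp, ContinuousLinearMap.comp_apply, tensorAnti_tmulL2,
    tensorOp_tmulL2]

end double

end

end QDouble

/-! Apart from the kernel operators `Lrep`, `lamRep` and the slices, every operator involved has the
form ξ ↦ c·(ξ∘τ), or ξ ↦ c·conj(ξ∘τ) in the conjugate-linear case. Two such operators coincide once
their weights and point maps do, so an identity between composites reduces to algebra in e^{λr}, η_λ
and β, driven by the addition formulas of the first two. This gives a closed form for V_D
(`isWC_VD`) and its pentagon equation (`isMultiplicativeUnitary_VD`).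

The antipode is governed by a second antiunitary involution K_D = Z(Ĵ ⊗ J), for which (Ĵ_D ⊗ K_D)
V_D^* (Ĵ_D ⊗ K_D) = V_D (`antiConj_VD`). Hence S_D sends the slice of V_D by ω_{ξ,η} to the slice by
ω_{K_Dη, K_Dξ}, and so preserves the closed span of the slices, which is A_D
(`closure_rightSlices`). By the pentagon equation Δ_D of a slice is the corresponding slice of
V₁₃V₂₃. Since S_D ⊗ S_D reverses products, it produces a slice of V₂₃V₁₃, which is the flipped
coproduct of the transformed slice.

Closure of A_D under products also comes from the pentagon equation. For adjoints, a slice of V_D by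
elementary tensors factors as π(a)π'(b) with a a slice of Y and b a slice of X (`vecSlice_VD`).
Adjoints of slices of X and of Y are again slices of the same operator, so the adjoint is a product
π'(b')π(a') in the wrong order. The antimultiplicative S_D, which maps π(a) to π(S(a)) and π'(b) to
π'(Ŝ(b)), restores the order (`piAhat_mul_piA_mem`).

It remains to place L_f and λ_φ in the closed slice spans of Y and X. The operator λ_φ is a norm
limit of slices of X, obtained by testing against normalised indicators of shrinking boxes
(`norm_lamRep_sub_vecSlice_le`). The operator L_f is exactly one slice of Y: the fundamental theorem
of calculus along a flow writes f as the r-integral that such a slice computes (`Lrep_eq_vecSlice`).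
-/

namespace QDouble

/-! ### Calculus of weighted composition operators -/

section weightedCompositions

variable {α β γ δ : Type} [MeasureSpace α] [MeasureSpace β] [MeasureSpace γ] [MeasureSpace δ]

theorem IsWeighted.comp {c : α → ℂ} {τ : α → β} {c' : β → ℂ} {τ' : β → γ}
    (h : IsWeighted c τ) (h' : IsWeighted c' τ') :
    IsWeighted (fun p => c p * c' (τ p)) (fun p => τ' (τ p)) where
  meas_c := h.meas_c.mul (h'.meas_c.comp h.meas_τ)
  meas_τ := h'.meas_τ.comp h.meas_τ
  ne_zero p := mul_ne_zero (h.ne_zero _) (h'.ne_zero _)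
  lintegral g hg := by
    rw [← h'.lintegral g hg, ← h.lintegral (fun q => ‖c' q‖ₑ ^ 2 * g (τ' q))
      ((h'.meas_c.enorm.pow_const 2).mul (hg.comp h'.meas_τ))]
    simp only [enorm_mul, mul_pow, mul_assoc]

theorem IsWeighted.conj {c : α → ℂ} {τ : α → β} (h : IsWeighted c τ) :
    IsWeighted (fun p => conj (c p)) τ where
  meas_c := Complex.continuous_conj.measurable.comp h.meas_c
  meas_τ := h.meas_τ
  ne_zero p := by simpa using h.ne_zero p
  lintegral g hg := by
    rw [← h.lintegral g hg]
    refine lintegral_congr fun p => ?_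
    rw [← ofReal_norm, ← ofReal_norm, RCLike.norm_conj]

theorem IsWeighted.id : IsWeighted (fun _ : α => (1 : ℂ)) (fun p => p) :=
  .of_measurePreserving measurable_const (by simp) (MeasurePreserving.id _)

/-- Substitute q = τ(p) in the integral over β: the factors |c|² and |c'∘τ|² cancel. No Jacobian has
to be computed for the inverse map. -/
theorem IsWeighted.inv {c : α → ℂ} {τ : α → β} (h : IsWeighted c τ) {c' : β → ℂ} {τ' : β → α}
    (hc' : Measurable c') (hτ' : Measurable τ') (h0 : ∀ p, c p * c' (τ p) = 1)
    (h1 : ∀ p, τ' (τ p) = p) (h2 : ∀ q, τ (τ' q) = q) : IsWeighted c' τ' where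
  meas_c := hc'
  meas_τ := hτ'
  ne_zero q := by
    have := h0 (τ' q)
    rw [h2] at this
    exact right_ne_zero_of_mul_eq_one this
  lintegral g hg := by
    rw [← h.lintegral (fun p => ‖c' p‖ₑ ^ 2 * g (τ' p))
      ((hc'.enorm.pow_const 2).mul (hg.comp hτ'))]
    refine lintegral_congr fun p => ?_
    rw [← mul_assoc, ← mul_pow, ← enorm_mul, h0, h1]
    simp

theorem IsWeighted.prod [SigmaFinite (volume : Measure α)] [SigmaFinite (volume : Measure β)]
    [SigmaFinite (volume : Measure γ)] [SigmaFinite (volume : Measure δ)]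
    {c : α → ℂ} {τ : α → β} {c' : γ → ℂ} {τ' : γ → δ}
    (h : IsWeighted c τ) (h' : IsWeighted c' τ') :
    IsWeighted (fun p : α × γ => c p.1 * c' p.2) (fun p : α × γ => (τ p.1, τ' p.2)) where
  meas_c := (h.meas_c.comp measurable_fst).mul (h'.meas_c.comp measurable_snd)
  meas_τ := (h.meas_τ.comp measurable_fst).prodMk (h'.meas_τ.comp measurable_snd)
  ne_zero p := mul_ne_zero (h.ne_zero _) (h'.ne_zero _)
  lintegral g hg := by
    have hc := h.meas_c
    have hc' := h'.meas_c
    have hτ := h.meas_τ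
    have hτ' := h'.meas_τ
    rw [Measure.volume_eq_prod, Measure.volume_eq_prod, lintegral_prod _ hg.aemeasurable,
      lintegral_prod _ (Measurable.aemeasurable (by fun_prop)),
      ← h.lintegral (fun a => ∫⁻ b, g (a, b)) hg.lintegral_prod_right']
    refine lintegral_congr fun p => ?_
    rw [← h'.lintegral (fun b => g (τ p, b)) (by fun_prop),
      ← lintegral_const_mul _ (by fun_prop)]
    simp only [enorm_mul, mul_pow, mul_assoc]

theorem weightedComp_comp {c : α → ℂ} {τ : α → β} {c' : β → ℂ} {τ' : β → γ}
    (h : IsWeighted c τ) (h' : IsWeighted c' τ') :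
    (weightedComp c τ h).comp (weightedComp c' τ' h') = weightedComp _ _ (h.comp h') := by
  ext1 ξ
  apply Lp.ext
  filter_upwards [coeFn_weightedComp _ _ h (weightedComp c' τ' h' ξ),
    h.qmp.ae (coeFn_weightedComp _ _ h' ξ), coeFn_weightedComp _ _ (h.comp h') ξ] with p h1 h2 h3
  rw [ContinuousLinearMap.comp_apply, h1, h2, h3, mul_assoc]

theorem norm_weightedComp_apply {c : α → ℂ} {τ : α → β} (h : IsWeighted c τ) (ξ : L2 β) :
    ‖weightedComp c τ h ξ‖ = ‖ξ‖ := by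
  rw [Lp.norm_def, Lp.norm_def, ← (h.memLp ξ).2,
    eLpNorm_congr_ae (coeFn_weightedComp c τ h ξ)]

theorem inner_weightedComp {c : α → ℂ} {τ : α → β} (h : IsWeighted c τ) (ξ η : L2 β) :
    ⟪weightedComp c τ h ξ, weightedComp c τ h η⟫_ℂ = ⟪ξ, η⟫_ℂ :=
  (LinearIsometry.mk (weightedComp c τ h).toLinearMap (norm_weightedComp_apply h)).inner_map_map ξ η

/-- Both sides are bounded, so comparing them on elementary tensors is enough. -/
theorem tensorOp_weightedComp [SigmaFinite (volume : Measure α)]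
    [SigmaFinite (volume : Measure β)] {c : α → ℂ} {τ : α → α} {c' : β → ℂ} {τ' : β → β}
    (h : IsWeighted c τ) (h' : IsWeighted c' τ') :
    tensorOp (weightedComp c τ h) (weightedComp c' τ' h') = weightedComp _ _ (h.prod h') := by
  refine ext_tmulL2 fun f g => ?_
  rw [tensorOp_tmulL2]
  apply Lp.ext
  filter_upwards [coeFn_tmulL2 (weightedComp c τ h f) (weightedComp c' τ' h' g),
    coeFn_weightedComp _ _ (h.prod h') (tmulL2 f g), (h.prod h').qmp.ae (coeFn_tmulL2 f g),
    ae_fst_of_ae (β := β) (coeFn_weightedComp c τ h f),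
    ae_snd_of_ae (α := α) (coeFn_weightedComp c' τ' h' g)] with p h1 h2 h3 h4 h5
  rw [h1, h2, h3, h4, h5]
  ring

theorem conjL2_comp_weightedComp [SigmaFinite (volume : Measure α)]
    [SigmaFinite (volume : Measure β)] {c : α → ℂ} {τ : α → β} (h : IsWeighted c τ) :
    conjL2.comp (weightedComp c τ h) = (weightedComp _ τ h.conj).comp conjL2 := by
  ext1 ξ
  apply Lp.ext
  filter_upwards [coeFn_conjL2 (weightedComp c τ h ξ), coeFn_weightedComp _ _ h ξ,
    coeFn_weightedComp _ _ h.conj (conjL2 ξ), h.qmp.ae (coeFn_conjL2 ξ)] with p h1 h2 h3 h4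
  simp only [ContinuousLinearMap.comp_apply]
  rw [h1, h2, h3, h4, map_mul]

/-- `T` is the weighted composition operator `ξ ↦ c · (ξ ∘ τ)`. -/
def IsWC (T : L2 β →L[ℂ] L2 α) (c : α → ℂ) (τ : α → β) : Prop :=
  ∃ h : IsWeighted c τ, T = weightedComp c τ h

/-- `A` is the conjugate-linear weighted composition operator `ξ ↦ c · conj (ξ ∘ τ)`. -/
def IsAWC [SigmaFinite (volume : Measure α)] (A : AntiOp α) (c : α → ℂ) (τ : α → α) : Prop :=
  ∃ h : IsWeighted c τ, A = (weightedComp c τ h).comp conjL2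

theorem IsWC.congr {T : L2 β →L[ℂ] L2 α} {c c' : α → ℂ} {τ τ' : α → β} (h : IsWC T c τ)
    (hc : ∀ p, c p = c' p) (hτ : ∀ p, τ p = τ' p) : IsWC T c' τ' := by
  obtain rfl : c = c' := funext hc
  obtain rfl : τ = τ' := funext hτ
  exact h

theorem IsAWC.congr [SigmaFinite (volume : Measure α)] {T : AntiOp α} {c c' : α → ℂ} {τ τ' : α → α} (h : IsAWC T c τ)
    (hc : ∀ p, c p = c' p) (hτ : ∀ p, τ p = τ' p) : IsAWC T c' τ' := by
  obtain rfl : c = c' := funext hc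
  obtain rfl : τ = τ' := funext hτ
  exact h

/-- The tool that converts operator identities into pointwise ones; together with the closure rules
below it carries all computations with Y, X, Z and V_D. -/
theorem IsWC.unique {T T' : L2 β →L[ℂ] L2 α} {c c' : α → ℂ} {τ τ' : α → β} (h : IsWC T c τ)
    (h' : IsWC T' c' τ') (hc : ∀ p, c p = c' p) (hτ : ∀ p, τ p = τ' p) : T = T' := by
  obtain ⟨_, rfl⟩ := h.congr hc hτ
  obtain ⟨_, rfl⟩ := h'
  rfl

theorem IsAWC.unique [SigmaFinite (volume : Measure α)] {T T' : AntiOp α} {c c' : α → ℂ} {τ τ' : α → α} (h : IsAWC T c τ)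
    (h' : IsAWC T' c' τ') (hc : ∀ p, c p = c' p) (hτ : ∀ p, τ p = τ' p) : T = T' := by
  obtain ⟨_, rfl⟩ := h.congr hc hτ
  obtain ⟨_, rfl⟩ := h'
  rfl

theorem IsWC.one : IsWC (1 : Op α) (fun _ => 1) (fun p => p) := by
  refine ⟨IsWeighted.id, ?_⟩
  ext1 ξ
  apply Lp.ext
  filter_upwards [coeFn_weightedComp _ _ IsWeighted.id ξ] with p hp
  rw [hp, one_mul]; rfl

theorem IsWC.comp {T : L2 β →L[ℂ] L2 α} {S : L2 γ →L[ℂ] L2 β} {c : α → ℂ} {τ : α → β} {c' : β → ℂ}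
    {τ' : β → γ} (h : IsWC T c τ) (h' : IsWC S c' τ') :
    IsWC (T.comp S) (fun p => c p * c' (τ p)) (fun p => τ' (τ p)) := by
  obtain ⟨h, rfl⟩ := h
  obtain ⟨h', rfl⟩ := h'
  exact ⟨h.comp h', weightedComp_comp h h'⟩

theorem IsWC.mul {T S : Op α} {c c' : α → ℂ} {τ τ' : α → α} (h : IsWC T c τ) (h' : IsWC S c' τ') :
    IsWC (T * S) (fun p => c p * c' (τ p)) (fun p => τ' (τ p)) := h.comp h'

theorem IsWC.tensor [SigmaFinite (volume : Measure α)] [SigmaFinite (volume : Measure β)]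
    {T : Op α} {S : Op β} {c : α → ℂ} {τ : α → α} {c' : β → ℂ} {τ' : β → β}
    (h : IsWC T c τ) (h' : IsWC S c' τ') :
    IsWC (tensorOp T S) (fun p : α × β => c p.1 * c' p.2) (fun p : α × β => (τ p.1, τ' p.2)) := by
  obtain ⟨h, rfl⟩ := h
  obtain ⟨h', rfl⟩ := h'
  exact ⟨h.prod h', tensorOp_weightedComp h h'⟩

theorem IsWC.norm_apply {T : L2 β →L[ℂ] L2 α} {c : α → ℂ} {τ : α → β} (h : IsWC T c τ) (ξ : L2 β) :
    ‖T ξ‖ = ‖ξ‖ := by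
  obtain ⟨h, rfl⟩ := h
  exact norm_weightedComp_apply h ξ

theorem IsWC.inner_map_map {T : L2 β →L[ℂ] L2 α} {c : α → ℂ} {τ : α → β} (h : IsWC T c τ)
    (ξ η : L2 β) : ⟪T ξ, T η⟫_ℂ = ⟪ξ, η⟫_ℂ := by
  obtain ⟨h, rfl⟩ := h
  exact inner_weightedComp h ξ η

theorem IsWC.coeFn {T : L2 β →L[ℂ] L2 α} {c : α → ℂ} {τ : α → β} (h : IsWC T c τ) (ξ : L2 β) :
    T ξ =ᵐ[volume] fun p => c p * ξ (τ p) := by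
  obtain ⟨h, rfl⟩ := h
  exact coeFn_weightedComp _ _ h ξ

theorem IsWC.star_mul_self {T : Op α} {c : α → ℂ} {τ : α → α} (h : IsWC T c τ) :
    star T * T = 1 := by
  refine ContinuousLinearMap.ext fun ξ => ext_inner_left ℂ fun η => ?_
  rw [mul_apply_eq_comp, ContinuousLinearMap.star_eq_adjoint,
    ContinuousLinearMap.adjoint_inner_right, h.inner_map_map]
  rfl

/-- The adjoint of an invertible weighted composition operator. -/
theorem IsWC.star {T : Op α} {c : α → ℂ} {τ : α → α} (h : IsWC T c τ) {c' : α → ℂ} {τ' : α → α}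
    (hc' : Measurable c') (hτ' : Measurable τ') (h0 : ∀ p, c p * c' (τ p) = 1)
    (h1 : ∀ p, τ' (τ p) = p) (h2 : ∀ q, τ (τ' q) = q) : IsWC (star T) c' τ' := by
  obtain ⟨hw, hT⟩ := h
  have hi : IsWC (weightedComp c' τ' (hw.inv hc' hτ' h0 h1 h2)) c' τ' :=
    ⟨hw.inv hc' hτ' h0 h1 h2, rfl⟩
  have hTS : T * weightedComp c' τ' (hw.inv hc' hτ' h0 h1 h2) = 1 :=
    (IsWC.mul ⟨hw, hT⟩ hi).unique IsWC.one h0 h1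
  -- The isometry T has the left inverse `star T` and the candidate as right inverse, so the two
  -- inverses coincide.
  have := congrArg (fun R => Star.star T * R) hTS
  simp only [← mul_assoc, mul_one] at this
  rw [IsWC.star_mul_self ⟨hw, hT⟩, one_mul] at this
  exact this ▸ hi

theorem IsWC.mul_star_self_of_star {T : Op α} {c' : α → ℂ}
    {τ' : α → α} (h' : IsWC (Star.star T) c' τ') : T * Star.star T = 1 := by
  simpa using h'.star_mul_self

theorem isWC_compMP (τ : α → β) (h : MeasurePreserving τ) : IsWC (compMP τ h) (fun _ => 1) τ :=
  ⟨_, rfl⟩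

theorem isWC_flip (α : Type) [MeasureSpace α] [SigmaFinite (volume : Measure α)] :
    IsWC (flip α) (fun _ => 1) Prod.swap := isWC_compMP _ _

theorem isWC_midFlip (α : Type) [MeasureSpace α] [SigmaFinite (volume : Measure α)] :
    IsWC (midFlip α) (fun _ => 1) (mid α) := isWC_compMP _ _

theorem IsAWC.coeFn [SigmaFinite (volume : Measure α)] {A : AntiOp α} {c : α → ℂ} {τ : α → α} (h : IsAWC A c τ) (ξ : L2 α) :
    A ξ =ᵐ[volume] fun p => c p * conj (ξ (τ p)) := by
  obtain ⟨h, rfl⟩ := h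
  filter_upwards [coeFn_weightedComp c τ h (conjL2 ξ), h.qmp.ae (coeFn_conjL2 ξ)] with p h1 h2
  rw [ContinuousLinearMap.comp_apply, h1, h2]

/-- Pulling complex conjugation to the right through a weighted composition only conjugates its
weight. -/
theorem IsAWC.comp_wc [SigmaFinite (volume : Measure α)] {A : AntiOp α} {T : Op α} {c c' : α → ℂ} {τ τ' : α → α}
    (h : IsAWC A c τ) (h' : IsWC T c' τ') :
    IsAWC (A.comp T) (fun p => c p * conj (c' (τ p))) (fun p => τ' (τ p)) := by
  obtain ⟨h, rfl⟩ := h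
  obtain ⟨h', rfl⟩ := h'
  refine ⟨h.comp h'.conj, ?_⟩
  rw [← weightedComp_comp h h'.conj, ContinuousLinearMap.comp_assoc,
    conjL2_comp_weightedComp, ContinuousLinearMap.comp_assoc]

theorem IsWC.comp_anti [SigmaFinite (volume : Measure α)] {A : AntiOp α} {T : Op α} {c c' : α → ℂ} {τ τ' : α → α}
    (h : IsWC T c τ) (h' : IsAWC A c' τ') :
    IsAWC (T.comp A) (fun p => c p * c' (τ p)) (fun p => τ' (τ p)) := by
  obtain ⟨h, rfl⟩ := h
  obtain ⟨h', rfl⟩ := h'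
  refine ⟨h.comp h', ?_⟩
  rw [← weightedComp_comp h h', ContinuousLinearMap.comp_assoc]

theorem IsAWC.comp [SigmaFinite (volume : Measure α)] {A B : AntiOp α} {c c' : α → ℂ} {τ τ' : α → α}
    (h : IsAWC A c τ) (h' : IsAWC B c' τ') :
    IsWC (A.comp B) (fun p => c p * conj (c' (τ p))) (fun p => τ' (τ p)) := by
  obtain ⟨h, rfl⟩ := h
  obtain ⟨h', rfl⟩ := h'
  refine ⟨h.comp h'.conj, ?_⟩
  ext1 ξ
  simp only [ContinuousLinearMap.comp_apply]
  rw [← ContinuousLinearMap.comp_apply conjL2, conjL2_comp_weightedComp, ← weightedComp_comp h h'.conj]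
  simp

theorem IsAWC.tensor [SigmaFinite (volume : Measure α)] [SigmaFinite (volume : Measure β)]
    {A : AntiOp α} {B : AntiOp β} {c : α → ℂ} {τ : α → α} {c' : β → ℂ} {τ' : β → β}
    (h : IsAWC A c τ) (h' : IsAWC B c' τ') :
    IsAWC (tensorAnti A B) (fun p : α × β => c p.1 * c' p.2)
      (fun p : α × β => (τ p.1, τ' p.2)) := by
  obtain ⟨h, rfl⟩ := h
  obtain ⟨h', rfl⟩ := h'
  refine ⟨h.prod h', ?_⟩
  rw [← tensorOp_weightedComp h h', tensorAnti]
  congr 2 <;> ext1 ξ <;> simp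

/-- Weighted conjugate-linear compositions are anti-isometric. -/
theorem IsAWC.inner_map_map [SigmaFinite (volume : Measure α)] {A : AntiOp α} {c : α → ℂ} {τ : α → α} (h : IsAWC A c τ)
    (ξ η : L2 α) : ⟪A ξ, A η⟫_ℂ = ⟪η, ξ⟫_ℂ := by
  obtain ⟨h, rfl⟩ := h
  rw [ContinuousLinearMap.comp_apply, ContinuousLinearMap.comp_apply, inner_weightedComp,
    L2.inner_def, L2.inner_def]
  refine integral_congr_ae ?_
  filter_upwards [coeFn_conjL2 ξ, coeFn_conjL2 η] with p h1 h2
  simp [h1, h2, mul_comm]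

end weightedCompositions

end QDouble

namespace QDouble

noncomputable section

/-! ### Antiunitary involutions and the maps x ↦ A x^* A -/

section antiunitaries

variable {α β : Type} [MeasureSpace α] [MeasureSpace β]
  [SigmaFinite (volume : Measure α)] [SigmaFinite (volume : Measure β)]

/-- Involutive antiunitary operators. -/
structure IsConjugation (A : AntiOp α) : Prop where
  apply_apply : ∀ ξ, A (A ξ) = ξ
  inner_map_map : ∀ ξ η, ⟪A ξ, A η⟫_ℂ = ⟪η, ξ⟫_ℂ

theorem IsConjugation.inner_right {A : AntiOp α} (hA : IsConjugation A) (ξ η : L2 α) :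
    ⟪ξ, A η⟫_ℂ = ⟪η, A ξ⟫_ℂ := by
  rw [← hA.inner_map_map, hA.apply_apply]

theorem IsConjugation.norm_map {A : AntiOp α} (hA : IsConjugation A) (ξ : L2 α) :
    ‖A ξ‖ = ‖ξ‖ := by
  rw [@norm_eq_sqrt_re_inner ℂ, @norm_eq_sqrt_re_inner ℂ _ _ _ _ ξ, hA.inner_map_map]

/-- The linear antimultiplicative map `x ↦ A x^* A`. -/
def antiConj (A : AntiOp α) (x : Op α) : Op α := A.comp ((star x).comp A)

theorem antiConj_apply (A : AntiOp α) (x : Op α) (ξ : L2 α) :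
    antiConj A x ξ = A (star x (A ξ)) := rfl

theorem inner_antiConj {A : AntiOp α} (hA : IsConjugation A) (x : Op α) (ξ η : L2 α) :
    ⟪ξ, antiConj A x η⟫_ℂ = ⟪A η, x (A ξ)⟫_ℂ := by
  rw [antiConj_apply, hA.inner_right, ContinuousLinearMap.star_eq_adjoint,
    ContinuousLinearMap.adjoint_inner_left]

theorem op_ext_inner {x y : L2 β →L[ℂ] L2 α} (h : ∀ ξ η, ⟪ξ, x η⟫_ℂ = ⟪ξ, y η⟫_ℂ) : x = y :=
  ContinuousLinearMap.ext fun η => ext_inner_left ℂ fun ξ => h ξ η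

theorem antiConj_add (A : AntiOp α) (x y : Op α) :
    antiConj A (x + y) = antiConj A x + antiConj A y := by
  ext1 ξ; simp [antiConj_apply]

theorem antiConj_smul (A : AntiOp α) (c : ℂ) (x : Op α) :
    antiConj A (c • x) = c • antiConj A x := by
  ext1 ξ; simp [antiConj_apply, map_smulₛₗ]

theorem antiConj_star {A : AntiOp α} (hA : IsConjugation A) (x : Op α) :
    antiConj A (star x) = star (antiConj A x) := by
  refine op_ext_inner fun ξ η => ?_
  rw [inner_antiConj hA]
  simp only [ContinuousLinearMap.star_eq_adjoint, ContinuousLinearMap.adjoint_inner_right]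
  rw [← inner_conj_symm (antiConj A x ξ), inner_antiConj hA, inner_conj_symm]

theorem antiConj_mul {A : AntiOp α} (hA : IsConjugation A) (x y : Op α) :
    antiConj A (x * y) = antiConj A y * antiConj A x := by
  ext1 ξ
  simp [antiConj_apply, mul_apply_eq_comp, hA.apply_apply]

theorem antiConj_antiConj {A : AntiOp α} (hA : IsConjugation A) (x : Op α) :
    antiConj A (antiConj A x) = x := by
  refine op_ext_inner fun ξ η => ?_
  rw [inner_antiConj hA, inner_antiConj hA, hA.apply_apply, hA.apply_apply]

theorem norm_antiConj_le {A : AntiOp α} (hA : IsConjugation A) (x : Op α) :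
    ‖antiConj A x‖ ≤ ‖x‖ := by
  refine ContinuousLinearMap.opNorm_le_bound _ (norm_nonneg _) fun ξ => ?_
  rw [antiConj_apply, hA.norm_map, ← norm_star x, ← hA.norm_map ξ]
  exact ContinuousLinearMap.le_opNorm _ _

/-- `x ↦ A x^* A` as a bounded linear map. -/
def antiConjL {A : AntiOp α} (hA : IsConjugation A) : Op α →L[ℂ] Op α :=
  LinearMap.mkContinuous
    { toFun := antiConj A
      map_add' := antiConj_add A
      map_smul' := antiConj_smul A } 1 (fun x => by simpa using norm_antiConj_le hA x)

theorem antiConjL_apply {A : AntiOp α} (hA : IsConjugation A) (x : Op α) :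
    antiConjL hA x = antiConj A x := rfl

/-- No closure under scalars is needed, because a scalar can be absorbed into one tensor factor. The
principle therefore applies to linear and conjugate-linear dependence alike. -/
theorem tmul_induction {P : L2 (α × β) → Prop} (hc : IsClosed {x | P x})
    (h0 : P 0) (ha : ∀ x y, P x → P y → P (x + y)) (ht : ∀ f g, P (tmulL2 f g)) (x : L2 (α × β)) :
    P x := by
  refine denseRange_tensorEmb.induction_on (p := P) x hc fun a => ?_
  induction a using TensorProduct.induction_on with
  | zero => simpa using h0
  | add x y hx hy => rw [map_add]; exact ha _ _ hx hy
  | tmul f g => exact ht f g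

theorem op_ext_tmul {γ : Type} [MeasureSpace γ] {x y : L2 γ →L[ℂ] L2 (α × β)}
    (h : ∀ f g η, ⟪tmulL2 f g, x η⟫_ℂ = ⟪tmulL2 f g, y η⟫_ℂ) : x = y := by
  refine ContinuousLinearMap.ext fun η => ext_inner_left ℂ fun ξ => ?_
  induction ξ using tmul_induction with
  | hc => exact isClosed_eq (by fun_prop) (by fun_prop)
  | h0 => simp
  | ha x y hx hy => rw [inner_add_left, inner_add_left, hx, hy]
  | ht f g => exact h f g η

theorem IsConjugation.tensor {A : AntiOp α} {B : AntiOp β} (hA : IsConjugation A)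
    (hB : IsConjugation B) : IsConjugation (tensorAnti A B) where
  apply_apply := by
    have : (tensorAnti A B).comp (tensorAnti A B) = ContinuousLinearMap.id ℂ _ :=
      ext_tmulL2 fun f g => by
        simp [tensorAnti_tmulL2, hA.apply_apply, hB.apply_apply]
    exact fun ξ => DFunLike.congr_fun this ξ
  inner_map_map := by
    intro ξ η
    induction ξ using tmul_induction with
    | hc => exact isClosed_eq (by fun_prop) (by fun_prop)
    | h0 => simp
    | ha x y hx hy => rw [map_add, inner_add_left, inner_add_right, hx, hy]
    | ht f g =>
      induction η using tmul_induction with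
      | hc => exact isClosed_eq (by fun_prop) (by fun_prop)
      | h0 => simp
      | ha x y hx hy => rw [map_add, inner_add_left, inner_add_right, hx, hy]
      | ht f' g' =>
        rw [tensorAnti_tmulL2, tensorAnti_tmulL2, inner_tmulL2, inner_tmulL2, hA.inner_map_map,
          hB.inner_map_map]

theorem antiConj_tensorOp {A : AntiOp α} {B : AntiOp β} (a : Op α) (b : Op β) :
    antiConj (tensorAnti A B) (tensorOp a b) = tensorOp (antiConj A a) (antiConj B b) := by
  refine ext_tmulL2 fun f g => ?_
  simp only [antiConj_apply, star_tensorOp, tensorAnti_tmulL2, tensorOp_tmulL2]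

end antiunitaries

/-! ### Slices and their closed linear span -/

section slices

variable {α β γ : Type} [MeasureSpace α] [MeasureSpace β] [MeasureSpace γ]
  [SigmaFinite (volume : Measure α)] [SigmaFinite (volume : Measure β)]
  [SigmaFinite (volume : Measure γ)]

theorem tensorOp_mul (a b : Op α) (c d : Op β) :
    tensorOp (a * b) (c * d) = tensorOp a c * tensorOp b d :=
  ext_tmulL2 fun f g => by simp [tensorOp_tmulL2, mul_apply_eq_comp]

theorem tensorOp_one : tensorOp (1 : Op α) (1 : Op β) = 1 :=
  ext_tmulL2 fun f g => by simp [tensorOp_tmulL2]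

theorem tmulL2_add_right (f : L2 α) (g g' : L2 β) :
    tmulL2 f (g + g') = tmulL2 f g + tmulL2 f g' := (tmulBilin f).map_add g g'

theorem continuous_ketR : Continuous fun η : L2 β => (ketR η : L2 α →L[ℂ] L2 (α × β)) := by
  unfold ketR
  have : Continuous fun η : L2 β => (TensorProduct.mkL ℂ (L2 α) (L2 β)).flip η :=
    ContinuousLinearMap.continuous _
  exact continuous_const.clm_comp this

@[fun_prop]
theorem continuous_tmulL2_right (f : L2 α) : Continuous fun g : L2 β => tmulL2 f g := by
  have h := (continuous_ketR (α := α) (β := β)).clm_apply (continuous_const (y := f))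
  exact h

theorem ketR_add (η η' : L2 β) :
    (ketR (η + η') : L2 α →L[ℂ] L2 (α × β)) = ketR η + ketR η' := by
  ext1 ζ; exact tmulL2_add_right _ _ _

theorem ketR_zero : (ketR (0 : L2 β) : L2 α →L[ℂ] L2 (α × β)) = 0 := by
  ext1 ζ; exact (tmulBilin ζ).map_zero

theorem vecSlice_add_left (V : Op (α × β)) (ξ ξ' η : L2 β) :
    vecSlice V (ξ + ξ') η = vecSlice V ξ η + vecSlice V ξ' η := by
  simp only [vecSlice, ketR_add, map_add, ContinuousLinearMap.add_comp]

theorem vecSlice_add_right (V : Op (α × β)) (ξ η η' : L2 β) :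
    vecSlice V ξ (η + η') = vecSlice V ξ η + vecSlice V ξ η' := by
  simp only [vecSlice, ketR_add, ContinuousLinearMap.comp_add]

theorem continuous_vecSlice_left (V : Op (α × β)) (η : L2 β) :
    Continuous fun ξ => vecSlice V ξ η :=
  ((ContinuousLinearMap.adjoint (𝕜 := ℂ)).continuous.comp continuous_ketR).clm_comp
    continuous_const

theorem continuous_vecSlice_right (V : Op (α × β)) (ξ : L2 β) :
    Continuous fun η => vecSlice V ξ η :=
  continuous_const.clm_comp (continuous_const.clm_comp continuous_ketR)

/-- The closed linear span of the right slices of `V`. -/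
def sliceSpan (V : Op (α × β)) : Submodule ℂ (Op α) :=
  (Submodule.span ℂ {T | ∃ ξ η, T = vecSlice V ξ η}).topologicalClosure

theorem isClosed_sliceSpan (V : Op (α × β)) : IsClosed (sliceSpan V : Set (Op α)) :=
  Submodule.isClosed_topologicalClosure _

theorem vecSlice_mem (V : Op (α × β)) (ξ η : L2 β) : vecSlice V ξ η ∈ sliceSpan V :=
  Submodule.le_topologicalClosure _ (Submodule.subset_span ⟨ξ, η, rfl⟩)

theorem sliceSpan_le {V : Op (α × β)} {W : Submodule ℂ (Op α)} (hW : IsClosed (W : Set (Op α)))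
    (h : ∀ ξ η, vecSlice V ξ η ∈ W) : sliceSpan V ≤ W := by
  refine Submodule.topologicalClosure_minimal _ (Submodule.span_le.2 ?_) hW
  rintro _ ⟨ξ, η, rfl⟩
  exact h ξ η

theorem sliceSpan_induction {V : Op (α × β)} {P : Op α → Prop} (hc : IsClosed {x | P x})
    (h0 : P 0) (ha : ∀ x y, P x → P y → P (x + y)) (hs : ∀ (c : ℂ) x, P x → P (c • x))
    (h : ∀ ξ η, P (vecSlice V ξ η)) {x : Op α} (hx : x ∈ sliceSpan V) : P x :=
  sliceSpan_le (W := ⟨⟨⟨{x | P x}, fun {x y} hx hy => ha x y hx hy⟩, h0⟩, fun c x hx => hs c x hx⟩)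
    hc h hx

/-- A slice is additive and continuous in each of its two vectors, so both can be reduced to
elementary tensors one after the other. -/
theorem sliceSpan_le_of_tmul {V : Op (α × (β × γ))} {W : Submodule ℂ (Op α)}
    (hW : IsClosed (W : Set (Op α)))
    (h : ∀ ξ ξ' η η', vecSlice V (tmulL2 ξ ξ') (tmulL2 η η') ∈ W) : sliceSpan V ≤ W := by
  refine sliceSpan_le hW fun ξ η => ?_
  induction ξ using tmul_induction with
  | hc => exact hW.preimage (continuous_vecSlice_left V η)
  | h0 =>
    have : vecSlice V 0 η = 0 := by simp [vecSlice, ketR_zero]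
    rw [this]; exact W.zero_mem
  | ha x y hx hy => rw [vecSlice_add_left]; exact W.add_mem hx hy
  | ht ξ ξ' =>
    induction η using tmul_induction with
    | hc => exact hW.preimage (continuous_vecSlice_right V _)
    | h0 =>
      have : vecSlice V (tmulL2 ξ ξ') 0 = 0 := by simp [vecSlice, ketR_zero]
      rw [this]; exact W.zero_mem
    | ha x y hx hy => rw [vecSlice_add_right]; exact W.add_mem hx hy
    | ht η η' => exact h _ _ _ _

theorem vecSlice_smul_right (V : Op (α × β)) (ξ η : L2 β) (c : ℂ) :
    vecSlice V ξ (c • η) = c • vecSlice V ξ η := by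
  have : (ketR (c • η) : L2 α →L[ℂ] L2 (α × β)) = c • ketR η := by
    ext1 ζ; exact (tmulBilin ζ).map_smul c η
  simp only [vecSlice, this, ContinuousLinearMap.comp_smul]

theorem span_subset_rightSlices (V : Op (α × β)) :
    (Submodule.span ℂ {T | ∃ ξ η, T = vecSlice V ξ η} : Set (Op α)) ⊆ rightSlices V := by
  intro T hT
  have key : ∃ l : List (L2 β × L2 β), T = (l.map fun q => vecSlice V q.1 q.2).sum := by
    induction hT using Submodule.span_induction with
    | mem x hx => obtain ⟨ξ, η, rfl⟩ := hx; exact ⟨[(ξ, η)], by simp⟩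
    | zero => exact ⟨[], by simp⟩
    | add x y _ _ hx hy =>
      obtain ⟨l, rfl⟩ := hx
      obtain ⟨m, rfl⟩ := hy
      exact ⟨l ++ m, by simp⟩
    | smul c x _ hx =>
      obtain ⟨l, rfl⟩ := hx
      refine ⟨l.map fun q => (q.1, c • q.2), ?_⟩
      rw [List.smul_sum, List.map_map, List.map_map]
      congr 2
      funext q
      simp [vecSlice_smul_right]
  obtain ⟨l, rfl⟩ := key
  -- Padding the finite list with the default pair (0, 0) turns it into a sequence with vanishing
  -- tail, as the definition of `rightSlices` demands.
  have h0 : ∀ i ∉ Finset.range l.length, l.getD i 0 = 0 := fun i hi => by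
    rw [List.getD_eq_default]; simpa using hi
  refine ⟨fun i => (l.getD i 0).1, fun i => (l.getD i 0).2,
    summable_of_ne_finset_zero (s := Finset.range l.length) fun i hi => ?_,
    summable_of_ne_finset_zero (s := Finset.range l.length) fun i hi => ?_, ?_⟩
  · dsimp only; rw [h0 i hi]; simp
  · dsimp only; rw [h0 i hi]; simp
  · have hs : (l.map fun q => vecSlice V q.1 q.2).sum
        = ∑ i ∈ Finset.range l.length, vecSlice V (l.getD i 0).1 (l.getD i 0).2 := by
      rw [Finset.sum_range, ← Fin.sum_univ_fun_getElem]
      refine Finset.sum_congr rfl fun i _ => ?_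
      simp
    rw [hs]
    refine hasSum_sum_of_ne_finset_zero fun i hi => ?_
    dsimp only
    rw [h0 i hi]
    simp [vecSlice, ketR_zero]

/-- The set of normal slices lies between the algebraic span of the vector slices and the norm
closure of that span. In particular its closure is a linear subspace. -/
theorem closure_rightSlices (V : Op (α × β)) :
    closure (rightSlices V) = (sliceSpan V : Set (Op α)) := by
  refine Set.Subset.antisymm (closure_minimal ?_ (isClosed_sliceSpan V))
    (closure_mono (span_subset_rightSlices V))
  rintro T ⟨ξ, η, -, -, hT⟩
  refine (isClosed_sliceSpan V).mem_of_tendsto hT (Eventually.of_forall fun s => ?_)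
  exact Submodule.sum_mem _ fun i _ => vecSlice_mem V _ _

theorem star_vecSlice (V : Op (α × β)) (ξ η : L2 β) :
    star (vecSlice V ξ η) = vecSlice (star V) η ξ := by
  refine op_ext_inner fun ζ ζ' => ?_
  rw [inner_vecSlice, ContinuousLinearMap.star_eq_adjoint, ContinuousLinearMap.star_eq_adjoint,
    ContinuousLinearMap.adjoint_inner_right, ContinuousLinearMap.adjoint_inner_right,
    ← inner_conj_symm, inner_vecSlice, inner_conj_symm]

/-- Antiunitarity exchanges the two entries of the inner product, which is why the slicing vectors
trade places. -/
theorem antiConj_vecSlice {A : AntiOp α} {K : AntiOp β} (hA : IsConjugation A)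
    (hK : IsConjugation K) (V : Op (α × β)) (ξ η : L2 β) :
    antiConj A (vecSlice V ξ η) = vecSlice (antiConj (tensorAnti A K) V) (K η) (K ξ) := by
  refine op_ext_inner fun ζ ζ' => ?_
  rw [inner_antiConj hA, inner_vecSlice, inner_vecSlice, inner_antiConj (hA.tensor hK),
    tensorAnti_tmulL2, tensorAnti_tmulL2, hK.apply_apply, hK.apply_apply]

theorem vecSlice_tensor_mul (T : Op α) (V : Op (α × β)) (ξ η : L2 β) :
    vecSlice (tensorOp T 1 * V) ξ η = T * vecSlice V ξ η := by
  refine op_ext_inner fun ζ ζ' => ?_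
  rw [inner_vecSlice, mul_apply_eq_comp, mul_apply_eq_comp,
    ← ContinuousLinearMap.adjoint_inner_left, ← ContinuousLinearMap.adjoint_inner_left T,
    inner_vecSlice, ← ContinuousLinearMap.star_eq_adjoint, star_tensorOp, tensorOp_tmulL2,
    star_one]
  rfl

theorem vecSlice_mul_tensor (T : Op α) (V : Op (α × β)) (ξ η : L2 β) :
    vecSlice (V * tensorOp T 1) ξ η = vecSlice V ξ η * T := by
  refine op_ext_inner fun ζ ζ' => ?_
  rw [inner_vecSlice, mul_apply_eq_comp, mul_apply_eq_comp, inner_vecSlice, tensorOp_tmulL2]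
  rfl

theorem flip_tmulL2 (f g : L2 α) : flip α (tmulL2 f g) = tmulL2 g f := by
  apply Lp.ext
  have hq : Measure.QuasiMeasurePreserving (Prod.swap : α × α → α × α) volume volume :=
    (Measure.measurePreserving_swap (μ := (volume : Measure α)) (ν := (volume : Measure α))).quasiMeasurePreserving
  filter_upwards [(isWC_flip α).coeFn (tmulL2 f g), coeFn_tmulL2 g f,
    hq.ae (coeFn_tmulL2 f g)] with p h1 h2 h3
  rw [h1, h2, h3, one_mul, mul_comm]
  rfl

theorem flip_mul_flip : flip α * flip α = 1 :=
  ext_tmulL2 fun f g => by simp [mul_apply_eq_comp, flip_tmulL2]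

theorem star_flip : star (flip α) = flip α := by
  have h := (isWC_flip α).star_mul_self
  calc star (flip α) = star (flip α) * (flip α * flip α) := by rw [flip_mul_flip, mul_one]
    _ = flip α := by rw [← mul_assoc, h, one_mul]

end slices

/-! ### Operators on three tensor legs -/

section threeLegs

variable {α β γ : Type} [MeasureSpace α] [MeasureSpace β] [MeasureSpace γ]
  [SigmaFinite (volume : Measure α)] [SigmaFinite (volume : Measure β)]
  [SigmaFinite (volume : Measure γ)]

variable (α β γ) in
/-- The canonical unitary `L²(α × (β × γ)) → L²((α × β) × γ)`. -/
def assocR : L2 (α × (β × γ)) →L[ℂ] L2 ((α × β) × γ) :=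
  compMP MeasurableEquiv.prodAssoc (measurePreserving_prodAssoc volume volume volume)

variable (α β γ) in
/-- The canonical unitary `L²((α × β) × γ) → L²(α × (β × γ))`. -/
def assocL : L2 ((α × β) × γ) →L[ℂ] L2 (α × (β × γ)) :=
  compMP MeasurableEquiv.prodAssoc.symm
    ((measurePreserving_prodAssoc volume volume volume).symm _)

theorem isWC_assocR : IsWC (assocR α β γ) (fun _ => 1) (fun p => (p.1.1, p.1.2, p.2)) :=
  isWC_compMP _ _

theorem isWC_assocL : IsWC (assocL α β γ) (fun _ => 1) (fun p => ((p.1, p.2.1), p.2.2)) :=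
  isWC_compMP _ _

theorem assocR_comp_assocL : (assocR α β γ).comp (assocL α β γ) = 1 :=
  (isWC_assocR.comp isWC_assocL).unique IsWC.one (by simp) (by simp)

theorem assocL_comp_assocR : (assocL α β γ).comp (assocR α β γ) = 1 :=
  (isWC_assocL.comp isWC_assocR).unique IsWC.one (by simp) (by simp)

theorem assocL_assocR (x : L2 (α × (β × γ))) : assocL α β γ (assocR α β γ x) = x :=
  DFunLike.congr_fun assocL_comp_assocR x

theorem assocR_assocL (x : L2 ((α × β) × γ)) : assocR α β γ (assocL α β γ x) = x :=
  DFunLike.congr_fun assocR_comp_assocL x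

theorem assocR_tmul (f : L2 α) (g : L2 β) (h : L2 γ) :
    assocR α β γ (tmulL2 f (tmulL2 g h)) = tmulL2 (tmulL2 f g) h := by
  apply Lp.ext
  filter_upwards [isWC_assocR.coeFn (tmulL2 f (tmulL2 g h)), coeFn_tmulL2 (tmulL2 f g) h,
    ae_fst_of_ae (β := γ) (coeFn_tmulL2 f g),
    (measurePreserving_prodAssoc (volume : Measure α) (volume : Measure β)
      (volume : Measure γ)).quasiMeasurePreserving.ae (coeFn_tmulL2 f (tmulL2 g h)),
    (measurePreserving_prodAssoc (volume : Measure α) (volume : Measure β)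
      (volume : Measure γ)).quasiMeasurePreserving.ae
        (ae_snd_of_ae (α := α) (coeFn_tmulL2 g h))] with p h1 h2 h3 h4 h5
  rw [h1, h2, h3, one_mul]
  refine h4.trans ?_
  rw [h5]
  exact (mul_assoc _ _ _).symm

theorem assocL_tmul (f : L2 α) (g : L2 β) (h : L2 γ) :
    assocL α β γ (tmulL2 (tmulL2 f g) h) = tmulL2 f (tmulL2 g h) := by
  rw [← assocR_tmul, assocL_assocR]

theorem inner_assocL (x : L2 (α × (β × γ))) (y : L2 ((α × β) × γ)) :
    ⟪x, assocL α β γ y⟫_ℂ = ⟪assocR α β γ x, y⟫_ℂ := by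
  rw [← isWC_assocR.inner_map_map, assocR_assocL]

theorem inner_assocR (x : L2 ((α × β) × γ)) (y : L2 (α × (β × γ))) :
    ⟪x, assocR α β γ y⟫_ℂ = ⟪assocL α β γ x, y⟫_ℂ := by
  rw [← isWC_assocL.inner_map_map, assocL_assocR]

/-- `V₂₃` on `L²((α × β) × γ)`. -/
def amp23 (V : Op (β × γ)) : Op ((α × β) × γ) :=
  (assocR α β γ).comp ((tensorOp 1 V).comp (assocL α β γ))

theorem amp23_tmul (V : Op (β × γ)) (f : L2 α) (g : L2 β) (h : L2 γ) :
    amp23 V (tmulL2 (tmulL2 f g) h) = assocR α β γ (tmulL2 f (V (tmulL2 g h))) := by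
  simp only [amp23, ContinuousLinearMap.comp_apply, assocL_tmul, tensorOp_tmulL2]
  rfl

theorem amp23_mul (V W : Op (β × γ)) :
    (amp23 (V * W) : Op ((α × β) × γ)) = amp23 V * amp23 W := by
  ext1 x
  simp only [amp23, mul_apply_eq_comp, ContinuousLinearMap.comp_apply, assocL_assocR]
  rw [← mul_apply_eq_comp, ← tensorOp_mul, one_mul]

theorem amp23_one : (amp23 (1 : Op (β × γ)) : Op ((α × β) × γ)) = 1 := by
  ext1 x
  simp [amp23, tensorOp_one, assocR_assocL]

theorem op_ext_tmul3 {x y : Op ((α × β) × γ)}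
    (h : ∀ f g k, x (tmulL2 (tmulL2 f g) k) = y (tmulL2 (tmulL2 f g) k)) : x = y := by
  refine ext_tmulL2 fun F k => ?_
  have : x.comp (ketR k) = y.comp (ketR k) := ext_tmulL2 fun f g => h f g k
  exact DFunLike.congr_fun this F

theorem star_amp23 (V : Op (β × γ)) :
    star (amp23 V : Op ((α × β) × γ)) = amp23 (star V) := by
  refine op_ext_inner fun x y => ?_
  rw [ContinuousLinearMap.star_eq_adjoint, ContinuousLinearMap.adjoint_inner_right]
  simp only [amp23, ContinuousLinearMap.comp_apply]
  rw [inner_assocR, ← inner_conj_symm, inner_assocR, inner_conj_symm,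
    ← ContinuousLinearMap.adjoint_inner_right, ← ContinuousLinearMap.star_eq_adjoint,
    star_tensorOp, star_one]

theorem vecSlice_amp23 (V : Op (β × γ)) (ξ η : L2 γ) :
    vecSlice (amp23 V : Op ((α × β) × γ)) ξ η = tensorOp 1 (vecSlice V ξ η) := by
  refine op_ext_tmul fun f g x => ?_
  induction x using tmul_induction with
  | hc => exact isClosed_eq (by fun_prop) (by fun_prop)
  | h0 => simp
  | ha x y hx hy => rw [map_add, map_add, inner_add_right, inner_add_right, hx, hy]
  | ht f' g' =>
    rw [inner_vecSlice, amp23_tmul, inner_assocR, assocL_tmul, inner_tmulL2, tensorOp_tmulL2,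
      inner_tmulL2, inner_vecSlice]
    rfl

/-- `V₁₃` on `L²((α × α) × γ)`. -/
def amp13 (V : Op (α × γ)) : Op ((α × α) × γ) :=
  tensorOp (flip α) 1 * amp23 V * tensorOp (flip α) 1

theorem vecSlice_amp13 (V : Op (α × γ)) (ξ η : L2 γ) :
    vecSlice (amp13 V) ξ η = tensorOp (vecSlice V ξ η) 1 := by
  rw [amp13, vecSlice_mul_tensor, vecSlice_tensor_mul, vecSlice_amp23]
  exact ext_tmulL2 fun f g => by simp [mul_apply_eq_comp, flip_tmulL2, tensorOp_tmulL2]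

theorem tensor_flip_mul_self :
    tensorOp (flip α) (1 : Op γ) * tensorOp (flip α) 1 = 1 := by
  rw [← tensorOp_mul, flip_mul_flip, one_mul, tensorOp_one]

theorem flip_amp13_flip (V : Op (α × γ)) :
    tensorOp (flip α) 1 * amp13 V * tensorOp (flip α) 1 = amp23 V := by
  have h := tensor_flip_mul_self (α := α) (γ := γ)
  calc _ = (tensorOp (flip α) 1 * tensorOp (flip α) 1) * amp23 V *
        (tensorOp (flip α) 1 * tensorOp (flip α) 1) := by simp only [amp13, mul_assoc]
    _ = _ := by rw [h, one_mul, mul_one]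

variable {A : AntiOp α} {K : AntiOp γ}

/-- On the idle first leg the antiunitary acts twice, and A² = 1. -/
theorem antiConj_amp23 (hA : IsConjugation A) (V : Op (α × γ)) :
    antiConj (tensorAnti (tensorAnti A A) K) (amp23 V) =
      (amp23 (antiConj (tensorAnti A K) V) : Op ((α × α) × γ)) := by
  have h : ∀ (f : L2 α) (G : L2 (α × γ)), tensorAnti (tensorAnti A A) K (assocR α α γ (tmulL2 f G))
      = assocR α α γ (tmulL2 (A f) (tensorAnti A K G)) := by
    intro f G
    induction G using tmul_induction with
    | hc => exact isClosed_eq (by fun_prop) (by fun_prop)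
    | h0 =>
      have h0 : ∀ f : L2 α, tmulL2 f (0 : L2 (α × γ)) = 0 := fun f => (tmulBilin f).map_zero
      simp [h0]
    | ha x y hx hy => simp only [tmulL2_add_right, map_add, hx, hy]
    | ht g k => simp only [assocR_tmul, tensorAnti_tmulL2]
  have h2 : ∀ f g k, antiConj (tensorAnti (tensorAnti A A) K) (amp23 V) (tmulL2 (tmulL2 f g) k)
      = assocR α α γ (tmulL2 (A (A f)) (antiConj (tensorAnti A K) V (tmulL2 g k))) := by
    intro f g k
    rw [antiConj_apply, star_amp23, tensorAnti_tmulL2, tensorAnti_tmulL2, amp23_tmul, h,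
      antiConj_apply, tensorAnti_tmulL2]
  refine op_ext_tmul3 fun f g k => ?_
  rw [h2, amp23_tmul, hA.apply_apply]

theorem tensorAnti_tensor_flip (x : L2 ((α × α) × γ)) :
    tensorAnti (tensorAnti A A) K (tensorOp (flip α) 1 x)
      = tensorOp (flip α) 1 (tensorAnti (tensorAnti A A) K x) := by
  have h1 : (tensorAnti A A).comp (flip α) = (flip α).comp (tensorAnti A A) :=
    ext_tmulL2 fun f g => by simp [flip_tmulL2, tensorAnti_tmulL2]
  have h : (tensorAnti (tensorAnti A A) K).comp (tensorOp (flip α) 1)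
      = (tensorOp (flip α) 1).comp (tensorAnti (tensorAnti A A) K) :=
    ext_tmulL2 fun f g => by
      simp only [ContinuousLinearMap.comp_apply, tensorOp_tmulL2, tensorAnti_tmulL2]
      rw [← ContinuousLinearMap.comp_apply (tensorAnti A A), h1]
      rfl
  exact DFunLike.congr_fun h x

theorem antiConj_tensor_flip (hA : IsConjugation A) (hK : IsConjugation K) :
    antiConj (tensorAnti (tensorAnti A A) K) (tensorOp (flip α) 1) = tensorOp (flip α) 1 := by
  ext1 x
  rw [antiConj_apply, star_tensorOp, star_flip, star_one, tensorAnti_tensor_flip,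
    ((hA.tensor hA).tensor hK).apply_apply]

theorem antiConj_amp13 (hA : IsConjugation A) (hK : IsConjugation K) (V : Op (α × γ)) :
    antiConj (tensorAnti (tensorAnti A A) K) (amp13 V) =
      amp13 (antiConj (tensorAnti A K) V) := by
  have hB := (hA.tensor hA).tensor hK
  rw [amp13, antiConj_mul hB, antiConj_mul hB, antiConj_amp23 hA, antiConj_tensor_flip hA hK,
    ← mul_assoc]
  rfl

end threeLegs

end

end QDouble

namespace QDouble

noncomputable section

/-! ### Boundedness of the ampliations -/

section ampliations

variable {α β : Type} [MeasureSpace α] [MeasureSpace β]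
  [SigmaFinite (volume : Measure α)] [SigmaFinite (volume : Measure β)]

/-- The bound holds on the algebraic tensor product, and extending along an isometric dense
embedding does not increase the norm. It makes a ↦ a ⊗ 1 and b ↦ 1 ⊗ b continuous, as the closure
arguments require. -/
theorem norm_tensorOp_le (a : Op α) (b : Op β) : ‖tensorOp a b‖ ≤ ‖a‖ * ‖b‖ := by
  have h1 : ‖tensorOp a b‖ ≤ (1 : ℝ≥0) * ‖(tensorEmb : L2 α ⊗[ℂ] L2 β →ₗᵢ[ℂ]
      L2 (α × β)).toContinuousLinearMap.comp (TensorProduct.mapL a b)‖ :=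
    ContinuousLinearMap.opNorm_extend_le _ denseRange_tensorEmb (fun x => by simp)
  rw [NNReal.coe_one, one_mul] at h1
  refine h1.trans (le_trans ?_ (TensorProduct.norm_mapL_le a b))
  refine ContinuousLinearMap.opNorm_le_bound _ (ContinuousLinearMap.opNorm_nonneg _) fun x => ?_
  rw [ContinuousLinearMap.comp_apply, LinearIsometry.coe_toContinuousLinearMap,
    LinearIsometry.norm_map]
  exact ContinuousLinearMap.le_opNorm _ _

variable (α β) in
/-- `b ↦ 1 ⊗ b` -/
def ampRight : Op β →L[ℂ] Op (α × β) :=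
  LinearMap.mkContinuous
    { toFun := fun b => tensorOp 1 b
      map_add' := fun x y => ext_tmulL2 fun f g => by simp [tensorOp_tmulL2, tmulL2_add_right]
      map_smul' := fun c x => ext_tmulL2 fun f g => by
        simp only [tensorOp_tmulL2, smul_apply, RingHom.id_apply]
        exact (tmulBilin _).map_smul c _ } ‖(1 : Op α)‖ (norm_tensorOp_le 1)

variable (α β) in
/-- `a ↦ a ⊗ 1` -/
def ampLeft : Op α →L[ℂ] Op (α × β) :=
  LinearMap.mkContinuous
    { toFun := fun a => tensorOp a 1
      map_add' := fun x y => ext_tmulL2 fun f g => by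
        simp only [tensorOp_tmulL2, add_apply]
        exact (tmulBilin.flip _).map_add _ _
      map_smul' := fun c x => ext_tmulL2 fun f g => by
        simp only [tensorOp_tmulL2, smul_apply, RingHom.id_apply]
        exact (tmulBilin.flip _).map_smul c _ } ‖(1 : Op β)‖
    (fun a => (norm_tensorOp_le a 1).trans_eq (mul_comm _ _))

theorem ampRight_apply (b : Op β) : ampRight α β b = tensorOp 1 b := rfl

end ampliations

/-! ### Consequences of the pentagon equation -/

section multiplicativeUnitary

variable {α : Type} [MeasureSpace α] [SigmaFinite (volume : Measure α)]

/-- Multiplicative unitaries: unitaries satisfying the pentagon equation. -/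
structure IsMultiplicativeUnitary (V : Op (α × α)) : Prop where
  star_mul_self : star V * V = 1
  mul_star_self : V * star V = 1
  pentagon : tensorOp V 1 * amp13 V * amp23 V = amp23 V * tensorOp V 1

variable {V : Op (α × α)}

/-- The pentagon equation solved for V₁₃V₂₃; slicing the last leg of the right-hand side yields
V^*(1 ⊗ x)V. -/
theorem IsMultiplicativeUnitary.amp13_mul_amp23 (hV : IsMultiplicativeUnitary V) :
    amp13 V * amp23 V = star (tensorOp V 1) * amp23 V * tensorOp V 1 := by
  have h : star (tensorOp V (1 : Op α)) * tensorOp V 1 = 1 := by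
    rw [star_tensorOp, ← tensorOp_mul, hV.star_mul_self, star_one, one_mul, tensorOp_one]
  rw [mul_assoc _ (amp23 V), ← hV.pentagon, mul_assoc, ← mul_assoc, h, one_mul]

/-- The coproduct of a slice. -/
theorem IsMultiplicativeUnitary.coproduct_vecSlice (hV : IsMultiplicativeUnitary V) (ξ η : L2 α) :
    star V * tensorOp 1 (vecSlice V ξ η) * V = vecSlice (amp13 V * amp23 V) ξ η := by
  rw [hV.amp13_mul_amp23, vecSlice_mul_tensor, star_tensorOp, star_one, vecSlice_tensor_mul,
    vecSlice_amp23]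

/-- The product of two slices. -/
theorem IsMultiplicativeUnitary.vecSlice_mul_vecSlice (hV : IsMultiplicativeUnitary V)
    (ξ η ξ' η' : L2 α) :
    vecSlice V ξ η * vecSlice V ξ' η' =
      vecSlice ((assocL α α α).comp ((tensorOp V 1).comp (assocR α α α)))
        (star V (tmulL2 ξ ξ')) (star V (tmulL2 η η')) := by
  -- A product of two slices of V is the slice of V₁₂V₁₃ over legs 2 and 3. In the form V₂₃V₁₂V₂₃^*
  -- the outer factors act only on those legs and can be moved onto the slicing vectors.
  have h1 : amp23 V * tensorOp V 1 * star (amp23 V) = tensorOp V 1 * amp13 V := by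
    rw [← hV.pentagon, mul_assoc, star_amp23, ← amp23_mul, hV.mul_star_self, amp23_one, mul_one]
  refine op_ext_inner fun ζ ζ' => ?_
  rw [inner_vecSlice]
  simp only [ContinuousLinearMap.comp_apply]
  rw [inner_assocL, ← amp23_tmul, ← amp23_tmul, ← star_amp23,
    ContinuousLinearMap.star_eq_adjoint, ContinuousLinearMap.adjoint_inner_left,
    ← ContinuousLinearMap.star_eq_adjoint]
  rw [← mul_apply_eq_comp, ← mul_apply_eq_comp, h1, mul_apply_eq_comp, mul_apply_eq_comp,
    inner_vecSlice, ← ContinuousLinearMap.adjoint_inner_left V,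
    ← ContinuousLinearMap.adjoint_inner_left (tensorOp V 1),
    ← ContinuousLinearMap.star_eq_adjoint, ← ContinuousLinearMap.star_eq_adjoint, star_tensorOp,
    tensorOp_tmulL2, star_one, one_apply_eq_self, ← inner_vecSlice, vecSlice_amp13,
    tensorOp_tmulL2]
  rfl

/-- Slicing V₁₂ by elementary tensors over legs 2 and 3 gives a scalar multiple of a slice of V,
since the third leg contributes only an inner product. -/
theorem sliceSpan_assoc_le (V : Op (α × α)) :
    sliceSpan ((assocL α α α).comp ((tensorOp V 1).comp (assocR α α α))) ≤ sliceSpan V := by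
  refine sliceSpan_le_of_tmul (isClosed_sliceSpan V) fun ξ ξ' η η' => ?_
  have : vecSlice ((assocL α α α).comp ((tensorOp V 1).comp (assocR α α α)))
      (tmulL2 ξ ξ') (tmulL2 η η') = ⟪ξ', η'⟫_ℂ • vecSlice V ξ η := by
    refine op_ext_inner fun ζ ζ' => ?_
    rw [inner_vecSlice]
    simp only [ContinuousLinearMap.comp_apply]
    rw [inner_assocL, assocR_tmul, assocR_tmul, tensorOp_tmulL2, inner_tmulL2,
      smul_apply, inner_smul_right, inner_vecSlice, mul_comm]
    rfl
  rw [this]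
  exact Submodule.smul_mem _ _ (vecSlice_mem V ξ η)

/-- Multiplication by a fixed operator is linear and continuous, so it suffices to multiply two
vector slices. -/
theorem IsMultiplicativeUnitary.mul_mem (hV : IsMultiplicativeUnitary V) {x y : Op α}
    (hx : x ∈ sliceSpan V) (hy : y ∈ sliceSpan V) : x * y ∈ sliceSpan V := by
  have hc : ∀ z : Op α, IsClosed ((sliceSpan V).comap (LinearMap.mulRight ℂ z) : Set (Op α)) :=
    fun z => (isClosed_sliceSpan V).preimage (continuous_mul_const z)
  have hc' : ∀ z : Op α, IsClosed ((sliceSpan V).comap (LinearMap.mulLeft ℂ z) : Set (Op α)) :=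
    fun z => (isClosed_sliceSpan V).preimage (continuous_const_mul z)
  refine sliceSpan_le (W := (sliceSpan V).comap (LinearMap.mulRight ℂ y)) (hc y) (fun ξ η => ?_) hx
  refine sliceSpan_le (W := (sliceSpan V).comap (LinearMap.mulLeft ℂ (vecSlice V ξ η))) (hc' _)
    (fun ξ' η' => ?_) hy
  rw [Submodule.mem_comap, LinearMap.mulLeft_apply, hV.vecSlice_mul_vecSlice]
  exact sliceSpan_assoc_le V (vecSlice_mem _ _ _)

variable {A K : AntiOp α}

theorem antiConj_mem_sliceSpan (hA : IsConjugation A) (hK : IsConjugation K)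
    (h : antiConj (tensorAnti A K) V = V) {x : Op α} (hx : x ∈ sliceSpan V) :
    antiConj A x ∈ sliceSpan V := by
  refine sliceSpan_le (W := (sliceSpan V).comap (antiConjL hA).toLinearMap)
    ((isClosed_sliceSpan V).preimage (antiConjL hA).continuous) (fun ξ η => ?_) hx
  rw [Submodule.mem_comap]
  change antiConj A _ ∈ _
  rw [antiConj_vecSlice hA hK, h]
  exact vecSlice_mem _ _ _

/-- The antimultiplicative map `x ↦ A x^* A` reverses the coproduct. -/
theorem IsMultiplicativeUnitary.antiConj_coproduct (hV : IsMultiplicativeUnitary V)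
    (hA : IsConjugation A) (hK : IsConjugation K) (h : antiConj (tensorAnti A K) V = V) {x : Op α}
    (hx : x ∈ sliceSpan V) :
    antiConj (tensorAnti A A) (star V * tensorOp 1 x * V) =
      flip α * (star V * tensorOp 1 (antiConj A x) * V) * flip α := by
  have hA2 := hA.tensor hA
  have hB := hA2.tensor hK
  -- Both sides are linear and norm continuous in x, so the identity defines a closed subspace and
  -- need only be checked on vector slices. The bundled map `ampRight` supplies linearity and
  -- continuity.
  let W : Submodule ℂ (Op α) :=
    { carrier := {x | antiConj (tensorAnti A A) (star V * ampRight α α x * V) =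
        flip α * (star V * ampRight α α (antiConj A x) * V) * flip α}
      add_mem' := fun {x y} hx hy => by
        simp only [Set.mem_ofPred_eq] at hx hy ⊢
        simp only [map_add, antiConj_add, mul_add, add_mul, hx, hy]
      zero_mem' := by
        simp only [Set.mem_ofPred_eq]
        rw [← antiConjL_apply hA, ← antiConjL_apply hA2]
        simp
      smul_mem' := fun c x hx => by
        simp only [Set.mem_ofPred_eq] at hx ⊢
        simp only [map_smul, antiConj_smul, mul_smul_comm, smul_mul_assoc, hx] }
  have hW : IsClosed (W : Set (Op α)) := by
    refine isClosed_eq ?_ ?_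
    · exact (antiConjL hA2).continuous.comp ((continuous_const.mul
        (ampRight α α).continuous).mul continuous_const)
    · exact (continuous_const.mul ((continuous_const.mul ((ampRight α α).continuous.comp
        (antiConjL hA).continuous)).mul continuous_const)).mul continuous_const
  refine sliceSpan_le hW (fun ξ η => ?_) hx
  change antiConj (tensorAnti A A) (star V * tensorOp 1 (vecSlice V ξ η) * V) =
      flip α * (star V * tensorOp 1 (antiConj A (vecSlice V ξ η)) * V) * flip α
  -- Antimultiplicativity turns V₁₃V₂₃ into V₂₃V₁₃. Flipping legs 1 and 2 exchanges the two factors,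
  -- so this is the flip of V₁₃V₂₃.
  rw [hV.coproduct_vecSlice, antiConj_vecSlice hA2 hK, antiConj_vecSlice hA hK, h,
    hV.coproduct_vecSlice, antiConj_mul hB, antiConj_amp13 hA hK, antiConj_amp23 hA, h,
    ← vecSlice_tensor_mul, ← vecSlice_mul_tensor]
  congr 1
  rw [← flip_amp13_flip]
  have hF := tensor_flip_mul_self (α := α) (γ := α)
  simp only [amp13, mul_assoc]
  simp only [← mul_assoc (tensorOp (flip α) (1 : Op α)) (tensorOp (flip α) 1), hF, one_mul, mul_one]

end multiplicativeUnitary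

end

end QDouble

namespace QDouble

noncomputable section

/-! ### Phases, exponentials and the cocycle η_λ -/

section phases

variable {n : ℕ} {lam : ℝ}

theorem e_add (s t : ℝ) : e (s + t) = e s * e t := by
  rw [e, e, e, ← Complex.exp_add]; push_cast; ring_nf

theorem e_zero : e 0 = 1 := by simp [e]

theorem ebar_add (s t : ℝ) : ebar (s + t) = ebar s * ebar t := by
  rw [ebar, neg_add, e_add]; rfl

theorem conj_ebar (t : ℝ) : conj (ebar t) = ebar (-t) := by
  rw [ebar, ebar, e, e, ← Complex.exp_conj]
  congr 1
  simp [Complex.conj_ofReal, map_ofNat]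

variable (n) in
/-- The weighted phase `w^n ē(θ)`. -/
def wph (w θ : ℝ) : ℂ := ((w ^ n : ℝ) : ℂ) * ebar θ

theorem wph_mul (w θ w' θ' : ℝ) : wph n w θ * wph n w' θ' = wph n (w * w') (θ + θ') := by
  simp only [wph, ebar_add, mul_pow]; push_cast; ring

theorem conj_wph (w θ : ℝ) : conj (wph n w θ) = wph n w (-θ) := by
  simp only [wph, map_mul, conj_ebar, Complex.conj_ofReal]

theorem one_eq_wph : (1 : ℂ) = wph n 1 0 := by simp [wph, ebar, e_zero]

theorem wph_one (θ : ℝ) : wph n 1 θ = ebar θ := by simp [wph]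

theorem wph_zero (w : ℝ) : wph n w 0 = ((w ^ n : ℝ) : ℂ) := by simp [wph, ebar, e_zero]

theorem wph_congr {w θ w' θ' : ℝ} (h : w = w') (h' : θ = θ') : wph n w θ = wph n w' θ' := by
  rw [h, h']

@[fun_prop]
theorem measurable_wph {X : Type*} [MeasurableSpace X] {w θ : X → ℝ} (hw : Measurable w)
    (hθ : Measurable θ) : Measurable fun p => wph n (w p) (θ p) := by
  unfold wph
  exact (Complex.measurable_ofReal.comp (hw.pow_const n)).mul
    (continuous_ebar.measurable.comp hθ)

variable (lam) in
/-- `e^{λr}` -/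
def ex (r : ℝ) : ℝ := Real.exp (lam * r)

theorem ex_pos (r : ℝ) : 0 < ex lam r := Real.exp_pos _

@[simp] theorem ex_ne_zero (r : ℝ) : ex lam r ≠ 0 := (ex_pos r).ne'

theorem ex_add (r s : ℝ) : ex lam (r + s) = ex lam r * ex lam s := by
  rw [ex, mul_add, Real.exp_add]; rfl

theorem ex_neg (r : ℝ) : ex lam (-r) = (ex lam r)⁻¹ := by
  rw [ex, mul_neg, Real.exp_neg]; rfl

theorem ex_sub (r s : ℝ) : ex lam (r - s) = ex lam r * (ex lam s)⁻¹ := by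
  rw [sub_eq_add_neg, ex_add, ex_neg]

@[fun_prop] theorem continuous_ex : Continuous (ex lam) := by unfold ex; fun_prop

/-- Treats λ ≠ 0 and λ = 0 uniformly: either η_λ is polynomial in e^{λr}, or the exponential is
trivial and η_λ is the identity. Identities in several radial variables can then be closed by
`ring`. -/
theorem eta_cases (lam : ℝ) :
    (∃ k, ∀ r, eta lam r = k * (ex lam r ^ 2 - 1)) ∨ ∀ r, ex lam r = 1 ∧ eta lam r = r := by
  by_cases h : lam = 0
  · right; intro r; simp [ex, eta, h]
  · left
    refine ⟨1 / (2 * lam), fun r => ?_⟩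
    rw [eta, if_neg h, ex, ← Real.exp_nat_mul]
    push_cast
    rw [mul_assoc 2 lam r]
    ring

theorem eta_add (r s : ℝ) : eta lam (r + s) = eta lam r + ex lam r ^ 2 * eta lam s := by
  rcases eta_cases lam with ⟨k, h⟩ | h
  · rw [h, h, h, ex_add]; ring
  · rw [(h _).2, (h _).2, (h _).2, (h _).1]; ring

theorem eta_neg (r : ℝ) : eta lam (-r) = -((ex lam r)⁻¹ ^ 2 * eta lam r) := by
  rcases eta_cases lam with ⟨k, h⟩ | h
  · rw [h, h, ex_neg]; field_simp; ring
  · rw [(h _).2, (h _).2, (h _).1]; ring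

theorem eta_sub (r s : ℝ) :
    eta lam (r - s) = eta lam r - ex lam r ^ 2 * (ex lam s)⁻¹ ^ 2 * eta lam s := by
  rw [sub_eq_add_neg, eta_add, eta_neg]; ring

/-- The cocycle formula for η_λ(r + s) is not visibly symmetric in r and s; this relation is that
symmetry. It is what `ring` cannot see when η_λ and e^{λr} are treated as independent quantities. -/
theorem eta_mul_comm (r s : ℝ) :
    eta lam r * (ex lam s ^ 2 - 1) = eta lam s * (ex lam r ^ 2 - 1) := by
  rcases eta_cases lam with ⟨k, h⟩ | h
  · rw [h, h]; ring
  · rw [(h _).1, (h _).1]; ring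

@[simp] theorem beta_add_left (x y z : Vec n) : beta (x + y) z = beta x z + beta y z :=
  inner_add_left _ _ _
@[simp] theorem beta_add_right (x y z : Vec n) : beta x (y + z) = beta x y + beta x z :=
  inner_add_right _ _ _
@[simp] theorem beta_sub_left (x y z : Vec n) : beta (x - y) z = beta x z - beta y z :=
  inner_sub_left _ _ _
@[simp] theorem beta_sub_right (x y z : Vec n) : beta x (y - z) = beta x y - beta x z :=
  inner_sub_right _ _ _
@[simp] theorem beta_neg_left (x y : Vec n) : beta (-x) y = -beta x y := inner_neg_left _ _
@[simp] theorem beta_neg_right (x y : Vec n) : beta x (-y) = -beta x y := inner_neg_right _ _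
@[simp] theorem beta_smul_left (a : ℝ) (x y : Vec n) : beta (a • x) y = a * beta x y := by
  simp [beta, real_inner_smul_left]
@[simp] theorem beta_smul_right (a : ℝ) (x y : Vec n) : beta x (a • y) = a * beta x y := by
  simp [beta, real_inner_smul_right]

end phases

/-! ### Explicit forms of J, Ĵ, j, Y, X and Z -/

section operators

variable (n : ℕ) (lam : ℝ)

theorem isAWC_J : IsAWC (J n lam) (fun p => wph n 1 (eta lam p.2.2 * beta p.1 p.2.1))
    (fun p => (-p.1, -p.2.1, p.2.2)) :=
  IsAWC.congr ⟨isWeighted_J n lam, rfl⟩ (fun _ => (wph_one _).symm) (fun _ => rfl)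

theorem isAWC_Jhat : IsAWC (Jhat n lam) (fun p => wph n (ex lam p.2.2) 0)
    (fun p => (ex lam p.2.2 • p.1, ex lam p.2.2 • p.2.1, -p.2.2)) :=
  IsAWC.congr ⟨isWeighted_Jhat n lam, rfl⟩ (fun _ => (wph_zero _).symm) (fun _ => rfl)

theorem isWC_U : IsWC (UA n lam)
    (fun p => wph n (ex lam p.2.2.2)⁻¹ (eta lam p.2.2.2 * beta ((ex lam p.2.2.2)⁻¹ • p.1.1)
      (p.2.2.1 - (ex lam p.2.2.2)⁻¹ • p.1.2.1)))
    (fun p => (((ex lam p.2.2.2)⁻¹ • p.1.1, (ex lam p.2.2.2)⁻¹ • p.1.2.1, p.1.2.2 + p.2.2.2),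
      (p.2.1 - (ex lam p.2.2.2)⁻¹ • p.1.1, p.2.2.1 - (ex lam p.2.2.2)⁻¹ • p.1.2.1, p.2.2.2))) :=
  IsWC.congr ⟨isWeighted_U n lam, rfl⟩ (fun p => by simp [cU, wph, ex, Real.exp_neg])
    (fun p => by simp [tU, ex, Real.exp_neg])

theorem J_comp_J : (J n lam).comp (J n lam) = 1 :=
  ((isAWC_J n lam).comp (isAWC_J n lam)).unique .one
    (fun p => by
      rw [conj_wph, wph_mul, one_eq_wph (n := n)]
      refine wph_congr (by simp) (by simp))
    (fun p => by simp)

theorem Jhat_comp_Jhat : (Jhat n lam).comp (Jhat n lam) = 1 :=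
  ((isAWC_Jhat n lam).comp (isAWC_Jhat n lam)).unique .one
    (fun p => by
      rw [conj_wph, wph_mul, one_eq_wph (n := n)]
      refine wph_congr (by simp [ex_neg]) (by simp))
    (fun p => by simp [ex_neg, smul_smul])

theorem isConjugation_J : IsConjugation (J n lam) where
  apply_apply ξ := DFunLike.congr_fun (J_comp_J n lam) ξ
  inner_map_map := (isAWC_J n lam).inner_map_map

theorem isConjugation_Jhat : IsConjugation (Jhat n lam) where
  apply_apply ξ := DFunLike.congr_fun (Jhat_comp_Jhat n lam) ξ
  inner_map_map := (isAWC_Jhat n lam).inner_map_map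

theorem isWC_j : IsWC (jOp n lam) (fun p => wph n (ex lam p.2.2) (eta lam p.2.2 * beta p.1 p.2.1))
    (fun p => (-(ex lam p.2.2 • p.1), -(ex lam p.2.2 • p.2.1), -p.2.2)) :=
  ((isAWC_Jhat n lam).comp (isAWC_J n lam)).congr
    (fun p => by
      rw [conj_wph, wph_mul]
      refine wph_congr (by simp) ?_
      simp only [eta_neg, beta_smul_left, beta_smul_right]
      field_simp
      ring)
    (fun p => rfl)

theorem isWC_j1 : IsWC (j1 n lam)
    (fun p => wph n (ex lam p.1.2.2) (eta lam p.1.2.2 * beta p.1.1 p.1.2.1))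
    (fun p => ((-(ex lam p.1.2.2 • p.1.1), -(ex lam p.1.2.2 • p.1.2.1), -p.1.2.2), p.2)) :=
  ((isWC_j n lam).tensor .one).congr (fun p => by simp) (fun p => rfl)

theorem isWC_jj : IsWC (jj n lam)
    (fun p => wph n (ex lam p.1.2.2 * ex lam p.2.2.2)
      (eta lam p.1.2.2 * beta p.1.1 p.1.2.1 + eta lam p.2.2.2 * beta p.2.1 p.2.2.1))
    (fun p => ((-(ex lam p.1.2.2 • p.1.1), -(ex lam p.1.2.2 • p.1.2.1), -p.1.2.2),
      (-(ex lam p.2.2.2 • p.2.1), -(ex lam p.2.2.2 • p.2.2.1), -p.2.2.2))) :=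
  ((isWC_j n lam).tensor (isWC_j n lam)).congr (fun _ => wph_mul _ _ _ _) (fun _ => rfl)

theorem isWC_Y : IsWC (Yop n lam)
    (fun p => wph n 1 (-(eta lam p.1.2.2 * (ex lam p.2.2.2 * (ex lam p.1.2.2)⁻¹) *
      beta p.2.1 p.1.2.1)))
    (fun p => ((p.1.1 + (ex lam p.2.2.2 * (ex lam p.1.2.2)⁻¹) • p.2.1,
      p.1.2.1 + (ex lam p.2.2.2 * (ex lam p.1.2.2)⁻¹) • p.2.2.1, p.1.2.2),
      (p.2.1, p.2.2.1, p.2.2.2 - p.1.2.2))) := by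
  refine (((((isWC_flip _).mul (isWC_j1 n lam)).mul (isWC_U n lam)).mul (isWC_j1 n lam)).mul
    (isWC_flip _)).congr ?_ ?_
  · rintro ⟨⟨x, y, r⟩, ⟨x', y', r'⟩⟩
    simp only [Prod.swap, one_mul, mul_one, wph_mul]
    refine wph_congr ?_ ?_
    · simp only [ex_neg, ex_add]
      field_simp
    · simp only [ex_neg, eta_neg, eta_add, beta_smul_left, beta_smul_right, beta_neg_left,
        beta_neg_right, beta_sub_right]
      field_simp
      -- The leftover terms are multiples of β(x', y') and cancel by the symmetry of the η_λ
      -- cocycle.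
      linear_combination (beta x' y') * eta_mul_comm (lam := lam) r' r
  · rintro ⟨⟨x, y, r⟩, ⟨x', y', r'⟩⟩
    simp only [Prod.swap, ex_neg, ex_add, Prod.mk.injEq, and_true]
    refine ⟨⟨?_, ?_⟩, ?_, ?_, ?_⟩
    · match_scalars <;> field_simp
    · match_scalars <;> field_simp
    · match_scalars; field_simp
    · match_scalars; field_simp
    · ring

/-- The stated map and phase are those of the inverse, verified against `isWC_Y`; unitarity
identifies the inverse with the adjoint. -/
theorem isWC_star_Y : IsWC (star (Yop n lam))
    (fun p => wph n 1 (eta lam p.1.2.2 * ex lam p.2.2.2 *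
      beta p.2.1 (p.1.2.1 - ex lam p.2.2.2 • p.2.2.1)))
    (fun p => ((p.1.1 - ex lam p.2.2.2 • p.2.1, p.1.2.1 - ex lam p.2.2.2 • p.2.2.1, p.1.2.2),
      (p.2.1, p.2.2.1, p.2.2.2 + p.1.2.2))) := by
  refine (isWC_Y n lam).star ?_ ?_ ?_ ?_ ?_
  · refine measurable_wph measurable_const (Continuous.measurable (by fun_prop))
  · exact Continuous.measurable (by fun_prop)
  · rintro ⟨⟨x, y, r⟩, ⟨x', y', r'⟩⟩
    simp only [wph_mul]
    rw [one_eq_wph (n := n)]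
    refine wph_congr (by simp) ?_
    simp only [ex_sub, beta_smul_right, beta_sub_right, beta_add_right]
    ring
  · rintro ⟨⟨x, y, r⟩, ⟨x', y', r'⟩⟩
    simp [ex_sub]
  · rintro ⟨⟨x, y, r⟩, ⟨x', y', r'⟩⟩
    simp [ex_add]

theorem isWC_X : IsWC (Xop n lam)
    (fun p => wph n 1 (eta lam p.2.2.2 * ex lam p.1.2.2 *
      beta p.1.1 (p.2.2.1 - ex lam p.1.2.2 • p.1.2.1)))
    (fun p => ((p.1.1, p.1.2.1, p.1.2.2 + p.2.2.2),
      (p.2.1 - ex lam p.1.2.2 • p.1.1, p.2.2.1 - ex lam p.1.2.2 • p.1.2.1, p.2.2.2))) :=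
  (((isWC_flip _).mul (isWC_star_Y n lam)).mul (isWC_flip _)).congr
    (fun p => by simp) (fun p => by simp [Prod.swap])

theorem star_X : star (Xop n lam) = flip (Pt n) * Yop n lam * flip (Pt n) := by
  simp only [Xop, star_mul, star_flip, star_star, mul_assoc]

theorem isWC_star_X : IsWC (star (Xop n lam))
    (fun p => wph n 1 (-(eta lam p.2.2.2 * (ex lam p.1.2.2 * (ex lam p.2.2.2)⁻¹) *
      beta p.1.1 p.2.2.1)))
    (fun p => ((p.1.1, p.1.2.1, p.1.2.2 - p.2.2.2),
      (p.2.1 + (ex lam p.1.2.2 * (ex lam p.2.2.2)⁻¹) • p.1.1,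
      p.2.2.1 + (ex lam p.1.2.2 * (ex lam p.2.2.2)⁻¹) • p.1.2.1, p.2.2.2))) := by
  rw [star_X]
  exact (((isWC_flip _).mul (isWC_Y n lam)).mul (isWC_flip _)).congr
    (fun p => by simp) (fun p => by simp [Prod.swap])

/-- The radial shifts in the two occurrences of Y compensate, so Z fixes both r and r'. For fixed r
and r' its point map is linear in the remaining variables. -/
theorem isWC_Z : IsWC (Zop n lam)
    (fun p => wph n (ex lam p.1.2.2) (eta lam p.1.2.2 * (ex lam p.2.2.2 * beta p.2.1 p.1.2.1 -
      beta p.1.1 p.2.2.1 + (ex lam p.2.2.2 - ex lam p.2.2.2 ^ 2) * beta p.2.1 p.2.2.1)))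
    (fun p => ((p.1.1 + (1 - ex lam p.2.2.2) • p.2.1, p.1.2.1 + (1 - ex lam p.2.2.2) • p.2.2.1,
      p.1.2.2), (ex lam p.1.2.2 • p.2.1, ex lam p.1.2.2 • p.2.2.1, p.2.2.2))) := by
  refine ((isWC_star_Y n lam).mul (((isWC_jj n lam).mul (isWC_Y n lam)).mul
    (isWC_jj n lam))).congr ?_ ?_
  · rintro ⟨⟨x, y, r⟩, ⟨x', y', r'⟩⟩
    simp only [wph_mul]
    refine wph_congr ?_ ?_
    · simp only [ex_neg, ex_add, ex_sub]
      field_simp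
    · simp only [ex_neg, ex_add, eta_neg, eta_add, eta_sub, beta_smul_left,
        beta_smul_right, beta_neg_left, beta_neg_right, beta_sub_right, beta_add_right,
        beta_sub_left, beta_add_left]
      field_simp
      ring
  · rintro ⟨⟨x, y, r⟩, ⟨x', y', r'⟩⟩
    simp only [ex_neg, ex_add, ex_sub, Prod.mk.injEq]
    refine ⟨⟨?_, ?_, ?_⟩, ?_, ?_, ?_⟩
    · match_scalars <;> field_simp
      ring
    · match_scalars <;> field_simp
      ring
    · ring
    · match_scalars; field_simp
    · match_scalars; field_simp
    · ring

theorem isWC_star_Z : IsWC (star (Zop n lam))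
    (fun p => wph n (ex lam p.1.2.2)⁻¹ (-(eta lam p.1.2.2 * (ex lam p.1.2.2)⁻¹ *
      (ex lam p.2.2.2 * beta p.2.1 p.1.2.1 - beta p.1.1 p.2.2.1 +
        (1 - ex lam p.2.2.2) * (ex lam p.1.2.2)⁻¹ * beta p.2.1 p.2.2.1))))
    (fun p => ((p.1.1 - ((1 - ex lam p.2.2.2) * (ex lam p.1.2.2)⁻¹) • p.2.1,
      p.1.2.1 - ((1 - ex lam p.2.2.2) * (ex lam p.1.2.2)⁻¹) • p.2.2.1, p.1.2.2),
      ((ex lam p.1.2.2)⁻¹ • p.2.1, (ex lam p.1.2.2)⁻¹ • p.2.2.1, p.2.2.2))) := by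
  refine (isWC_Z n lam).star ?_ ?_ ?_ ?_ ?_
  · refine measurable_wph (Continuous.measurable ?_) (Continuous.measurable ?_)
    · exact Continuous.inv₀ (by fun_prop) (fun p => ex_ne_zero _)
    · have : Continuous fun p : Pt n × Pt n => (ex lam p.1.2.2)⁻¹ :=
        Continuous.inv₀ (by fun_prop) (fun p => ex_ne_zero _)
      fun_prop
  · have : Continuous fun p : Pt n × Pt n => (ex lam p.1.2.2)⁻¹ :=
      Continuous.inv₀ (by fun_prop) (fun p => ex_ne_zero _)
    exact Continuous.measurable (by fun_prop)
  · rintro ⟨⟨x, y, r⟩, ⟨x', y', r'⟩⟩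
    simp only [wph_mul]
    rw [one_eq_wph (n := n)]
    refine wph_congr (by simp) ?_
    simp only [beta_smul_right, beta_add_right, beta_smul_left, beta_add_left]
    field_simp
    ring
  · rintro ⟨⟨x, y, r⟩, ⟨x', y', r'⟩⟩
    simp [smul_smul]
  · rintro ⟨⟨x, y, r⟩, ⟨x', y', r'⟩⟩
    simp [smul_smul]

end operators

end

end QDouble

namespace QDouble

noncomputable section

/-! ### The multiplicative unitary of the double and its antiunitary symmetry -/

section doubleUnitary

variable (n : ℕ) (lam : ℝ)

theorem IsWC.leg12 {α : Type} [MeasureSpace α] [SigmaFinite (volume : Measure α)]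
    {T : Op (α × α)} {c : α × α → ℂ} {τ : α × α → α × α} (h : IsWC T c τ) :
    IsWC (leg12 T) (fun p => c p.1) (fun p => (τ p.1, p.2)) :=
  (h.tensor .one).congr (fun p => by simp) (fun _ => rfl)

theorem IsWC.leg13 {α : Type} [MeasureSpace α] [SigmaFinite (volume : Measure α)]
    {T : Op (α × α)} {c : α × α → ℂ} {τ : α × α → α × α} (h : IsWC T c τ) :
    IsWC (leg13 T) (fun p => c (p.1.1, p.2.1))
      (fun p => (((τ (p.1.1, p.2.1)).1, p.1.2), ((τ (p.1.1, p.2.1)).2, p.2.2))) :=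
  (((isWC_midFlip α).mul (h.tensor .one)).mul (isWC_midFlip α)).congr
    (fun p => by simp [mid]) (fun _ => rfl)

theorem IsWC.leg24 {α : Type} [MeasureSpace α] [SigmaFinite (volume : Measure α)]
    {T : Op (α × α)} {c : α × α → ℂ} {τ : α × α → α × α} (h : IsWC T c τ) :
    IsWC (leg24 T) (fun p => c (p.1.2, p.2.2))
      (fun p => ((p.1.1, (τ (p.1.2, p.2.2)).1), (p.2.1, (τ (p.1.2, p.2.2)).2))) :=
  (((isWC_midFlip α).mul (IsWC.one.tensor h)).mul (isWC_midFlip α)).congr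
    (fun p => by simp [mid]) (fun _ => rfl)

/-- The weight has modulus one: the scaling factors from Z₁₂ and Z₁₂^* are evaluated at the same
first radial variable, which Y₂₄ leaves alone, and they cancel. -/
theorem isWC_VD : IsWC (VD n lam)
    (fun p => wph n 1
      (eta lam p.1.1.2.2 * (ex lam p.2.2.2.2 * (ex lam p.1.1.2.2)⁻¹ * (ex lam p.1.2.2.2)⁻¹) *
        (beta p.1.1.1 p.2.2.2.1 - ex lam p.1.2.2.2 * beta p.2.2.1 p.1.1.2.1 -
          (1 - ex lam p.1.2.2.2) *
          (ex lam p.2.2.2.2 * (ex lam p.1.1.2.2)⁻¹ * (ex lam p.1.2.2.2)⁻¹) *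
          beta p.2.2.1 p.2.2.2.1) -
      (ex lam p.2.2.2.2 * (ex lam p.1.1.2.2)⁻¹ * (ex lam p.1.2.2.2)⁻¹) * eta lam p.1.2.2.2 *
        beta p.2.2.1 p.1.2.2.1 +
      eta lam p.2.1.2.2 * beta
        (ex lam p.1.1.2.2 • p.1.1.1 -
          ((1 - ex lam p.1.2.2.2) * ex lam p.2.2.2.2 * (ex lam p.1.2.2.2)⁻¹) • p.2.2.1)
        (p.2.1.2.1 - ex lam p.1.1.2.2 • p.1.1.2.1 +
          ((1 - ex lam p.1.2.2.2) * ex lam p.2.2.2.2 * (ex lam p.1.2.2.2)⁻¹) • p.2.2.2.1)))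
    (fun p => (((p.1.1.1 - ((1 - ex lam p.1.2.2.2) *
        (ex lam p.2.2.2.2 * (ex lam p.1.1.2.2)⁻¹ * (ex lam p.1.2.2.2)⁻¹)) • p.2.2.1,
      p.1.1.2.1 - ((1 - ex lam p.1.2.2.2) *
        (ex lam p.2.2.2.2 * (ex lam p.1.1.2.2)⁻¹ * (ex lam p.1.2.2.2)⁻¹)) • p.2.2.2.1,
      p.1.1.2.2 + p.2.1.2.2),
      (p.1.2.1 + (ex lam p.2.2.2.2 * (ex lam p.1.1.2.2)⁻¹ * (ex lam p.1.2.2.2)⁻¹) • p.2.2.1,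
      p.1.2.2.1 + (ex lam p.2.2.2.2 * (ex lam p.1.1.2.2)⁻¹ * (ex lam p.1.2.2.2)⁻¹) • p.2.2.2.1,
      p.1.2.2.2)),
      ((p.2.1.1 - ex lam p.1.1.2.2 • p.1.1.1 +
        ((1 - ex lam p.1.2.2.2) * ex lam p.2.2.2.2 * (ex lam p.1.2.2.2)⁻¹) • p.2.2.1,
      p.2.1.2.1 - ex lam p.1.1.2.2 • p.1.1.2.1 +
        ((1 - ex lam p.1.2.2.2) * ex lam p.2.2.2.2 * (ex lam p.1.2.2.2)⁻¹) • p.2.2.2.1,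
      p.2.1.2.2),
      (p.2.2.1, p.2.2.2.1, p.2.2.2.2 - p.1.2.2.2)))) := by
  have hZ : star (leg12 (Zop n lam)) = leg12 (star (Zop n lam)) := by
    rw [leg12, leg12, star_tensorOp, star_one]
  rw [VD, hZ]
  refine ((((isWC_Z n lam).leg12.mul (isWC_Y n lam).leg24).mul (isWC_star_Z n lam).leg12).mul
    (isWC_X n lam).leg13).congr ?_ ?_
  · rintro ⟨⟨⟨x1, y1, r1⟩, ⟨x2, y2, r2⟩⟩, ⟨⟨x3, y3, r3⟩, ⟨x4, y4, r4⟩⟩⟩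
    simp only [wph_mul]
    refine wph_congr ?_ ?_
    · field_simp
    · simp only [beta_smul_left, beta_smul_right, beta_sub_right, beta_add_right,
        beta_sub_left, beta_add_left]
      field_simp
      linear_combination (-ex lam r1 * ex lam r2 * ex lam r4 * beta x4 y2) * eta_mul_comm (lam := lam) r2 r1
  · rintro ⟨⟨⟨x1, y1, r1⟩, ⟨x2, y2, r2⟩⟩, ⟨⟨x3, y3, r3⟩, ⟨x4, y4, r4⟩⟩⟩
    simp only [Prod.mk.injEq, and_true]
    refine ⟨⟨⟨?_, ?_⟩, ?_, ?_⟩, ?_, ?_⟩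
    all_goals match_scalars <;> field_simp <;> ring

theorem star_leg12 (T : Op (Pt n × Pt n)) : star (leg12 T) = leg12 (star T) := by
  rw [leg12, leg12, star_tensorOp, star_one]

theorem star_midFlip : star (midFlip (Pt n)) = midFlip (Pt n) := by
  have h1 : midFlip (Pt n) * midFlip (Pt n) = 1 :=
    ((isWC_midFlip _).mul (isWC_midFlip _)).unique .one (by simp) (by simp [mid])
  have h := (isWC_midFlip (Pt n)).star_mul_self
  calc star (midFlip (Pt n)) = star (midFlip (Pt n)) * (midFlip (Pt n) * midFlip (Pt n)) := by
        rw [h1, mul_one]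
    _ = midFlip (Pt n) := by rw [← mul_assoc, h, one_mul]

theorem star_leg13 (T : Op (Pt n × Pt n)) : star (leg13 T) = leg13 (star T) := by
  simp only [leg13, star_mul, star_midFlip, star_tensorOp, star_one, mul_assoc]

theorem star_leg24 (T : Op (Pt n × Pt n)) : star (leg24 T) = leg24 (star T) := by
  simp only [leg24, star_mul, star_midFlip, star_tensorOp, star_one, mul_assoc]

/-- The adjoint is a product of adjoints already known to be weighted compositions, hence an
isometry; no closed form for the inverse of V_D is needed. -/
theorem VD_mul_star_self : VD n lam * star (VD n lam) = 1 := by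
  have h : star (VD n lam) = leg13 (star (Xop n lam)) * (leg12 (Zop n lam) *
      (leg24 (star (Yop n lam)) * leg12 (star (Zop n lam)))) := by
    simp only [VD, star_mul, star_star, star_leg12, star_leg13, star_leg24]
  have h2 := (isWC_star_X n lam).leg13.mul ((isWC_Z n lam).leg12.mul
    ((isWC_star_Y n lam).leg24.mul (isWC_star_Z n lam).leg12))
  rw [← h] at h2
  exact h2.mul_star_self_of_star

/-- The antiunitary on the second tensor factor that is compatible with `Ĵ_D`. -/
def KD : AntiOp (Pt n × Pt n) := (Zop n lam).comp (tensorAnti (Jhat n lam) (J n lam))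

theorem isAWC_KD : IsAWC (KD n lam)
    (fun p => wph n (ex lam p.1.2.2 ^ 2) (eta lam p.1.2.2 * (ex lam p.2.2.2 * beta p.2.1 p.1.2.1 -
      beta p.1.1 p.2.2.1 + (ex lam p.2.2.2 - ex lam p.2.2.2 ^ 2) * beta p.2.1 p.2.2.1) +
      eta lam p.2.2.2 * ex lam p.1.2.2 ^ 2 * beta p.2.1 p.2.2.1))
    (fun p => ((ex lam p.1.2.2 • (p.1.1 + (1 - ex lam p.2.2.2) • p.2.1),
      ex lam p.1.2.2 • (p.1.2.1 + (1 - ex lam p.2.2.2) • p.2.2.1), -p.1.2.2),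
      (-(ex lam p.1.2.2 • p.2.1), -(ex lam p.1.2.2 • p.2.2.1), p.2.2.2))) :=
  ((isWC_Z n lam).comp_anti ((isAWC_Jhat n lam).tensor (isAWC_J n lam))).congr
    (fun p => by
      simp only [wph_mul]
      refine wph_congr (by ring) ?_
      simp only [beta_smul_left, beta_smul_right]
      ring)
    (fun _ => rfl)

theorem KD_comp_KD : (KD n lam).comp (KD n lam) = 1 :=
  ((isAWC_KD n lam).comp (isAWC_KD n lam)).unique .one
    (fun p => by
      rw [conj_wph, wph_mul, one_eq_wph (n := n)]
      refine wph_congr ?_ ?_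
      · simp only [ex_neg]
        field_simp
      · simp only [ex_neg, eta_neg, beta_smul_left, beta_smul_right, beta_add_left, beta_add_right,
          beta_neg_left, beta_neg_right]
        field_simp
        -- Z contributes η_λ(r) and J contributes η_λ(r') in front of the same form β(x', y'); the
        -- cocycle symmetry is what makes them cancel.
        linear_combination beta p.2.1 p.2.2.1 * eta_mul_comm (lam := lam) p.2.2.2 p.1.2.2)
    (fun p => by
      rcases p with ⟨⟨x, y, r⟩, ⟨x', y', r'⟩⟩
      simp only [ex_neg, Prod.mk.injEq, and_true]
      refine ⟨⟨?_, ?_, ?_⟩, ?_, ?_⟩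
      · match_scalars <;> field_simp
        ring
      · match_scalars <;> field_simp
        ring
      · ring
      · match_scalars; field_simp
      · match_scalars; field_simp)

theorem isConjugation_KD : IsConjugation (KD n lam) where
  apply_apply ξ := DFunLike.congr_fun (KD_comp_KD n lam) ξ
  inner_map_map := (isAWC_KD n lam).inner_map_map

theorem isConjugation_JDhat : IsConjugation (JDhat n lam) :=
  (isConjugation_J n lam).tensor (isConjugation_Jhat n lam)

theorem isAWC_JDhat : IsAWC (JDhat n lam)
    (fun p => wph n (ex lam p.2.2.2) (eta lam p.1.2.2 * beta p.1.1 p.1.2.1))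
    (fun p => ((-p.1.1, -p.1.2.1, p.1.2.2),
      (ex lam p.2.2.2 • p.2.1, ex lam p.2.2.2 • p.2.2.1, -p.2.2.2))) :=
  ((isAWC_J n lam).tensor (isAWC_Jhat n lam)).congr
    (fun p => by rw [wph_mul]; exact wph_congr (by simp) (by simp)) (fun _ => rfl)

theorem isAWC_JDhat_tensor_KD : IsAWC (tensorAnti (JDhat n lam) (KD n lam))
    (fun p => wph n (ex lam p.1.2.2.2 * ex lam p.2.1.2.2 ^ 2)
      (eta lam p.1.1.2.2 * beta p.1.1.1 p.1.1.2.1 +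
        (eta lam p.2.1.2.2 * (ex lam p.2.2.2.2 * beta p.2.2.1 p.2.1.2.1 -
      beta p.2.1.1 p.2.2.2.1 + (ex lam p.2.2.2.2 - ex lam p.2.2.2.2 ^ 2) *
        beta p.2.2.1 p.2.2.2.1) +
      eta lam p.2.2.2.2 * ex lam p.2.1.2.2 ^ 2 * beta p.2.2.1 p.2.2.2.1)))
    (fun p => (((-p.1.1.1, -p.1.1.2.1, p.1.1.2.2),
      (ex lam p.1.2.2.2 • p.1.2.1, ex lam p.1.2.2.2 • p.1.2.2.1, -p.1.2.2.2)),
      ((ex lam p.2.1.2.2 • (p.2.1.1 + (1 - ex lam p.2.2.2.2) • p.2.2.1),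
      ex lam p.2.1.2.2 • (p.2.1.2.1 + (1 - ex lam p.2.2.2.2) • p.2.2.2.1), -p.2.1.2.2),
      (-(ex lam p.2.1.2.2 • p.2.2.1), -(ex lam p.2.1.2.2 • p.2.2.2.1), p.2.2.2.2)))) :=
  ((isAWC_JDhat n lam).tensor (isAWC_KD n lam)).congr (fun _ => wph_mul _ _ _ _) (fun _ => rfl)

/-- With C = Ĵ_D ⊗ K_D this is equivalent to C V_D^* C = V_D, and it has the advantage that only V_D
itself occurs, not its adjoint. -/
theorem VD_comp_anti_comp_VD :
    ((VD n lam).comp (tensorAnti (JDhat n lam) (KD n lam))).comp (VD n lam) =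
      tensorAnti (JDhat n lam) (KD n lam) := by
  refine IsAWC.unique (((isWC_VD n lam).comp_anti (isAWC_JDhat_tensor_KD n lam)).comp_wc
    (isWC_VD n lam)) (isAWC_JDhat_tensor_KD n lam) ?_ ?_
  · rintro ⟨⟨⟨x1, y1, r1⟩, ⟨x2, y2, r2⟩⟩, ⟨⟨x3, y3, r3⟩, ⟨x4, y4, r4⟩⟩⟩
    simp only [wph_mul, conj_wph]
    refine wph_congr (by simp) ?_
    simp only [ex_neg, ex_add, ex_sub, eta_neg, eta_add, eta_sub, beta_smul_left,
        beta_smul_right, beta_neg_left, beta_neg_right, beta_sub_right, beta_add_right,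
        beta_sub_left, beta_add_left]
    -- For λ ≠ 0 everything becomes rational in the e^{λr_i}; for λ = 0 it is polynomial in the r_i.
    rcases eta_cases lam with ⟨k, h⟩ | h
    · simp only [h]
      field_simp
      ring
    · simp only [fun r => (h r).1, fun r => (h r).2]
      ring
  · rintro ⟨⟨⟨x1, y1, r1⟩, ⟨x2, y2, r2⟩⟩, ⟨⟨x3, y3, r3⟩, ⟨x4, y4, r4⟩⟩⟩
    simp only [ex_neg, ex_add, ex_sub, Prod.mk.injEq]
    refine ⟨⟨⟨?_, ?_, ?_⟩, ?_, ?_, ?_⟩, ⟨?_, ?_, ?_⟩, ?_, ?_, ?_⟩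
    all_goals first | trivial | ring1 | (match_scalars <;> field_simp <;> ring1)

/-- The symmetry responsible for S_D preserving A_D and reversing Δ_D. From V C V = C and V^*V = 1
one gets V^*C = CV, and then C² = 1 finishes. -/
theorem antiConj_VD : antiConj (tensorAnti (JDhat n lam) (KD n lam)) (VD n lam) = VD n lam := by
  have hC := (isConjugation_JDhat n lam).tensor (isConjugation_KD n lam)
  have h : ∀ ξ, star (VD n lam) (tensorAnti (JDhat n lam) (KD n lam) ξ)
      = tensorAnti (JDhat n lam) (KD n lam) (VD n lam ξ) := by
    intro ξ
    have h1 := DFunLike.congr_fun (VD_comp_anti_comp_VD n lam) ξ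
    rw [← h1, ContinuousLinearMap.comp_apply, ContinuousLinearMap.comp_apply, ← mul_apply_eq_comp,
      (isWC_VD n lam).star_mul_self]
    rfl
  ext1 ξ
  rw [antiConj_apply, h, hC.apply_apply]

theorem IsWC.amp23 {α β γ : Type} [MeasureSpace α] [MeasureSpace β] [MeasureSpace γ]
    [SigmaFinite (volume : Measure α)] [SigmaFinite (volume : Measure β)]
    [SigmaFinite (volume : Measure γ)] {T : Op (β × γ)} {c : β × γ → ℂ} {τ : β × γ → β × γ}
    (h : IsWC T c τ) : IsWC (amp23 T : Op ((α × β) × γ)) (fun p => c (p.1.2, p.2))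
      (fun p => ((p.1.1, (τ (p.1.2, p.2)).1), (τ (p.1.2, p.2)).2)) :=
  (isWC_assocR.comp ((IsWC.one.tensor h).comp isWC_assocL)).congr (fun p => by simp) (fun _ => rfl)

theorem IsWC.amp13 {α γ : Type} [MeasureSpace α] [MeasureSpace γ]
    [SigmaFinite (volume : Measure α)] [SigmaFinite (volume : Measure γ)] {T : Op (α × γ)}
    {c : α × γ → ℂ} {τ : α × γ → α × γ} (h : IsWC T c τ) :
    IsWC (amp13 T) (fun p => c (p.1.1, p.2))
      (fun p => (((τ (p.1.1, p.2)).1, p.1.2), (τ (p.1.1, p.2)).2)) :=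
  ((((isWC_flip α).tensor .one).mul h.amp23).mul ((isWC_flip α).tensor .one)).congr
    (fun p => by simp) (fun _ => rfl)

theorem isMultiplicativeUnitary_VD : IsMultiplicativeUnitary (VD n lam) where
  star_mul_self := (isWC_VD n lam).star_mul_self
  mul_star_self := VD_mul_star_self n lam
  pentagon := by
    have h := isWC_VD n lam
    -- The pentagon equation is compared in eighteen variables, three for each of six elementary
    -- legs: one goal for the phase, one for the point map.
    refine (((h.tensor .one).mul h.amp13).mul h.amp23).unique (h.amp23.mul (h.tensor .one)) ?_ ?_
    · rintro ⟨⟨⟨⟨x1, y1, r1⟩, ⟨x2, y2, r2⟩⟩, ⟨⟨x3, y3, r3⟩, ⟨x4, y4, r4⟩⟩⟩,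
        ⟨⟨x5, y5, r5⟩, ⟨x6, y6, r6⟩⟩⟩
      simp only [wph_mul, mul_one]
      refine wph_congr (by simp) ?_
      simp only [ex_add, ex_sub, eta_add, eta_sub, beta_smul_left,
        beta_smul_right, beta_sub_right, beta_add_right, beta_sub_left, beta_add_left]
      rcases eta_cases lam with ⟨k, h⟩ | h
      · simp only [h]
        field_simp
        ring
      · simp only [fun r => (h r).1, fun r => (h r).2]
        ring
    · rintro ⟨⟨⟨⟨x1, y1, r1⟩, ⟨x2, y2, r2⟩⟩, ⟨⟨x3, y3, r3⟩, ⟨x4, y4, r4⟩⟩⟩,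
        ⟨⟨x5, y5, r5⟩, ⟨x6, y6, r6⟩⟩⟩
      simp only [ex_add, ex_sub, Prod.mk.injEq]
      refine ⟨⟨⟨⟨?_, ?_, ?_⟩, ?_, ?_, ?_⟩, ⟨?_, ?_, ?_⟩, ?_, ?_, ?_⟩, ⟨?_, ?_, ?_⟩, ?_, ?_, ?_⟩
      all_goals first | trivial | ring1 | (match_scalars <;> field_simp <;> ring1)

end doubleUnitary

end

end QDouble

namespace QDouble

noncomputable section

/-! ### Symmetries of X, Y, Z and of their slices -/

section legOperators

variable (n : ℕ) (lam : ℝ)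

theorem antiConj_eq_self_of_comp {α : Type} [MeasureSpace α] [SigmaFinite (volume : Measure α)]
    {C : AntiOp α} (hC : IsConjugation C) {T : Op α} (hT : star T * T = 1)
    (h : (T.comp C).comp T = C) : antiConj C T = T := by
  ext1 ξ
  have h1 := DFunLike.congr_fun h ξ
  rw [antiConj_apply, ← h1, ContinuousLinearMap.comp_apply, ContinuousLinearMap.comp_apply,
    ← mul_apply_eq_comp, hT, one_apply_eq_self, hC.apply_apply]

/-- The analogue for X of the symmetry of V_D; it makes Ŝ preserve the slices of X, and through
ΣX^*Σ = Y it makes S preserve those of Y. -/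
theorem antiConj_X : antiConj (JDhat n lam) (Xop n lam) = Xop n lam := by
  refine antiConj_eq_self_of_comp (isConjugation_JDhat n lam) (isWC_X n lam).star_mul_self
    ((((isWC_X n lam).comp_anti (isAWC_JDhat n lam)).comp_wc (isWC_X n lam)).unique
      (isAWC_JDhat n lam) ?_ ?_)
  · rintro ⟨⟨x, y, r⟩, ⟨x', y', r'⟩⟩
    simp only [wph_mul, conj_wph]
    refine wph_congr (by simp) ?_
    simp only [ex_add, eta_neg, eta_add, beta_smul_right, beta_neg_left,
      beta_neg_right, beta_sub_right]
    field_simp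
    ring
  · rintro ⟨⟨x, y, r⟩, ⟨x', y', r'⟩⟩
    simp only [ex_add, Prod.mk.injEq]
    refine ⟨⟨?_, ?_, ?_⟩, ?_, ?_, ?_⟩
    all_goals first | trivial | ring1 | (match_scalars <;> field_simp <;> ring1)

/-- Commutation with Z means that S_D exchanges Z and Z^*. Conjugation by Z, and hence the form of
π, thus survives the antimultiplicative map. -/
theorem JDhat_comp_Z : (JDhat n lam).comp (Zop n lam) = (Zop n lam).comp (JDhat n lam) := by
  refine ((isAWC_JDhat n lam).comp_wc (isWC_Z n lam)).unique
    ((isWC_Z n lam).comp_anti (isAWC_JDhat n lam)) ?_ ?_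
  · rintro ⟨⟨x, y, r⟩, ⟨x', y', r'⟩⟩
    simp only [wph_mul, conj_wph]
    refine wph_congr (by ring) ?_
    simp only [ex_neg, beta_smul_left, beta_smul_right, beta_neg_left,
      beta_neg_right, beta_add_left, beta_add_right]
    field_simp
    ring
  · rintro ⟨⟨x, y, r⟩, ⟨x', y', r'⟩⟩
    simp only [ex_neg, Prod.mk.injEq]
    refine ⟨⟨?_, ?_, ?_⟩, ?_, ?_, ?_⟩
    all_goals first | trivial | ring1 | (match_scalars <;> field_simp <;> ring1)

theorem antiConj_star_Z : antiConj (JDhat n lam) (star (Zop n lam)) = Zop n lam := by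
  ext1 ξ
  rw [antiConj_apply, star_star, ← ContinuousLinearMap.comp_apply, JDhat_comp_Z,
    ContinuousLinearMap.comp_apply, (isConjugation_JDhat n lam).apply_apply]

theorem antiConj_Z : antiConj (JDhat n lam) (Zop n lam) = star (Zop n lam) := by
  have h := antiConj_star_Z n lam
  rw [antiConj_star (isConjugation_JDhat n lam)] at h
  rw [← star_star (antiConj (JDhat n lam) (Zop n lam)), h]

/-- Over each fixed first coordinate the map is a translation. -/
theorem measurePreserving_shear {v : Pt n → Pt n} (hv : Measurable v) :
    MeasurePreserving fun z : Pt n × Pt n => (z.1, z.2 + v z.1) := by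
  have := isAddRightInvariant_pt (n := n)
  refine MeasurePreserving.skew_product (g := fun p q => q + v p)
    (MeasurePreserving.id (volume : Measure (Pt n))) ?_
    (Eventually.of_forall fun p => (measurePreserving_add_right (volume : Measure (Pt n)) (v p)).map_eq)
  exact measurable_snd.add (hv.comp measurable_fst)

/-- A shear followed by the change of variables of Ĵ in the second leg, chosen so that composing it
with X^* matches the form of X with Ĵ inserted. -/
theorem isWeighted_shear_Jhat : IsWeighted (fun z : Pt n × Pt n => wph n (ex lam z.2.2.2) 0)
    (fun z => (z.1, (ex lam z.2.2.2 • (z.2.1 - ex lam z.1.2.2 • z.1.1),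
      ex lam z.2.2.2 • (z.2.2.1 - ex lam z.1.2.2 • z.1.2.1), -z.2.2.2))) := by
  have h1 := measurePreserving_shear n
    (v := fun p => (-(ex lam p.2.2 • p.1), -(ex lam p.2.2 • p.2.1), 0))
    (Continuous.measurable (by fun_prop))
  obtain ⟨h2, -⟩ := isAWC_Jhat n lam
  have h3 := (IsWeighted.of_measurePreserving (c := fun _ => 1) measurable_const (by simp) h1).comp
    (IsWeighted.id.prod h2)
  have : IsWC (weightedComp _ _ h3) _ _ := ⟨h3, rfl⟩
  refine (this.congr (fun p => ?_) (fun p => ?_)).choose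
  · simp
  · simp [sub_eq_add_neg]

/-- This is the statement that the adjoint of a slice of X is a slice of X, written with matrix
coefficients. -/
theorem inner_star_X (ζ ζ' ξ η : L2 (Pt n)) :
    ⟪tmulL2 ζ η, star (Xop n lam) (tmulL2 ζ' ξ)⟫_ℂ =
      ⟪tmulL2 ζ (Jhat n lam ξ), Xop n lam (tmulL2 ζ' (Jhat n lam η))⟫_ℂ := by
  have hM : IsWC (weightedComp _ _ (isWeighted_shear_Jhat n lam)) _ _ := ⟨_, rfl⟩
  have hMX := (hM.comp (isWC_star_X n lam)).congr (c' := fun p => wph n (ex lam p.2.2.2)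
      (eta lam p.2.2.2 * ex lam p.1.2.2 * beta p.1.1 (p.2.2.1 - ex lam p.1.2.2 • p.1.2.1)))
      (τ' := fun p => ((p.1.1, p.1.2.1, p.1.2.2 + p.2.2.2),
      (ex lam p.2.2.2 • p.2.1, ex lam p.2.2.2 • p.2.2.1, -p.2.2.2)))
    (by
      rintro ⟨⟨x, y, r⟩, ⟨x', y', r'⟩⟩
      simp only [wph_mul]
      refine wph_congr (by ring) ?_
      simp only [ex_neg, eta_neg, beta_smul_right, beta_sub_right]
      field_simp
      ring)
    (by
      rintro ⟨⟨x, y, r⟩, ⟨x', y', r'⟩⟩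
      simp only [ex_neg, Prod.mk.injEq]
      refine ⟨⟨?_, ?_, ?_⟩, ?_, ?_, ?_⟩
      all_goals first | trivial | ring1 | (match_scalars <;> field_simp <;> ring1))
  have hX := isWC_X n lam
  have hJ := isAWC_Jhat n lam
  -- Applying the isometry to both entries on the left performs the change of variables; afterwards
  -- the two integrands agree almost everywhere.
  rw [← hM.inner_map_map, L2.inner_def, L2.inner_def]
  refine integral_congr_ae ?_
  have hMX' := hMX.choose
  have hX' := hX.choose
  filter_upwards [hM.coeFn (tmulL2 ζ η), (isWeighted_shear_Jhat n lam).qmp.ae (coeFn_tmulL2 ζ η),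
    hMX.coeFn (tmulL2 ζ' ξ), hMX'.qmp.ae (coeFn_tmulL2 ζ' ξ),
    coeFn_tmulL2 ζ (Jhat n lam ξ), ae_snd_of_ae (α := Pt n) (hJ.coeFn ξ),
    hX.coeFn (tmulL2 ζ' (Jhat n lam η)), hX'.qmp.ae (coeFn_tmulL2 ζ' (Jhat n lam η)),
    hX'.qmp.ae (ae_snd_of_ae (α := Pt n) (hJ.coeFn η))] with p h1 h2 h3 h4 h5 h6 h7 h8 h9
  rw [h1, h2, ← ContinuousLinearMap.comp_apply, h3, h4, h5, h6, h7, h8, h9]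
  simp only [RCLike.inner_apply, map_mul, conj_wph, RingHomCompTriple.comp_apply, RingHom.id_apply]
  rw [show wph n (ex lam p.2.2.2) (eta lam p.2.2.2 * ex lam p.1.2.2 * beta p.1.1
    (p.2.2.1 - ex lam p.1.2.2 • p.1.2.1)) = wph n (ex lam p.2.2.2) 0 * wph n 1
    (eta lam p.2.2.2 * ex lam p.1.2.2 * beta p.1.1 (p.2.2.1 - ex lam p.1.2.2 • p.1.2.1)) by
    rw [wph_mul]; exact wph_congr (by ring) (by ring)]
  simp only [neg_zero]
  ring

/-- The adjoint of a slice of `X` is a slice of `X`. -/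
theorem star_vecSlice_X (ξ η : L2 (Pt n)) : star (vecSlice (Xop n lam) ξ η) =
    vecSlice (Xop n lam) (Jhat n lam ξ) (Jhat n lam η) := by
  refine op_ext_inner fun ζ ζ' => ?_
  rw [star_vecSlice, inner_vecSlice, inner_vecSlice, inner_star_X]

/-- Since Y = ΣX^*Σ, slicing Y on the right is slicing X^* on the left, so the facts about slices of
Y follow from those about X. -/
theorem vecSlice_Y (ξ η : L2 (Pt n)) (ζ ζ' : L2 (Pt n)) : ⟪ζ, vecSlice (Yop n lam) ξ η ζ'⟫_ℂ =
    ⟪tmulL2 ξ ζ, star (Xop n lam) (tmulL2 η ζ')⟫_ℂ := by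
  rw [inner_vecSlice, star_X, mul_apply_eq_comp, mul_apply_eq_comp, flip_tmulL2,
    ← (isWC_flip (Pt n)).inner_map_map (tmulL2 ξ ζ), flip_tmulL2]
  rw [← mul_apply_eq_comp (flip (Pt n)) (flip (Pt n)), flip_mul_flip]
  rfl

theorem antiConj_vecSlice_X (ξ η : L2 (Pt n)) : antiConj (J n lam) (vecSlice (Xop n lam) ξ η) =
    vecSlice (Xop n lam) (Jhat n lam η) (Jhat n lam ξ) := by
  rw [antiConj_vecSlice (isConjugation_J n lam) (isConjugation_Jhat n lam)]
  congr 1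
  exact antiConj_X n lam

theorem inner_star_X_eq_inner_X (a b c d : L2 (Pt n)) :
    ⟪tmulL2 a b, star (Xop n lam) (tmulL2 c d)⟫_ℂ =
      ⟪tmulL2 (J n lam c) (Jhat n lam d), star (Xop n lam) (tmulL2 (J n lam a) (Jhat n lam b))⟫_ℂ := by
  have hC := isConjugation_JDhat n lam
  have h := inner_antiConj hC (star (Xop n lam)) (tmulL2 a b) (tmulL2 c d)
  rw [antiConj_star hC, antiConj_X] at h
  rw [h, JDhat, tensorAnti_tmulL2, tensorAnti_tmulL2]

theorem antiConj_vecSlice_Y (ξ η : L2 (Pt n)) :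
    antiConj (Jhat n lam) (vecSlice (Yop n lam) ξ η) =
      vecSlice (Yop n lam) (J n lam η) (J n lam ξ) := by
  refine op_ext_inner fun ζ ζ' => ?_
  rw [inner_antiConj (isConjugation_Jhat n lam), vecSlice_Y, vecSlice_Y,
    inner_star_X_eq_inner_X, (isConjugation_Jhat n lam).apply_apply,
    (isConjugation_Jhat n lam).apply_apply]

/-- Combine the two symmetries of X: conjugating with J ⊗ Ĵ inserts J and Ĵ, and the adjoint rule
for slices of X removes the Ĵ again. -/
theorem star_vecSlice_Y (ξ η : L2 (Pt n)) : star (vecSlice (Yop n lam) ξ η) =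
    vecSlice (Yop n lam) (J n lam ξ) (J n lam η) := by
  refine op_ext_inner fun ζ ζ' => ?_
  have h1 : ⟪ζ, star (vecSlice (Yop n lam) ξ η) ζ'⟫_ℂ =
      conj ⟪ζ', vecSlice (Yop n lam) ξ η ζ⟫_ℂ := by
    rw [ContinuousLinearMap.star_eq_adjoint, ContinuousLinearMap.adjoint_inner_right,
      inner_conj_symm]
  rw [h1, vecSlice_Y, vecSlice_Y, inner_star_X_eq_inner_X,
    inner_star_X, (isConjugation_Jhat n lam).apply_apply, inner_conj_symm,
    (isConjugation_Jhat n lam).apply_apply, ContinuousLinearMap.star_eq_adjoint,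
    ContinuousLinearMap.adjoint_inner_right]

end legOperators

end

end QDouble

namespace QDouble

noncomputable section

/-! ### The algebra A_D and its antipode -/

section doubleAlgebra

theorem midFlip_tmulL2 {α : Type} [MeasureSpace α] [SigmaFinite (volume : Measure α)]
    (a b c d : L2 α) : midFlip α (tmulL2 (tmulL2 a b) (tmulL2 c d)) =
      tmulL2 (tmulL2 a c) (tmulL2 b d) := by
  have hq := (measurePreserving_mid α).quasiMeasurePreserving
  apply Lp.ext
  filter_upwards [(isWC_midFlip α).coeFn (tmulL2 (tmulL2 a b) (tmulL2 c d)),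
    hq.ae (coeFn_tmulL2 (tmulL2 a b) (tmulL2 c d)), hq.ae (ae_fst_of_ae (coeFn_tmulL2 a b)),
    hq.ae (ae_snd_of_ae (coeFn_tmulL2 c d)), coeFn_tmulL2 (tmulL2 a c) (tmulL2 b d),
    ae_fst_of_ae (β := α × α) (coeFn_tmulL2 a c), ae_snd_of_ae (α := α × α) (coeFn_tmulL2 b d)]
    with p h1 h2 h3 h4 h5 h6 h7
  rw [h1, h2, h3, h4, h5, h6, h7]
  simp only [mid]
  ring

theorem adjoint_ketR_tmulL2 {α β : Type} [MeasureSpace α] [MeasureSpace β]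
    [SigmaFinite (volume : Measure α)] [SigmaFinite (volume : Measure β)] (η : L2 β) (u : L2 α)
    (v : L2 β) : ContinuousLinearMap.adjoint (ketR η) (tmulL2 u v) = ⟪η, v⟫_ℂ • u := by
  refine ext_inner_left ℂ fun ζ => ?_
  rw [ContinuousLinearMap.adjoint_inner_right, ketR_apply, inner_tmulL2, inner_smul_right, mul_comm]

/-- After regrouping, T acts on the first entries of both pairs and the second entries are merely
paired. So ξ contracts the second leg of H and η contracts the second leg of G. -/
theorem inner_mid_mid {α : Type} [MeasureSpace α] [SigmaFinite (volume : Measure α)]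
    (T : Op (α × α)) (ζ ξ ζ' η : L2 α) (G H : L2 (α × α)) :
    ⟪midFlip α (tmulL2 (tmulL2 ζ ξ) G), tensorOp T 1 (midFlip α (tmulL2 H (tmulL2 ζ' η)))⟫_ℂ =
      ⟪tmulL2 ζ (ContinuousLinearMap.adjoint (ketR η) G),
        T (tmulL2 (ContinuousLinearMap.adjoint (ketR ξ) H) ζ')⟫_ℂ := by
  have hz : ∀ f : L2 α, tmulL2 f (0 : L2 α) = 0 := fun f => (tmulBilin f).map_zero
  have hz1 : ∀ f : L2 α, tmulL2 (0 : L2 α) f = 0 := fun f => (tmulBilin.flip f).map_zero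
  have hz' : ∀ f : L2 (α × α), tmulL2 f (0 : L2 (α × α)) = 0 := fun f => (tmulBilin f).map_zero
  have hz2 : ∀ f : L2 (α × α), tmulL2 (0 : L2 (α × α)) f = 0 :=
    fun f => (tmulBilin.flip f).map_zero
  have hl : ∀ f f' g : L2 α, tmulL2 (f + f') g = tmulL2 f g + tmulL2 f' g :=
    fun f f' g => (tmulBilin.flip g).map_add f f'
  have hl' : ∀ f f' g : L2 (α × α), tmulL2 (f + f') g = tmulL2 f g + tmulL2 f' g :=
    fun f f' g => (tmulBilin.flip g).map_add f f'
  have hc : ∀ g : L2 α, Continuous fun f : L2 α => tmulL2 f g :=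
    fun g => (ketR g : L2 α →L[ℂ] L2 (α × α)).continuous
  have hc' : ∀ g : L2 (α × α), Continuous fun f : L2 (α × α) => tmulL2 f g :=
    fun g => (ketR g : L2 (α × α) →L[ℂ] L2 ((α × α) × (α × α))).continuous
  induction G using tmul_induction with
  | hc => exact isClosed_eq (by fun_prop) (by fun_prop)
  | h0 => simp [hz, hz']
  | ha x y hx hy => simp only [tmulL2_add_right, map_add, inner_add_left, hx, hy]
  | ht u v =>
    induction H using tmul_induction with
    | hc =>
      refine isClosed_eq ?_ ?_
      · have := hc' (tmulL2 ζ' η)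
        fun_prop
      · have := (hc ζ').comp (ContinuousLinearMap.adjoint (ketR (α := α) ξ)).continuous
        simp only [Function.comp_def] at this
        fun_prop
    | h0 => simp [hz1, hz2]
    | ha x y hx hy => simp only [hl, hl', map_add, inner_add_right, hx, hy]
    | ht a b =>
      have hs : ∀ (c : ℂ) (f g : L2 α), tmulL2 f (c • g) = c • tmulL2 f g :=
        fun c f g => (tmulBilin f).map_smul c g
      have hs' : ∀ (c : ℂ) (f g : L2 α), tmulL2 (c • f) g = c • tmulL2 f g :=
        fun c f g => (tmulBilin.flip g).map_smul c f
      rw [midFlip_tmulL2, midFlip_tmulL2, tensorOp_tmulL2, one_apply_eq_self, inner_tmulL2,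
        adjoint_ketR_tmulL2, adjoint_ketR_tmulL2, inner_tmulL2, hs, hs', map_smul,
        inner_smul_left, inner_smul_right, inner_conj_symm]
      ring

variable (n : ℕ) (lam : ℝ)

/-- Among the sliced legs only X₁₃ touches leg 3 and only Y₂₄ touches leg 4, so the two slices
separate and the copies of Z₁₂ remain as conjugation around the slice of Y. -/
theorem vecSlice_VD (ξ₁ ξ₂ η₁ η₂ : L2 (Pt n)) :
    vecSlice (VD n lam) (tmulL2 ξ₁ ξ₂) (tmulL2 η₁ η₂) =
      piA n lam (vecSlice (Yop n lam) ξ₂ η₂) * piAhat n (vecSlice (Xop n lam) ξ₁ η₁) := by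
  have key : ∀ T : Op (Pt n × Pt n),
      vecSlice (leg24 (Yop n lam) * (tensorOp T 1 * leg13 (Xop n lam))) (tmulL2 ξ₁ ξ₂)
        (tmulL2 η₁ η₂) = tensorOp 1 (vecSlice (Yop n lam) ξ₂ η₂) *
          (T * tensorOp (vecSlice (Xop n lam) ξ₁ η₁) 1) := by
    intro T
    refine op_ext_tmul fun ζ₁ ζ₂ x => ?_
    induction x using tmul_induction with
    | hc => exact isClosed_eq (by fun_prop) (by fun_prop)
    | h0 => simp
    | ha x y hx hy => rw [map_add, map_add, inner_add_right, inner_add_right, hx, hy]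
    | ht ζ₁' ζ₂' =>
      -- Y₂₄ is moved to the left entry of the inner product. The two sides are then vectors of the
      -- shape required by `inner_mid_mid`, with G coming from Y^* and H from X.
      rw [inner_vecSlice, mul_apply_eq_comp, mul_apply_eq_comp,
        ← ContinuousLinearMap.adjoint_inner_left, ← ContinuousLinearMap.star_eq_adjoint,
        star_leg24, leg24, leg13]
      simp only [mul_apply_eq_comp, midFlip_tmulL2, tensorOp_tmulL2, one_apply_eq_self]
      rw [inner_mid_mid, ← ContinuousLinearMap.adjoint_inner_left (tensorOp 1 _),
        ← ContinuousLinearMap.star_eq_adjoint, star_tensorOp, tensorOp_tmulL2, star_vecSlice,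
        star_one]
      rfl
  rw [VD, mul_assoc, mul_assoc, leg12, vecSlice_tensor_mul, star_tensorOp, star_one, key]
  simp only [piA, piAhat, mul_assoc]

theorem continuous_piA : Continuous (piA n lam) :=
  (continuous_const.mul (ampRight (Pt n) (Pt n)).continuous).mul continuous_const

theorem continuous_piAhat : Continuous (piAhat n) := (ampLeft (Pt n) (Pt n)).continuous

theorem piA_add (a b : Op (Pt n)) : piA n lam (a + b) = piA n lam a + piA n lam b := by
  simp only [piA, ← ampRight_apply, map_add, mul_add, add_mul]

theorem piA_smul (c : ℂ) (a : Op (Pt n)) : piA n lam (c • a) = c • piA n lam a := by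
  simp only [piA, ← ampRight_apply, map_smul, mul_smul_comm, smul_mul_assoc]

theorem piAhat_add (a b : Op (Pt n)) : piAhat n (a + b) = piAhat n a + piAhat n b :=
  (ampLeft (Pt n) (Pt n)).map_add a b

theorem piAhat_smul (c : ℂ) (a : Op (Pt n)) : piAhat n (c • a) = c • piAhat n a :=
  (ampLeft (Pt n) (Pt n)).map_smul c a

theorem piA_zero : piA n lam 0 = 0 := by simpa using piA_smul n lam 0 0

theorem piAhat_zero : piAhat n 0 = 0 := by simpa using piAhat_smul n 0 0

theorem piA_mul_piAhat_mem {a b : Op (Pt n)} (ha : a ∈ sliceSpan (Yop n lam))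
    (hb : b ∈ sliceSpan (Xop n lam)) :
    piA n lam a * piAhat n b ∈ sliceSpan (VD n lam) := by
  have hcl := isClosed_sliceSpan (VD n lam)
  refine sliceSpan_induction (P := fun a => piA n lam a * piAhat n b ∈ sliceSpan (VD n lam))
    (hcl.preimage ((continuous_piA n lam).mul continuous_const)) ?_ (fun x y hx hy => ?_)
    (fun c x hx => ?_) (fun ξ η => ?_) ha
  · rw [piA_zero, zero_mul]; exact Submodule.zero_mem _
  · rw [piA_add, add_mul]; exact Submodule.add_mem _ hx hy
  · rw [piA_smul, smul_mul_assoc]; exact Submodule.smul_mem _ _ hx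
  refine sliceSpan_induction (P := fun b => piA n lam _ * piAhat n b ∈ sliceSpan (VD n lam))
    (hcl.preimage (continuous_const.mul (continuous_piAhat n))) ?_ (fun x y hx hy => ?_)
    (fun c x hx => ?_) (fun ξ' η' => ?_) hb
  · rw [piAhat_zero, mul_zero]; exact Submodule.zero_mem _
  · rw [piAhat_add, mul_add]; exact Submodule.add_mem _ hx hy
  · rw [piAhat_smul, mul_smul_comm]; exact Submodule.smul_mem _ _ hx
  rw [← vecSlice_VD]
  exact vecSlice_mem _ _ _

theorem sliceSpan_VD_le {W : Submodule ℂ (Op (Pt n × Pt n))}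
    (hW : IsClosed (W : Set (Op (Pt n × Pt n))))
    (h : ∀ ξ ξ' η η', piA n lam (vecSlice (Yop n lam) ξ η) *
      piAhat n (vecSlice (Xop n lam) ξ' η') ∈ W) : sliceSpan (VD n lam) ≤ W :=
  sliceSpan_le_of_tmul hW fun ξ ξ' η η' => by rw [vecSlice_VD]; exact h _ _ _ _

theorem SD_eq_antiConj (x : Op (Pt n × Pt n)) : SD n lam x = antiConj (JDhat n lam) x := rfl

theorem SD_mem {x : Op (Pt n × Pt n)} (hx : x ∈ sliceSpan (VD n lam)) :
    SD n lam x ∈ sliceSpan (VD n lam) :=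
  antiConj_mem_sliceSpan (isConjugation_JDhat n lam) (isConjugation_KD n lam)
    (antiConj_VD n lam) hx

/-- Antimultiplicativity reverses Z(1 ⊗ a)Z^*, and the exchange of Z with Z^* reverses it back. -/
theorem SD_piA (a : Op (Pt n)) : SD n lam (piA n lam a) = piA n lam (S n lam a) := by
  have hC := isConjugation_JDhat n lam
  have h1 : antiConj (J n lam) 1 = 1 := by
    ext1 ξ; simp [antiConj_apply, (isConjugation_J n lam).apply_apply]
  rw [SD_eq_antiConj, piA, antiConj_mul hC, antiConj_mul hC, antiConj_Z, antiConj_star_Z, piA,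
    ← mul_assoc, JDhat, antiConj_tensorOp, h1]
  rfl

theorem SD_piAhat (b : Op (Pt n)) : SD n lam (piAhat n b) = piAhat n (Shat n lam b) := by
  have h1 : antiConj (Jhat n lam) 1 = 1 := by
    ext1 ξ; simp [antiConj_apply, (isConjugation_Jhat n lam).apply_apply]
  rw [SD_eq_antiConj, piAhat, JDhat, antiConj_tensorOp, h1]
  rfl

theorem SD_mul (x y : Op (Pt n × Pt n)) : SD n lam (x * y) = SD n lam y * SD n lam x :=
  antiConj_mul (isConjugation_JDhat n lam) x y

theorem SD_SD (x : Op (Pt n × Pt n)) : SD n lam (SD n lam x) = x :=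
  antiConj_antiConj (isConjugation_JDhat n lam) x

theorem SD_star (x : Op (Pt n × Pt n)) : SD n lam (star x) = star (SD n lam x) :=
  antiConj_star (isConjugation_JDhat n lam) x

theorem S_mem {a : Op (Pt n)} (ha : a ∈ sliceSpan (Yop n lam)) :
    S n lam a ∈ sliceSpan (Yop n lam) := by
  have hJ := isConjugation_Jhat n lam
  refine sliceSpan_induction (V := Yop n lam) (P := fun a => antiConj (Jhat n lam) a ∈ sliceSpan (Yop n lam))
    ((isClosed_sliceSpan _).preimage (antiConjL hJ).continuous) ?_ (fun x y hx hy => ?_)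
    (fun c x hx => ?_) (fun ξ η => ?_) ha
  · rw [← antiConjL_apply hJ, map_zero]; exact Submodule.zero_mem _
  · rw [antiConj_add]; exact Submodule.add_mem _ hx hy
  · rw [antiConj_smul]; exact Submodule.smul_mem _ _ hx
  · rw [antiConj_vecSlice_Y]; exact vecSlice_mem _ _ _

theorem Shat_mem {b : Op (Pt n)} (hb : b ∈ sliceSpan (Xop n lam)) :
    Shat n lam b ∈ sliceSpan (Xop n lam) := by
  have hJ := isConjugation_J n lam
  refine sliceSpan_induction (V := Xop n lam) (P := fun a => antiConj (J n lam) a ∈ sliceSpan (Xop n lam))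
    ((isClosed_sliceSpan _).preimage (antiConjL hJ).continuous) ?_ (fun x y hx hy => ?_)
    (fun c x hx => ?_) (fun ξ η => ?_) hb
  · rw [← antiConjL_apply hJ, map_zero]; exact Submodule.zero_mem _
  · rw [antiConj_add]; exact Submodule.add_mem _ hx hy
  · rw [antiConj_smul]; exact Submodule.smul_mem _ _ hx
  · rw [antiConj_vecSlice_X]; exact vecSlice_mem _ _ _

/-- The slices of V_D provide products in the order π(a)π'(b) only. Applying S_D to π(S(a))π'(Ŝ(b))
yields the opposite order, because S and Ŝ are involutive and preserve the slice spans. -/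
theorem piAhat_mul_piA_mem {a b : Op (Pt n)} (ha : a ∈ sliceSpan (Yop n lam))
    (hb : b ∈ sliceSpan (Xop n lam)) :
    piAhat n b * piA n lam a ∈ sliceSpan (VD n lam) := by
  have h := SD_mem n lam (piA_mul_piAhat_mem n lam (S_mem n lam ha) (Shat_mem n lam hb))
  rw [SD_mul, SD_piA, SD_piAhat] at h
  have h1 : S n lam (S n lam a) = a := antiConj_antiConj (isConjugation_Jhat n lam) a
  have h2 : Shat n lam (Shat n lam b) = b := antiConj_antiConj (isConjugation_J n lam) b
  rwa [h1, h2] at h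

/-- On a generator π(a)π'(b) the adjoint is π'(b^*)π(a^*), where a^* and b^* are slices again; the
order is then handled by `piAhat_mul_piA_mem`. -/
theorem star_mem_sliceSpan_VD {x : Op (Pt n × Pt n)} (hx : x ∈ sliceSpan (VD n lam)) :
    star x ∈ sliceSpan (VD n lam) := by
  let W : Submodule ℂ (Op (Pt n × Pt n)) :=
    ⟨⟨⟨{x | star x ∈ sliceSpan (VD n lam)}, fun {x y} hx hy => by
        simp only [Set.mem_ofPred_eq, star_add] at hx hy ⊢
        exact Submodule.add_mem _ hx hy⟩, by simp⟩, fun c x hx => by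
        simp only [Set.mem_ofPred_eq, star_smul] at hx ⊢
        exact Submodule.smul_mem _ _ hx⟩
  have hW : IsClosed (W : Set (Op (Pt n × Pt n))) :=
    (isClosed_sliceSpan (VD n lam)).preimage continuous_star
  refine sliceSpan_VD_le n lam hW (fun ξ ξ' η η' => ?_) hx
  change star _ ∈ sliceSpan (VD n lam)
  have h1 : star (piA n lam (vecSlice (Yop n lam) ξ η)) =
      piA n lam (star (vecSlice (Yop n lam) ξ η)) := by
    simp only [piA, star_mul, star_star, star_tensorOp, star_one, mul_assoc]
  rw [star_mul, h1, piAhat, star_tensorOp, star_one, star_vecSlice_X, star_vecSlice_Y]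
  exact piAhat_mul_piA_mem n lam (vecSlice_mem _ _ _) (vecSlice_mem _ _ _)

/-- The C*-algebra `A_D`. -/
def ADsub : NonUnitalStarSubalgebra ℂ (Op (Pt n × Pt n)) where
  carrier := sliceSpan (VD n lam)
  add_mem' := (sliceSpan (VD n lam)).add_mem
  zero_mem' := (sliceSpan (VD n lam)).zero_mem
  mul_mem' := (isMultiplicativeUnitary_VD n lam).mul_mem
  smul_mem' := fun c _ hx => (sliceSpan (VD n lam)).smul_mem c hx
  star_mem' := star_mem_sliceSpan_VD n lam

theorem coe_ADsub : (ADsub n lam : Set (Op (Pt n × Pt n))) = AD n lam :=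
  (closure_rightSlices (VD n lam)).symm

/-- The antipode `S_D` as a *-isomorphism of `A_D` onto its opposite algebra. -/
def antipodeD : ADsub n lam ≃⋆ₐ[ℂ] (ADsub n lam)ᵐᵒᵖ where
  toFun x := MulOpposite.op ⟨SD n lam x, SD_mem n lam x.2⟩
  invFun x := ⟨SD n lam x.unop, SD_mem n lam x.unop.2⟩
  left_inv _ := Subtype.ext (SD_SD n lam _)
  right_inv _ := MulOpposite.unop_injective (Subtype.ext (SD_SD n lam _))
  map_mul' _ _ := MulOpposite.unop_injective (Subtype.ext (SD_mul n lam _ _))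
  map_add' _ _ := MulOpposite.unop_injective (Subtype.ext (antiConj_add _ _ _))
  map_star' _ := MulOpposite.unop_injective (Subtype.ext (SD_star n lam _))
  map_smul' _ _ := MulOpposite.unop_injective (Subtype.ext (antiConj_smul _ _ _))

end doubleAlgebra

end

end QDouble

namespace QDouble

noncomputable section

/-! ### Cauchy–Schwarz and operator norm estimates -/

section integration

variable {α β : Type} [MeasureSpace α] [MeasureSpace β]

theorem integral_norm_mul_norm_le (f g : L2 α) :
    Integrable (fun p => ‖f p‖ * ‖g p‖) ∧ ∫ p, ‖f p‖ * ‖g p‖ ≤ ‖f‖ * ‖g‖ := by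
  have hm : ∀ f : L2 α, MemLp (fun p => ((‖f p‖ : ℝ) : ℂ)) 2 := fun f =>
    (Lp.memLp f).norm.ofReal
  have hn : ∀ f : L2 α, ‖(hm f).toLp _‖ = ‖f‖ := fun f => by
    rw [Lp.norm_toLp, Lp.norm_def]
    congr 1
    refine eLpNorm_congr_norm_ae (Eventually.of_forall fun p => ?_)
    simp
  have h0 : (fun p => ⟪(hm f).toLp _ p, (hm g).toLp _ p⟫_ℂ) =ᵐ[volume]
      fun p => ((‖f p‖ * ‖g p‖ : ℝ) : ℂ) := by
    filter_upwards [(hm f).coeFn_toLp, (hm g).coeFn_toLp] with p h1 h2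
    rw [h1, h2]
    simp [mul_comm]
  have hi := (L2.integrable_inner (𝕜 := ℂ) ((hm f).toLp _) ((hm g).toLp _)).congr h0
  refine ⟨by simpa using hi.re, ?_⟩
  have h1 := norm_inner_le_norm (𝕜 := ℂ) ((hm f).toLp _) ((hm g).toLp _)
  rw [L2.inner_def, integral_congr_ae h0, integral_complex_ofReal, hn, hn] at h1
  refine le_trans (le_abs_self _) ?_
  simpa using h1

theorem opNorm_le_of_inner {D : Op α} {K : ℝ} (hK : 0 ≤ K)
    (h : ∀ ζ ζ', ‖⟪ζ, D ζ'⟫_ℂ‖ ≤ K * ‖ζ‖ * ‖ζ'‖) : ‖D‖ ≤ K := by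
  refine ContinuousLinearMap.opNorm_le_bound _ hK fun ζ => ?_
  have h1 := h (D ζ) ζ
  rw [inner_self_eq_norm_sq_to_K] at h1
  simp only [Complex.coe_algebraMap, norm_pow, Complex.norm_real, norm_norm] at h1
  rcases (norm_nonneg (D ζ)).eq_or_lt with h0 | h0
  · rw [← h0]; positivity
  · exact le_of_mul_le_mul_left (by nlinarith) h0

end integration

/-! ### Lipschitz estimates for Schwartz kernels -/

section lamRep

open scoped SchwartzMap

variable {n : ℕ} {lam : ℝ}

theorem isAddHaarMeasure_pt : (volume : Measure (Pt n)).IsAddHaarMeasure := by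
  have h1 : (volume : Measure (Vec n × ℝ)).IsAddHaarMeasure :=
    Measure.prod.instIsAddHaarMeasure _ _
  exact Measure.prod.instIsAddHaarMeasure _ _

theorem memLp_schwartz (φ : 𝓢(Pt n, ℂ)) : MemLp φ 2 (volume : Measure (Pt n)) := by
  have := isAddHaarMeasure_pt (n := n)
  exact φ.memLp 2

theorem norm_ebar_sub_one_le (t : ℝ) : ‖ebar t - 1‖ ≤ 2 * Real.pi * |t| := by
  have h := Real.norm_exp_I_mul_ofReal_sub_one_le (x := -(2 * Real.pi * t))
  rw [norm_neg, Real.norm_eq_abs, abs_mul, abs_of_pos Real.two_pi_pos] at h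
  refine le_of_eq_of_le ?_ h
  congr 2
  rw [ebar, e]
  congr 1
  push_cast
  ring

theorem norm_beta_le (x y : Vec n) : |beta x y| ≤ ‖x‖ * ‖y‖ := abs_real_inner_le_norm x y

/-- `φ(e^{λs}a, e^{λs}b, -s)` -/
def psi (lam : ℝ) (φ : 𝓢(Pt n, ℂ)) (a b : Vec n) (s : ℝ) : ℂ := φ (ex lam s • a, ex lam s • b, -s)

theorem schwartz_lipschitz (φ : 𝓢(Pt n, ℂ)) :
    ∃ C, 0 ≤ C ∧ ∀ p q, ‖φ p - φ q‖ ≤ C * ‖p - q‖ := by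
  obtain ⟨C, hC⟩ := φ.decay 0 1
  refine ⟨C, ?_, fun p q => ?_⟩
  · exact le_trans (by positivity) (hC.2 0)
  · refine Convex.norm_image_sub_le_of_norm_fderiv_le (𝕜 := ℝ) (s := Set.univ)
      (fun x _ => φ.differentiableAt) (fun x _ => ?_) convex_univ trivial trivial
    have := hC.2 x
    rwa [pow_zero, one_mul, norm_iteratedFDeriv_one] at this

/-- The estimate must be uniform in a and b although the phase η_λ(s)β(a, v) grows with a. The decay
of φ absorbs this growth, and restricting to |s| ≤ R bounds η_λ and the exponentials. -/
theorem psi_twisted_lipschitz (lam : ℝ) (φ : 𝓢(Pt n, ℂ)) (R : ℝ) :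
    ∃ C, 0 ≤ C ∧ ∀ (a b u v : Vec n) (s ε : ℝ), |s| ≤ R → ‖u‖ ≤ ε → ‖v‖ ≤ ε →
      ‖psi lam φ (u + a) (v + b) s * ebar (eta lam s * beta a v) - psi lam φ a b s‖ ≤ C * ε := by
  obtain ⟨C₁, hC₁, h1⟩ := schwartz_lipschitz φ
  obtain ⟨C₂, -, h2⟩ := φ.decay 1 0
  obtain ⟨N, hN⟩ := (isCompact_Icc (a := -R) (b := R)).exists_bound_of_continuousOn
    (continuous_eta lam).continuousOn
  obtain ⟨M, hM⟩ := (isCompact_Icc (a := -R) (b := R)).exists_bound_of_continuousOn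
    (continuous_ex (lam := lam)).continuousOn
  have hM0 : 0 ≤ |M| := abs_nonneg M
  have hC₂ : 0 ≤ C₂ := le_trans (by positivity) (h2 0)
  refine ⟨C₁ * |M| + 2 * Real.pi * |N| * (C₂ * |M|), by positivity, ?_⟩
  intro a b u v s ε hs hu hv
  have hε : 0 ≤ ε := (norm_nonneg u).trans hu
  have hsI : s ∈ Set.Icc (-R) R := abs_le.1 hs
  have hnI : -s ∈ Set.Icc (-R) R := by constructor <;> linarith [hsI.1, hsI.2]
  have hE : ex lam s ≤ |M| := by
    have := hM s hsI
    rw [Real.norm_of_nonneg (ex_pos s).le] at this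
    exact this.trans (le_abs_self M)
  have hE' : (ex lam s)⁻¹ ≤ |M| := by
    have := hM (-s) hnI
    rw [Real.norm_of_nonneg (ex_pos _).le, ex_neg] at this
    exact this.trans (le_abs_self M)
  have hη : |eta lam s| ≤ |N| := (hN s hsI).trans (le_abs_self N)
  have e1 : ‖psi lam φ (u + a) (v + b) s - psi lam φ a b s‖ ≤ C₁ * (|M| * ε) := by
    refine (h1 _ _).trans (mul_le_mul_of_nonneg_left ?_ hC₁)
    have : ((ex lam s • (u + a), ex lam s • (v + b), -s) : Pt n) -
        (ex lam s • a, ex lam s • b, -s) = (ex lam s • u, ex lam s • v, 0) := by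
      simp
    rw [this, Prod.norm_def, Prod.norm_def]
    simp only [norm_smul, norm_zero, Real.norm_of_nonneg (ex_pos s).le]
    have := (ex_pos (lam := lam) s).le
    refine max_le ?_ (max_le ?_ (by positivity)) <;> gcongr
  -- One power of decay of φ pays for the factor ‖a‖ in the phase estimate; M also bounds e^{-λs},
  -- because the interval is symmetric.
  have e2 : ‖psi lam φ a b s‖ * ‖a‖ ≤ C₂ * |M| := by
    have h3 := h2 (ex lam s • a, ex lam s • b, -s)
    rw [pow_one, norm_iteratedFDeriv_zero] at h3
    have h4 : ex lam s * ‖a‖ ≤ ‖((ex lam s • a, ex lam s • b, -s) : Pt n)‖ := by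
      rw [Prod.norm_def]
      refine le_max_of_le_left ?_
      rw [norm_smul, Real.norm_of_nonneg (ex_pos s).le]
    have h5 : ‖a‖ ≤ (ex lam s)⁻¹ * ‖((ex lam s • a, ex lam s • b, -s) : Pt n)‖ := by
      rw [inv_mul_eq_div, le_div_iff₀ (ex_pos s)]; linarith
    calc ‖psi lam φ a b s‖ * ‖a‖
        ≤ ‖psi lam φ a b s‖ * ((ex lam s)⁻¹ * ‖((ex lam s • a, ex lam s • b, -s) : Pt n)‖) := by
          gcongr
      _ = (‖((ex lam s • a, ex lam s • b, -s) : Pt n)‖ * ‖psi lam φ a b s‖) * (ex lam s)⁻¹ := by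
          ring
      _ ≤ C₂ * |M| := mul_le_mul h3 hE' (inv_nonneg.2 (ex_pos s).le) hC₂
  have e3 : ‖ebar (eta lam s * beta a v) - 1‖ ≤ 2 * Real.pi * (|N| * (‖a‖ * ε)) := by
    refine (norm_ebar_sub_one_le _).trans ?_
    rw [abs_mul]
    have := (norm_beta_le a v).trans (mul_le_mul_of_nonneg_left hv (norm_nonneg a))
    have := Real.pi_pos
    gcongr
  calc _ = ‖(psi lam φ (u + a) (v + b) s - psi lam φ a b s) * ebar (eta lam s * beta a v) +
        psi lam φ a b s * (ebar (eta lam s * beta a v) - 1)‖ := by ring_nf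
    _ ≤ C₁ * (|M| * ε) + ‖psi lam φ a b s‖ * (2 * Real.pi * (|N| * (‖a‖ * ε))) := by
        refine (norm_add_le _ _).trans (add_le_add ?_ ?_)
        · rw [norm_mul, norm_ebar, mul_one]; exact e1
        · rw [norm_mul]; gcongr
    _ = C₁ * (|M| * ε) + 2 * Real.pi * |N| * ε * (‖psi lam φ a b s‖ * ‖a‖) := by ring
    _ ≤ C₁ * (|M| * ε) + 2 * Real.pi * |N| * ε * (C₂ * |M|) := by
        have := Real.pi_pos
        gcongr
    _ = _ := by ring

end lamRep

end

end QDouble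

namespace QDouble

noncomputable section

/-! ### Approximation of λ_φ by slices of X -/

section lamRepMem

open scoped SchwartzMap

variable {n : ℕ} {lam : ℝ}

theorem norm_tmulL2 {α β : Type} [MeasureSpace α] [MeasureSpace β]
    [SigmaFinite (volume : Measure α)] [SigmaFinite (volume : Measure β)] (f : L2 α) (g : L2 β) :
    ‖tmulL2 f g‖ = ‖f‖ * ‖g‖ := by
  rw [← tensorEmb_tmul, LinearIsometry.norm_map, TensorProduct.norm_tmul]

/-- `{(u, v, s) : |u| < ε, |v| < ε, |s| ≤ R}` -/
def box (n : ℕ) (ε R : ℝ) : Set (Pt n) :=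
  Metric.ball 0 ε ×ˢ (Metric.ball 0 ε ×ˢ Set.Icc (-R) R)

theorem measurableSet_box (ε R : ℝ) : MeasurableSet (box n ε R) :=
  measurableSet_ball.prod (measurableSet_ball.prod measurableSet_Icc)

theorem volume_box (ε R : ℝ) : volume (box n ε R) = volume (Metric.ball (0 : Vec n) ε) *
    (volume (Metric.ball (0 : Vec n) ε) * ENNReal.ofReal (2 * R)) := by
  rw [box, Measure.volume_eq_prod, Measure.prod_prod, Measure.volume_eq_prod, Measure.prod_prod,
    Real.volume_Icc]
  ring_nf

theorem volume_box_ne_top (ε R : ℝ) : volume (box n ε R) ≠ ∞ := by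
  rw [volume_box]
  exact (ENNReal.mul_lt_top measure_ball_lt_top
    (ENNReal.mul_lt_top measure_ball_lt_top ENNReal.ofReal_lt_top)).ne

variable (n) in
/-- The inverse of the volume of the `ε`-ball. -/
def ballInv (ε : ℝ) : ℝ := (volume.real (Metric.ball (0 : Vec n) ε))⁻¹

theorem volume_ball_pos {ε : ℝ} (hε : 0 < ε) : 0 < volume.real (Metric.ball (0 : Vec n) ε) :=
  ENNReal.toReal_pos (Metric.measure_ball_pos _ _ hε).ne' measure_ball_lt_top.ne

/-- The normalised indicator of the box. -/
def boxFun (n : ℕ) (ε R : ℝ) : Pt n → ℂ := (box n ε R).indicator fun _ => (ballInv n ε : ℂ)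

/-- The normalised indicator of the box as a vector. -/
def boxVec (n : ℕ) (ε R : ℝ) : L2 (Pt n) :=
  indicatorConstLp 2 (measurableSet_box ε R) (volume_box_ne_top ε R) (ballInv n ε : ℂ)

theorem coeFn_boxVec (ε R : ℝ) : boxVec n ε R =ᵐ[volume] boxFun n ε R := indicatorConstLp_coeFn

/-- The normalisation is the inverse ball volume, squared in the norm against the two balls in u and
v. The result does not depend on ε, which keeps the error estimate uniform. -/
theorem norm_boxVec_sq {ε R : ℝ} (hε : 0 < ε) (hR : 0 ≤ R) : ‖boxVec n ε R‖ ^ 2 = 2 * R := by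
  have hm := volume_ball_pos (n := n) hε
  rw [boxVec, norm_indicatorConstLp (by norm_num) (by norm_num), mul_pow, Measure.real, volume_box]
  simp only [ENNReal.toReal_mul, ENNReal.toReal_ofReal (by positivity : 0 ≤ 2 * R),
    ENNReal.toReal_ofNat, Complex.norm_real, ballInv, norm_inv]
  rw [← Real.sqrt_eq_rpow, Real.sq_sqrt (by positivity), Real.norm_of_nonneg hm.le]
  change (volume.real _)⁻¹ ^ 2 * (volume.real _ * (volume.real _ * (2 * R))) = 2 * R
  field_simp

theorem boxFun_eq (ε R : ℝ) (q : Pt n) : boxFun n ε R q ^ 2 =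
    (Metric.ball (0 : Vec n) ε).indicator (fun _ => (ballInv n ε : ℂ)) q.1 *
      ((Metric.ball (0 : Vec n) ε).indicator (fun _ => (ballInv n ε : ℂ)) q.2.1 *
        (Set.Icc (-R) R).indicator 1 q.2.2) := by
  by_cases h1 : q.1 ∈ Metric.ball (0 : Vec n) ε <;>
  by_cases h2 : q.2.1 ∈ Metric.ball (0 : Vec n) ε <;>
  by_cases h3 : q.2.2 ∈ Set.Icc (-R) R <;>
  simp [boxFun, box, Set.indicator, h1, h2, h3, Set.mem_prod, -Set.mem_Icc, sq]

/-- The square of the box function has mass one in u and in v and equals their product density on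
|s| ≤ R, so the auxiliary u and v integrate out. -/
theorem integral_boxFun_sq_mul {ε R : ℝ} (hε : 0 < ε) (g : ℝ → ℂ) (hg : ∀ s, R < |s| → g s = 0) :
    ∫ q : Pt n, boxFun n ε R q ^ 2 * g q.2.2 = ∫ s, g s := by
  have hm := volume_ball_pos (n := n) hε
  have hb : ∫ u : Vec n, (Metric.ball (0 : Vec n) ε).indicator (fun _ => (ballInv n ε : ℂ)) u = 1 := by
    rw [integral_indicator_const _ measurableSet_ball, ballInv, Complex.real_smul]
    push_cast
    exact mul_inv_cancel₀ (by exact_mod_cast hm.ne')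
  have h1 : ∀ q : Pt n, boxFun n ε R q ^ 2 * g q.2.2 =
      (Metric.ball (0 : Vec n) ε).indicator (fun _ => (ballInv n ε : ℂ)) q.1 *
      (fun w : Vec n × ℝ => (Metric.ball (0 : Vec n) ε).indicator (fun _ => (ballInv n ε : ℂ)) w.1 *
        g w.2) q.2 := by
    intro q
    rw [boxFun_eq]
    by_cases h3 : q.2.2 ∈ Set.Icc (-R) R
    · rw [Set.indicator_of_mem h3]; simp [mul_assoc]
    · have : g q.2.2 = 0 := hg _ (by
        by_contra hc
        exact h3 (abs_le.1 (not_lt.1 hc)))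
      simp [this]
  have h2 := integral_prod_mul (μ := (volume : Measure (Vec n))) (ν := (volume : Measure (Vec n × ℝ)))
    ((Metric.ball (0 : Vec n) ε).indicator fun _ => (ballInv n ε : ℂ))
    (fun w => (Metric.ball (0 : Vec n) ε).indicator (fun _ => (ballInv n ε : ℂ)) w.1 * g w.2)
  have h3 := integral_prod_mul (μ := (volume : Measure (Vec n))) (ν := (volume : Measure ℝ))
    ((Metric.ball (0 : Vec n) ε).indicator fun _ => (ballInv n ε : ℂ)) g
  rw [hb, one_mul] at h2 h3
  exact (integral_congr_ae (Eventually.of_forall h1)).trans (h2.trans h3)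

/-- The unitary `ξ ↦ ξ ∘ shear` for the shear that straightens `X`. -/
theorem exists_shear_X (n : ℕ) (lam : ℝ) : ∃ S : Op (Pt n × Pt n),
    IsWC S (fun _ => 1) (fun z => (z.1, (z.2.1 + ex lam z.1.2.2 • z.1.1,
      z.2.2.1 + ex lam z.1.2.2 • z.1.2.1, z.2.2.2))) ∧
    IsWC (S.comp (Xop n lam)) (fun z => ebar (eta lam z.2.2.2 *
      beta (ex lam z.1.2.2 • z.1.1) z.2.2.1))
      (fun z => ((z.1.1, z.1.2.1, z.1.2.2 + z.2.2.2), z.2)) := by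
  have h1 := measurePreserving_shear n
    (v := fun p => (ex lam p.2.2 • p.1, ex lam p.2.2 • p.2.1, 0))
    (Continuous.measurable (by fun_prop))
  have h2 : IsWC (compMP _ h1) (fun _ => 1) (fun z => (z.1, (z.2.1 + ex lam z.1.2.2 • z.1.1,
      z.2.2.1 + ex lam z.1.2.2 • z.1.2.1, z.2.2.2))) :=
    (isWC_compMP _ h1).congr (fun _ => rfl)
      (fun z => Prod.ext rfl (Prod.ext rfl (Prod.ext rfl (add_zero _))))
  refine ⟨_, h2, (h2.comp (isWC_X n lam)).congr (fun z => ?_) (fun z => by simp)⟩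
  rw [one_mul, wph_one]
  congr 1
  simp only [beta_smul_left, beta_sub_right, beta_add_right, beta_smul_right]
  ring

/-- Inflates the matrix coefficient of λ_φ by two dummy vector variables, so that it is an integral
over the same space as the coefficient of a slice of X. The radial integration variable is shifted
by r. -/
theorem inner_lamRep (φ : 𝓢(Pt n, ℂ)) {R : ℝ} (hφ : ∀ x y r, R < |r| → φ (x, y, r) = 0)
    {ε : ℝ} (hε : 0 < ε) (ζ ζ' : L2 (Pt n))
    (hi : Integrable fun z : Pt n × Pt n => boxFun n ε R z.2 ^ 2 *
      (psi lam φ (ex lam z.1.2.2 • z.1.1) (ex lam z.1.2.2 • z.1.2.1) z.2.2.2 *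
        ζ' (z.1.1, z.1.2.1, z.1.2.2 + z.2.2.2)) * conj (ζ z.1)) :
    ⟪ζ, lamRep lam φ ζ'⟫_ℂ = ∫ z : Pt n × Pt n, boxFun n ε R z.2 ^ 2 *
      (psi lam φ (ex lam z.1.2.2 • z.1.1) (ex lam z.1.2.2 • z.1.2.1) z.2.2.2 *
        ζ' (z.1.1, z.1.2.1, z.1.2.2 + z.2.2.2)) * conj (ζ z.1) := by
  rw [L2.inner_def]
  refine Eq.trans (integral_congr_ae ?_) (integral_prod _ hi).symm
  filter_upwards [coeFn_kernelOp (isSchur_Lam lam φ).choose_spec.choose_spec ζ'] with p hp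
  rw [RCLike.inner_apply, lamRep, hp, integral_mul_const,
    integral_boxFun_sq_mul hε (fun s => psi lam φ (ex lam p.2.2 • p.1) (ex lam p.2.2 • p.2.1) s *
      ζ' (p.1, p.2.1, p.2.2 + s)), ← integral_add_left_eq_self _ p.2.2]
  · congr 2
    funext s
    rw [kLam, tLam, psi, smul_smul, smul_smul, ← ex_add, add_comm s]
    congr 3
    · simp [ex]
  · intro s hs
    rw [psi, hφ _ _ _ (by rwa [abs_neg]), zero_mul]

/-- After straightening X by a shear, the slice has the kernel of λ_φ with its arguments displaced
by (u, v) and an extra phase that is trivial at v = 0. On the box the displacement is at most ε, so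
the twisted Lipschitz bound applies. -/
theorem norm_lamRep_sub_vecSlice_le (φ : 𝓢(Pt n, ℂ)) {R : ℝ} (hR : 0 ≤ R)
    (hφ : ∀ x y r, R < |r| → φ (x, y, r) = 0) : ∃ C, 0 ≤ C ∧ ∀ ε, 0 < ε → ∃ ξ η : L2 (Pt n),
      ‖vecSlice (Xop n lam) ξ η - lamRep lam φ‖ ≤ C * ε := by
  obtain ⟨C, hC, hψ⟩ := psi_twisted_lipschitz lam φ R
  obtain ⟨B, hB⟩ := φ.decay 0 0
  refine ⟨C * (2 * R), by positivity, fun ε hε => ?_⟩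
  have hφ2 := memLp_schwartz φ
  obtain ⟨M, hM⟩ := (isCompact_Icc (a := -R) (b := R)).exists_bound_of_continuousOn
    (f := fun s => (ex lam s)⁻¹ ^ n) (Continuous.continuousOn
      ((Continuous.inv₀ continuous_ex (fun p => ex_ne_zero _)).pow n))
  have hinv : Measurable fun q : Pt n => (ex lam q.2.2)⁻¹ ^ n :=
    Continuous.measurable ((Continuous.inv₀ (by fun_prop) (fun p => ex_ne_zero _)).pow n)
  have hbm : Measurable (boxFun n ε R) := measurable_const.indicator (measurableSet_box ε R)
  have hΘ : MemLp (fun q : Pt n => (((ex lam q.2.2)⁻¹ ^ n : ℝ) : ℂ) * boxFun n ε R q ^ 2) 2 := by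
    refine MemLp.of_le_mul (c := M * ‖ballInv n ε‖) (Lp.memLp (boxVec n ε R)) ?_ ?_
    · exact ((Complex.measurable_ofReal.comp hinv).mul (hbm.pow_const 2)).aestronglyMeasurable
    · filter_upwards [coeFn_boxVec (n := n) ε R] with q hq
      rw [hq, norm_mul, norm_pow]
      by_cases hqb : q ∈ box n ε R
      · have h1 := hM q.2.2 hqb.2.2
        rw [boxFun, Set.indicator_of_mem hqb, Complex.norm_real, Complex.norm_real, sq, ← mul_assoc]
        gcongr
      · simp [boxFun, hqb]
  -- Ĵφ conjugates back to the values of φ at (e^{λs}u, e^{λs}v, -s) times e^{nλs}; the factor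
  -- e^{-nλs} in the second vector removes that weight.
  refine ⟨Jhat n lam (hφ2.toLp _), hΘ.toLp _, opNorm_le_of_inner (by positivity) fun ζ ζ' => ?_⟩
  obtain ⟨S, hS, hSX⟩ := exists_shear_X n lam
  have h1 : ⟪ζ, vecSlice (Xop n lam) (Jhat n lam (hφ2.toLp _)) (hΘ.toLp _) ζ'⟫_ℂ =
      ⟪S (tmulL2 ζ (Jhat n lam (hφ2.toLp _))), (S.comp (Xop n lam)) (tmulL2 ζ' (hΘ.toLp _))⟫_ℂ := by
    rw [inner_vecSlice, ContinuousLinearMap.comp_apply, hS.inner_map_map]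
  set P : L2 (Pt n × Pt n) := (S.comp (Xop n lam)) (tmulL2 ζ' (boxVec n ε R)) with hP
  set Q : L2 (Pt n × Pt n) := tmulL2 ζ (boxVec n ε R) with hQ
  have hPae : P =ᵐ[volume] fun z => ebar (eta lam z.2.2.2 *
      beta (ex lam z.1.2.2 • z.1.1) z.2.2.1) * (ζ' (z.1.1, z.1.2.1, z.1.2.2 + z.2.2.2) *
        boxFun n ε R z.2) := by
    filter_upwards [hSX.coeFn (tmulL2 ζ' (boxVec n ε R)),
      hSX.choose.qmp.ae (coeFn_tmulL2 ζ' (boxVec n ε R)),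
      ae_snd_of_ae (α := Pt n) (coeFn_boxVec (n := n) ε R)] with z h1 h2 h3
    rw [hP, h1, h2, h3]
  have hQae : Q =ᵐ[volume] fun z => ζ z.1 * boxFun n ε R z.2 := by
    filter_upwards [coeFn_tmulL2 ζ (boxVec n ε R),
      ae_snd_of_ae (α := Pt n) (coeFn_boxVec (n := n) ε R)] with z h2 h3
    rw [hQ, h2, h3]
  have hbconj : ∀ q, conj (boxFun n ε R q) = boxFun n ε R q := fun q => by
    by_cases hqb : q ∈ box n ε R
    · rw [boxFun, Set.indicator_of_mem hqb, Complex.conj_ofReal]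
    · simp [boxFun, hqb]
  have hebar : ∀ t, conj (ebar t) * ebar t = 1 := fun t => by
    rw [conj_ebar, ← ebar_add, neg_add_cancel, ebar, neg_zero, e_zero]
  have hi : Integrable fun z : Pt n × Pt n => boxFun n ε R z.2 ^ 2 *
      (psi lam φ (ex lam z.1.2.2 • z.1.1) (ex lam z.1.2.2 • z.1.2.1) z.2.2.2 *
        ζ' (z.1.1, z.1.2.1, z.1.2.2 + z.2.2.2)) * conj (ζ z.1) := by
    have h2 := L2.integrable_inner (𝕜 := ℂ) Q P
    have h3 : Continuous fun z : Pt n × Pt n => conj (ebar (eta lam z.2.2.2 *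
      beta (ex lam z.1.2.2 • z.1.1) z.2.2.1)) *
        psi lam φ (ex lam z.1.2.2 • z.1.1) (ex lam z.1.2.2 • z.1.2.1) z.2.2.2 := by
      unfold psi
      have := φ.continuous
      have := Complex.continuous_conj
      fun_prop
    -- The integrand is an integrable product of two L² functions, times a bounded function that
    -- strips the phase of X and inserts the kernel.
    refine (h2.bdd_mul (c := B) h3.aestronglyMeasurable (Eventually.of_forall fun z => ?_)).congr ?_
    · rw [norm_mul, RCLike.norm_conj, norm_ebar, one_mul]
      have := hB.2 (ex lam z.2.2.2 • ex lam z.1.2.2 • z.1.1, ex lam z.2.2.2 • ex lam z.1.2.2 • z.1.2.1,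
        -z.2.2.2)
      rwa [pow_zero, one_mul, norm_iteratedFDeriv_zero] at this
    · filter_upwards [hPae, hQae] with z h4 h5
      rw [RCLike.inner_apply, h4, h5, map_mul, hbconj]
      linear_combination (psi lam φ (ex lam z.1.2.2 • z.1.1) (ex lam z.1.2.2 • z.1.2.1) z.2.2.2 *
        ζ' (z.1.1, z.1.2.1, z.1.2.2 + z.2.2.2) * conj (ζ z.1) * boxFun n ε R z.2 ^ 2) *
          hebar (eta lam z.2.2.2 * beta (ex lam z.1.2.2 • z.1.1) z.2.2.1)
  rw [sub_apply, inner_sub_right, inner_lamRep φ hφ hε ζ ζ' hi, h1,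
    L2.inner_def, ← integral_sub (L2.integrable_inner _ _) hi]
  obtain ⟨hPQ, hPQ'⟩ := integral_norm_mul_norm_le Q P
  have hnorm : ‖Q‖ * ‖P‖ = 2 * R * ‖ζ‖ * ‖ζ'‖ := by
    rw [hP, hQ, hSX.norm_apply, norm_tmulL2, norm_tmulL2, ← norm_boxVec_sq (n := n) hε hR]
    ring
  -- The squared box function is split evenly between P and Q, whose norms do not depend on ε;
  -- Cauchy–Schwarz then gives an operator norm bound.
  calc _ ≤ ∫ z, C * ε * (‖Q z‖ * ‖P z‖) := by
        refine norm_integral_le_of_norm_le (hPQ.const_mul _) ?_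
        filter_upwards [hPae, hQae, hS.coeFn (tmulL2 ζ (Jhat n lam (hφ2.toLp _))),
          hS.choose.qmp.ae (coeFn_tmulL2 ζ (Jhat n lam (hφ2.toLp _))),
          hS.choose.qmp.ae (ae_snd_of_ae (α := Pt n) ((isAWC_Jhat n lam).coeFn (hφ2.toLp _))),
          hS.choose.qmp.ae (ae_snd_of_ae (α := Pt n)
            ((isAWC_Jhat n lam).choose.qmp.ae hφ2.coeFn_toLp)),
          hSX.coeFn (tmulL2 ζ' (hΘ.toLp _)), hSX.choose.qmp.ae (coeFn_tmulL2 ζ' (hΘ.toLp _)),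
          ae_snd_of_ae (α := Pt n) hΘ.coeFn_toLp] with z a1 a2 a3 a4 a5 a6 a7 a8 a9
        rw [RCLike.inner_apply, a1, a2, a3, a4, a5, a6, a7, a8, a9]
        have hw : (((ex lam z.2.2.2) ^ n : ℝ) : ℂ) * (((ex lam z.2.2.2)⁻¹ ^ n : ℝ) : ℂ) = 1 := by
          rw [← Complex.ofReal_mul, ← mul_pow, mul_inv_cancel₀ (ex_ne_zero _), one_pow,
            Complex.ofReal_one]
        simp only [wph_zero, map_mul, map_one, Complex.conj_conj, Complex.conj_ofReal]
        by_cases hz : z.2 ∈ box n ε R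
        · have hb := hψ (ex lam z.1.2.2 • z.1.1) (ex lam z.1.2.2 • z.1.2.1) z.2.1 z.2.2.1 z.2.2.2 ε
            (abs_le.2 hz.2.2) (mem_ball_zero_iff.1 hz.1).le (mem_ball_zero_iff.1 hz.2.1).le
          refine le_of_eq_of_le (congrArg norm (a₂ := conj (ζ z.1 * boxFun n ε R z.2) *
            (ζ' (z.1.1, z.1.2.1, z.1.2.2 + z.2.2.2) * boxFun n ε R z.2) *
            (psi lam φ (z.2.1 + ex lam z.1.2.2 • z.1.1) (z.2.2.1 + ex lam z.1.2.2 • z.1.2.1) z.2.2.2 *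
              ebar (eta lam z.2.2.2 * beta (ex lam z.1.2.2 • z.1.1) z.2.2.1) -
              psi lam φ (ex lam z.1.2.2 • z.1.1) (ex lam z.1.2.2 • z.1.2.1) z.2.2.2)) ?_) ?_
          · rw [map_mul, hbconj]
            simp only [psi]
            linear_combination (ebar (eta lam z.2.2.2 * beta (ex lam z.1.2.2 • z.1.1) z.2.2.1) *
              ζ' (z.1.1, z.1.2.1, z.1.2.2 + z.2.2.2) * boxFun n ε R z.2 ^ 2 * conj (ζ z.1) *
              φ (ex lam z.2.2.2 • (z.2.1 + ex lam z.1.2.2 • z.1.1),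
                ex lam z.2.2.2 • (z.2.2.1 + ex lam z.1.2.2 • z.1.2.1), -z.2.2.2)) * hw
          · rw [norm_mul, norm_mul, RCLike.norm_conj, norm_mul (ebar _), norm_ebar, one_mul,
              mul_comm (C * ε)]
            gcongr
        · simp [boxFun, hz]
    _ ≤ C * ε * (‖Q‖ * ‖P‖) := by
        rw [integral_const_mul]
        gcongr
    _ = _ := by rw [hnorm]; ring

theorem lamRep_mem (n : ℕ) (lam : ℝ) {φ : 𝓢(Pt n, ℂ)} (hφ : φ ∈ FunAlg n) :
    lamRep lam φ ∈ sliceSpan (Xop n lam) := by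
  obtain ⟨R, hR⟩ := hφ
  obtain ⟨C, hC, h⟩ := norm_lamRep_sub_vecSlice_le (lam := lam) φ (R := max R 0) (le_max_right _ _)
    (fun x y r hr => hR x y r ((le_max_left _ _).trans_lt hr))
  rw [← SetLike.mem_coe, ← (isClosed_sliceSpan (Xop n lam)).closure_eq, Metric.mem_closure_iff]
  intro δ hδ
  -- Dividing by C + 1 rather than C also covers C = 0 and makes the final inequality strict.
  obtain ⟨ξ, η, hle⟩ := h (δ / (C + 1)) (by positivity)
  refine ⟨vecSlice (Xop n lam) ξ η, vecSlice_mem _ _ _, ?_⟩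
  rw [dist_comm, dist_eq_norm]
  refine hle.trans_lt ?_
  rw [mul_div_assoc', div_lt_iff₀ (by positivity)]
  nlinarith

end lamRepMem

end

end QDouble

namespace QDouble

noncomputable section

/-! ### Realisation of L_f as a slice of Y -/

section LrepMem

open scoped SchwartzMap

variable {n : ℕ} {lam : ℝ}

theorem memLp_one_add_norm_inv {E : Type} [NormedAddCommGroup E] [NormedSpace ℝ E]
    [FiniteDimensional ℝ E] [MeasureSpace E] [BorelSpace E]
    (hE : (volume : Measure E).IsAddHaarMeasure) {m : ℕ} (hm : Module.finrank ℝ E < m) :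
    MemLp (fun p : E => ((((1 + ‖p‖) ^ m)⁻¹ : ℝ) : ℂ)) 2 := by
  have hc : Continuous fun p : E => ((((1 + ‖p‖) ^ m)⁻¹ : ℝ) : ℂ) :=
    Complex.continuous_ofReal.comp (Continuous.inv₀ (by fun_prop) fun p => by positivity)
  refine (memLp_two_iff_integrable_sq_norm hc.aestronglyMeasurable).2 ?_
  have h := integrable_one_add_norm (E := E) (μ := volume) (r := ((2 * m : ℕ) : ℝ))
    (by exact_mod_cast hm.trans_le (by lia))
  refine h.congr (Eventually.of_forall fun p => ?_)
  have h0 : 0 < 1 + ‖p‖ := by positivity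
  simp only
  rw [Complex.norm_real, Real.norm_of_nonneg (by positivity), Real.rpow_neg h0.le,
    Real.rpow_natCast, inv_pow, ← pow_mul, mul_comm]

theorem memLp_exp_neg :
    MemLp ((Set.Ici (0 : ℝ)).indicator fun t => ((Real.exp (-t) : ℝ) : ℂ)) 2 := by
  rw [memLp_indicator_iff_restrict measurableSet_Ici]
  have hc : Continuous fun t : ℝ => ((Real.exp (-t) : ℝ) : ℂ) := by fun_prop
  refine (memLp_two_iff_integrable_sq_norm hc.aestronglyMeasurable).2 ?_
  have h : IntegrableOn (fun t : ℝ => Real.exp (-2 * t)) (Set.Ici 0) :=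
    (integrableOn_Ici_iff_integrableOn_Ioi (by simp)).2 (exp_neg_integrableOn_Ioi 0 (by norm_num))
  refine h.congr (Eventually.of_forall fun t => ?_)
  simp only
  rw [Complex.norm_real, Real.norm_of_nonneg (Real.exp_pos _).le, ← Real.exp_nat_mul]
  congr 1
  push_cast
  ring

theorem hasDerivAt_ex (s : ℝ) : HasDerivAt (ex lam) (lam * ex lam s) s := by
  have := ((hasDerivAt_id s).const_mul lam).exp
  refine this.congr_deriv ?_
  rw [mul_one, mul_comm]
  rfl

theorem hasDerivAt_eta (s : ℝ) : HasDerivAt (eta lam) (ex lam s ^ 2) s := by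
  by_cases h : lam = 0
  · have h1 : eta lam = fun r => r := by funext r; simp [eta, h]
    rw [h1]
    exact (hasDerivAt_id' s).congr_deriv (by simp [ex, h])
  · have h1 : eta lam = fun r => (ex lam r ^ 2 - 1) / (2 * lam) := by
      funext r
      rw [eta, if_neg h, ex, ← Real.exp_nat_mul]
      congr 3
      push_cast
      ring
    rw [h1]
    refine ((((hasDerivAt_ex (lam := lam) s).pow 2).sub_const 1).div_const (2 * lam)).congr_deriv ?_
    rw [div_eq_iff (by positivity)]
    push_cast
    ring

theorem contDiff_ex : ContDiff ℝ 1 (ex lam) := by unfold ex; fun_prop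

theorem contDiff_eta : ContDiff ℝ 1 (eta lam) := by
  unfold eta
  split_ifs
  · fun_prop
  · exact ContDiff.div_const (by fun_prop) _

/-- Scaling both vectors by e^{λs} multiplies β by e^{2λs}, so along the flow the phase of `twist`
depends on s only through -η_λ(s)β. -/
theorem eta_sub_mul (r s : ℝ) : eta lam (r - s) * ex lam s ^ 2 = eta lam r - eta lam s := by
  have := eta_mul_comm (lam := lam) r s
  have h0 := ex_ne_zero (lam := lam) s
  rw [eta_sub]
  field_simp
  linarith

theorem hasDerivAt_e (s : ℝ) : HasDerivAt e (2 * Real.pi * Complex.I * e s) s := by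
  have h := ((Complex.ofRealCLM.hasDerivAt (x := s)).const_mul (2 * Real.pi * Complex.I)).cexp
  refine h.congr_deriv ?_
  simp only [Complex.ofRealCLM_apply, Complex.ofReal_one, mul_one]
  rw [mul_comm]
  rfl

theorem contDiff_e : ContDiff ℝ 1 e := by
  unfold e
  exact (contDiff_const.mul Complex.ofRealCLM.contDiff).cexp

/-- `f(a, b, r) e[η(r) β(a, b)]` -/
def twist (lam : ℝ) (f : 𝓢(Pt n, ℂ)) (p : Pt n) : ℂ := f p * e (eta lam p.2.2 * beta p.1 p.2.1)

/-- The negative of the derivative at `t = 0` of `e^{-(1 + 2nλ)t}` times the values of `f` twisted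
along the flow `(e^{-λt}a, e^{-λt}b, r + t)`. -/
def flowDeriv (lam : ℝ) (f : 𝓢(Pt n, ℂ)) (p : Pt n) : ℂ :=
  (1 + 2 * n * lam) * f p + fderiv ℝ f p (lam • p.1, lam • p.2.1, -1) -
    2 * Real.pi * Complex.I * beta p.1 p.2.1 * f p

/-- `e^{(1 + 2nλ)s}` times `twist f` along the flow. -/
def flowFun (lam : ℝ) (f : 𝓢(Pt n, ℂ)) (p : Pt n) (s : ℝ) : ℂ :=
  ((Real.exp s * (ex lam s ^ n) ^ 2 : ℝ) : ℂ) *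
    twist lam f (ex lam s • p.1, ex lam s • p.2.1, p.2.2 - s)

theorem e_eta_flow (p : Pt n) (s : ℝ) :
    e (eta lam (p.2.2 - s) * beta (ex lam s • p.1) (ex lam s • p.2.1)) =
      e ((eta lam p.2.2 - eta lam s) * beta p.1 p.2.1) := by
  congr 1
  rw [beta_smul_left, beta_smul_right, ← eta_sub_mul]
  ring

theorem hasDerivAt_flowFun (f : 𝓢(Pt n, ℂ)) (p : Pt n) (s : ℝ) :
    HasDerivAt (flowFun lam f p) (((Real.exp s * (ex lam s ^ n) ^ 2 : ℝ) : ℂ) *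
      (flowDeriv lam f (ex lam s • p.1, ex lam s • p.2.1, p.2.2 - s) *
        e (eta lam (p.2.2 - s) * beta (ex lam s • p.1) (ex lam s • p.2.1)))) s := by
  have h1 : HasDerivAt (fun s => ((Real.exp s * (ex lam s ^ n) ^ 2 : ℝ) : ℂ))
      (((1 + 2 * n * lam) * (Real.exp s * (ex lam s ^ n) ^ 2) : ℝ) : ℂ) s := by
    refine HasDerivAt.ofReal_comp ?_
    have h2 : (fun s => Real.exp s * (ex lam s ^ n) ^ 2) =
        fun s => Real.exp ((1 + 2 * n * lam) * s) := by
      funext s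
      rw [ex, ← Real.exp_nat_mul, ← Real.exp_nat_mul, ← Real.exp_add]
      congr 1
      push_cast
      ring
    rw [h2, congrFun h2 s]
    have := ((hasDerivAt_id s).const_mul (1 + 2 * n * lam)).exp
    simpa [mul_comm] using this
  have h3 : HasDerivAt (fun s => ((ex lam s • p.1, ex lam s • p.2.1, p.2.2 - s) : Pt n))
      (lam • ex lam s • p.1, lam • ex lam s • p.2.1, -1) s := by
    have h := hasDerivAt_ex (lam := lam) s
    refine HasDerivAt.prodMk ?_ (HasDerivAt.prodMk ?_ ?_)
    · simpa [smul_smul] using h.smul_const p.1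
    · simpa [smul_smul] using h.smul_const p.2.1
    · simpa using (hasDerivAt_id s).const_sub p.2.2
  have h4 := (f.differentiableAt (x := (ex lam s • p.1, ex lam s • p.2.1, p.2.2 - s))).hasFDerivAt.comp_hasDerivAt s h3
  have h5 : HasDerivAt (fun s => e ((eta lam p.2.2 - eta lam s) * beta p.1 p.2.1))
      (-(ex lam s ^ 2 * beta p.1 p.2.1 : ℝ) * (2 * Real.pi * Complex.I *
        e ((eta lam p.2.2 - eta lam s) * beta p.1 p.2.1))) s := by
    have h6 := ((hasDerivAt_eta (lam := lam) s).const_sub (eta lam p.2.2)).mul_const (beta p.1 p.2.1)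
    have h7 := (hasDerivAt_e ((eta lam p.2.2 - eta lam s) * beta p.1 p.2.1)).scomp s h6
    refine h7.congr_deriv ?_
    rw [Complex.real_smul]
    push_cast
    ring
  have h8 := h1.mul (h4.mul h5)
  have h9 : flowFun lam f p = (fun s => ((Real.exp s * (ex lam s ^ n) ^ 2 : ℝ) : ℂ)) *
      ((f ∘ fun s => ((ex lam s • p.1, ex lam s • p.2.1, p.2.2 - s) : Pt n)) *
        fun s => e ((eta lam p.2.2 - eta lam s) * beta p.1 p.2.1)) := by
    funext s
    simp only [flowFun, twist, e_eta_flow, Pi.mul_apply, Function.comp_apply]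
  rw [h9]
  refine h8.congr_deriv ?_
  rw [e_eta_flow]
  simp only [Function.comp_apply, Pi.mul_apply, flowDeriv, beta_smul_left, beta_smul_right]
  push_cast
  ring

theorem contDiff_flowFun (f : 𝓢(Pt n, ℂ)) (p : Pt n) : ContDiff ℝ 1 (flowFun lam f p) := by
  have h9 : flowFun lam f p = fun s => ((Real.exp s * (ex lam s ^ n) ^ 2 : ℝ) : ℂ) *
      (f ((ex lam s • p.1, ex lam s • p.2.1, p.2.2 - s) : Pt n) *
        e ((eta lam p.2.2 - eta lam s) * beta p.1 p.2.1)) := by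
    funext s
    simp only [flowFun, twist, e_eta_flow]
  rw [h9]
  have h1 := contDiff_ex (lam := lam)
  have h2 := contDiff_eta (lam := lam)
  refine ContDiff.mul (Complex.ofRealCLM.contDiff.comp (Real.contDiff_exp.mul ((h1.pow n).pow 2))) (ContDiff.mul ((f.smooth 1).comp ?_)
    (contDiff_e.comp ?_)) <;> fun_prop

/-- The fundamental theorem of calculus for `flowFun` on (-∞, 0]: it has compact support in s
because f vanishes for |r - s| > R, and its value at 0 is `twist`. -/
theorem integral_flow {f : 𝓢(Pt n, ℂ)} {R : ℝ} (hf : ∀ x y r, R < |r| → f (x, y, r) = 0) (p : Pt n) :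
    ∫ s in Set.Iic (0 : ℝ), ((Real.exp s * (ex lam s ^ n) ^ 2 : ℝ) : ℂ) *
      (flowDeriv lam f (ex lam s • p.1, ex lam s • p.2.1, p.2.2 - s) *
        e (eta lam (p.2.2 - s) * beta (ex lam s • p.1) (ex lam s • p.2.1))) = twist lam f p := by
  have hs : HasCompactSupport (flowFun lam f p) := by
    refine HasCompactSupport.intro (isCompact_Icc (a := p.2.2 - R) (b := p.2.2 + R)) fun s hs => ?_
    rw [flowFun, twist, hf, zero_mul, mul_zero]
    by_contra hc
    have := abs_le.1 (not_lt.1 hc)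
    exact hs ⟨by linarith [this.2], by linarith [this.1]⟩
  have h := hs.integral_Iic_deriv_eq (contDiff_flowFun f p) 0
  simp only [(hasDerivAt_flowFun f p _).deriv] at h
  rw [h]
  simp [flowFun, ex]

theorem flowDeriv_bound (f : 𝓢(Pt n, ℂ)) (m : ℕ) :
    ∃ C, ∀ p, (1 + ‖p‖) ^ m * ‖flowDeriv lam f p‖ ≤ C := by
  have hd : ∀ k j : ℕ, ∃ C, ∀ p, (1 + ‖p‖) ^ k * ‖iteratedFDeriv ℝ j f p‖ ≤ C := fun k j =>
    ⟨_, fun p => SchwartzMap.one_add_le_sup_seminorm_apply (𝕜 := ℝ) (m := (k, j)) (k := k)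
      (n := j) le_rfl le_rfl f p⟩
  -- Two extra powers pay for the quadratic factor β(x, y), one for the linear coefficients of the
  -- derivative.
  obtain ⟨C₁, h1⟩ := hd (m + 2) 0
  obtain ⟨C₂, h2⟩ := hd (m + 1) 1
  refine ⟨|1 + 2 * n * lam| * C₁ + (|lam| + 1) * C₂ + 2 * Real.pi * C₁, fun p => ?_⟩
  have h1 := h1 p
  have h2 := h2 p
  rw [norm_iteratedFDeriv_zero] at h1
  rw [norm_iteratedFDeriv_one] at h2
  set A := 1 + ‖p‖ with hA
  have hA1 : 1 ≤ A := by simp [hA]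
  have hp1 : ‖p.1‖ ≤ ‖p‖ := norm_fst_le p
  have hp2 : ‖p.2.1‖ ≤ ‖p‖ := (norm_fst_le p.2).trans (norm_snd_le p)
  have hv : ‖((lam • p.1, lam • p.2.1, -1) : Pt n)‖ ≤ (|lam| + 1) * A := by
    simp only [Prod.norm_def, norm_smul, Real.norm_eq_abs, norm_neg, norm_one]
    have := abs_nonneg lam
    refine max_le ?_ (max_le ?_ ?_) <;> nlinarith [norm_nonneg p, norm_nonneg p.1, norm_nonneg p.2.1]
  have hb : |beta p.1 p.2.1| ≤ A ^ 2 := by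
    refine (norm_beta_le _ _).trans ?_
    rw [sq]
    gcongr <;> linarith
  have e1 : ‖((1 + 2 * n * lam : ℂ)) * f p‖ = |1 + 2 * n * lam| * ‖f p‖ := by
    rw [norm_mul, ← Real.norm_eq_abs, ← Complex.norm_real]
    push_cast
    rfl
  have e2 : ‖fderiv ℝ f p (lam • p.1, lam • p.2.1, -1)‖ ≤ ‖fderiv ℝ f p‖ * ((|lam| + 1) * A) :=
    (ContinuousLinearMap.le_opNorm _ _).trans (by gcongr)
  have e3 : ‖2 * Real.pi * Complex.I * beta p.1 p.2.1 * f p‖ ≤ 2 * Real.pi * A ^ 2 * ‖f p‖ := by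
    simp only [norm_mul, Complex.norm_ofNat, Complex.norm_real, Complex.norm_I, mul_one,
      Real.norm_of_nonneg Real.pi_pos.le, Real.norm_eq_abs]
    have := Real.pi_pos
    gcongr
  have e4 : ‖flowDeriv lam f p‖ ≤ |1 + 2 * n * lam| * ‖f p‖ + ‖fderiv ℝ f p‖ * ((|lam| + 1) * A) +
      2 * Real.pi * A ^ 2 * ‖f p‖ :=
    (norm_sub_le _ _).trans (add_le_add ((norm_add_le _ _).trans (add_le_add e1.le e2)) e3)
  have h3 : A ^ m * ‖f p‖ ≤ C₁ := le_trans (by gcongr; lia) h1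
  calc A ^ m * ‖flowDeriv lam f p‖ ≤ _ := mul_le_mul_of_nonneg_left e4 (by positivity)
    _ = |1 + 2 * n * lam| * (A ^ m * ‖f p‖) + (|lam| + 1) * (A ^ (m + 1) * ‖fderiv ℝ f p‖) +
        2 * Real.pi * (A ^ (m + 2) * ‖f p‖) := by ring
    _ ≤ _ := by
        have := Real.pi_pos
        gcongr

/-- The unitary `ξ ↦ ξ ∘ τ` up to a weight, for a change of variables `τ` that straightens `Y`. -/
theorem exists_shear_Y (n : ℕ) (lam : ℝ) : ∃ S : Op (Pt n × Pt n),
    IsWC S (fun z => wph n (ex lam z.2.2.2) (eta lam z.2.2.2 * beta z.2.1 z.2.2.1))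
      (fun z => (z.1, (-(ex lam z.2.2.2 • z.2.1), -(ex lam z.2.2.2 • z.2.2.1),
        z.1.2.2 - z.2.2.2))) ∧
    IsWC (S.comp (Yop n lam)) (fun z => wph n (ex lam z.2.2.2) (eta lam z.2.2.2 * beta z.2.1 z.2.2.1
        + eta lam z.1.2.2 * beta z.2.1 z.1.2.1))
      (fun z => ((z.1.1 - z.2.1, z.1.2.1 - z.2.2.1, z.1.2.2),
        (-(ex lam z.2.2.2 • z.2.1), -(ex lam z.2.2.2 • z.2.2.1), -z.2.2.2))) := by
  have h1 := measurePreserving_shear n (v := fun p => (0, 0, p.2.2))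
    (Continuous.measurable (by fun_prop))
  have h2 := ((IsWC.one (α := Pt n)).tensor (isWC_j n lam)).mul (isWC_compMP _ h1)
  have h3 : IsWC _ (fun z => wph n (ex lam z.2.2.2) (eta lam z.2.2.2 * beta z.2.1 z.2.2.1))
      (fun z : Pt n × Pt n => (z.1, (-(ex lam z.2.2.2 • z.2.1), -(ex lam z.2.2.2 • z.2.2.1),
        z.1.2.2 - z.2.2.2))) :=
    h2.congr (fun z => by rw [one_mul, mul_one]) (fun z => Prod.ext rfl
      (Prod.ext (add_zero _) (Prod.ext (add_zero _) (neg_add_eq_sub _ _))))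
  refine ⟨_, h3, (h3.comp (isWC_Y n lam)).congr (fun z => ?_) (fun z => ?_)⟩
  · simp only [wph_mul]
    refine wph_congr (mul_one _) ?_
    have h4 := ex_ne_zero (lam := lam) z.1.2.2
    have h5 := ex_ne_zero (lam := lam) z.2.2.2
    simp only [ex_sub, beta_neg_left, beta_smul_left]
    field_simp
  · have h4 := ex_ne_zero (lam := lam) z.1.2.2
    have h5 := ex_ne_zero (lam := lam) z.2.2.2
    have h6 : ex lam (z.1.2.2 - z.2.2.2) * (ex lam z.1.2.2)⁻¹ * ex lam z.2.2.2 = 1 := by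
      rw [ex_sub]
      field_simp
    simp only [smul_neg, smul_smul, h6, one_smul, ← sub_eq_add_neg, sub_sub_cancel_left]

/-- `(1 + |a|)^{-m}` as a vector. -/
def decayVec (n m : ℕ) : L2 (Vec n) :=
  if hm : Module.finrank ℝ (Vec n) < m then
    (memLp_one_add_norm_inv (E := Vec n) inferInstance hm).toLp _ else 0

theorem coeFn_decayVec {m : ℕ} (hm : Module.finrank ℝ (Vec n) < m) :
    decayVec n m =ᵐ[volume] fun a => ((((1 + ‖a‖) ^ m)⁻¹ : ℝ) : ℂ) := by
  rw [decayVec, dif_pos hm]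
  exact MemLp.coeFn_toLp _

/-- `flowDeriv`, reflected, conjugated, and divided by a decaying function. -/
def flowQuot (lam : ℝ) (m : ℕ) (f : 𝓢(Pt n, ℂ)) (p : Pt n) : ℂ :=
  conj (flowDeriv lam f (-p.1, -p.2.1, p.2.2) * e (eta lam p.2.2 * beta p.1 p.2.1)) *
    (((1 + ‖p.1‖) ^ m * (1 + ‖p.2.1‖) ^ m : ℝ) : ℂ)

theorem memLp_flowQuot (m : ℕ) (f : 𝓢(Pt n, ℂ)) :
    MemLp (flowQuot lam m f) 2 (volume : Measure (Pt n)) := by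
  -- One power m for each of the two decay factors divided out, and dimension plus one for square
  -- integrability of what is left.
  obtain ⟨C, hC⟩ := flowDeriv_bound (lam := lam) f (m + m + (Module.finrank ℝ (Pt n) + 1))
  have hd : Continuous (fderiv ℝ f) := (f.smooth 1).continuous_fderiv one_ne_zero
  have hc : Continuous (flowQuot lam m f) := by
    unfold flowQuot flowDeriv
    have := f.continuous
    have := Complex.continuous_conj
    fun_prop
  refine MemLp.of_le_mul (c := C) (memLp_one_add_norm_inv (isAddHaarMeasure_pt (n := n))
    (Nat.lt_succ_self _)) hc.aestronglyMeasurable (Eventually.of_forall fun p => ?_)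
  have h := hC (-p.1, -p.2.1, p.2.2)
  have hn : ‖((-p.1, -p.2.1, p.2.2) : Pt n)‖ = ‖p‖ := by
    simp only [Prod.norm_def, norm_neg]
  rw [hn] at h
  have hp1 : ‖p.1‖ ≤ ‖p‖ := norm_fst_le p
  have hp2 : ‖p.2.1‖ ≤ ‖p‖ := (norm_fst_le p.2).trans (norm_snd_le p)
  have h0 : 0 < 1 + ‖p‖ := by positivity
  rw [flowQuot, norm_mul, RCLike.norm_conj, norm_mul, norm_e, mul_one, Complex.norm_real,
    Complex.norm_real, Real.norm_of_nonneg (by positivity), Real.norm_of_nonneg (by positivity),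
    ← div_eq_mul_inv, le_div_iff₀ (by positivity)]
  calc _ ≤ ‖flowDeriv lam f (-p.1, -p.2.1, p.2.2)‖ * ((1 + ‖p‖) ^ m * (1 + ‖p‖) ^ m) *
        (1 + ‖p‖) ^ (Module.finrank ℝ (Pt n) + 1) := by gcongr
    _ = (1 + ‖p‖) ^ (m + m + (Module.finrank ℝ (Pt n) + 1)) *
        ‖flowDeriv lam f (-p.1, -p.2.1, p.2.2)‖ := by rw [pow_add, pow_add]; ring
    _ ≤ C := h

theorem integral_pt {G : Pt n → ℂ} (hG : Integrable G) :
    ∫ p, G p = ∫ q : Vec n × Vec n, ∫ s : ℝ, G (q.1, q.2, s) := by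
  have h := volume_preserving_prodAssoc (α₁ := Vec n) (β₁ := Vec n) (γ₁ := ℝ)
  rw [← h.integral_comp']
  exact integral_prod _ ((h.integrable_comp_emb (MeasurableEquiv.measurableEmbedding _)).2 hG)

/-- In straightened variables a slice of Y integrates over s a function of r - s against a function
of -s. Taking e^{-t} on t ≥ 0 as the latter gives the integral over s ≤ 0 in `integral_flow`, which
recovers f. The decay factors only make the second vector square integrable and cancel against
`flowQuot`. -/
theorem Lrep_eq_vecSlice {f : 𝓢(Pt n, ℂ)} {R : ℝ} (hf : ∀ x y r, R < |r| → f (x, y, r) = 0)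
    {m : ℕ} (hm : Module.finrank ℝ (Vec n) < m) :
    Lrep lam f = vecSlice (Yop n lam) ((memLp_flowQuot (lam := lam) m f).toLp _)
      (tmulL2 (decayVec n m) (tmulL2 (decayVec n m) (memLp_exp_neg.toLp _))) := by
  set ξ : L2 (Pt n) := (memLp_flowQuot (lam := lam) m f).toLp _ with hξ
  set η : L2 (Pt n) := tmulL2 (decayVec n m) (tmulL2 (decayVec n m) (memLp_exp_neg.toLp _)) with hη
  have hξae : ξ =ᵐ[volume] flowQuot lam m f := MemLp.coeFn_toLp _
  have hηae : η =ᵐ[volume] fun p => ((((1 + ‖p.1‖) ^ m * (1 + ‖p.2.1‖) ^ m)⁻¹ : ℝ) : ℂ) *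
      (Set.Ici (0 : ℝ)).indicator (fun t => ((Real.exp (-t) : ℝ) : ℂ)) p.2.2 := by
    filter_upwards [coeFn_tmulL2 (decayVec n m) (tmulL2 (decayVec n m) (memLp_exp_neg.toLp _)),
      ae_fst_of_ae (β := Vec n × ℝ) (coeFn_decayVec hm),
      ae_snd_of_ae (α := Vec n) (coeFn_tmulL2 (decayVec n m) (memLp_exp_neg.toLp _)),
      ae_snd_of_ae (α := Vec n) (ae_fst_of_ae (β := ℝ) (coeFn_decayVec hm)),
      ae_snd_of_ae (α := Vec n) (ae_snd_of_ae (α := Vec n) memLp_exp_neg.coeFn_toLp)]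
      with p h1 h2 h3 h4 h5
    rw [hη, h1, h2, h3, h4, h5, mul_inv]
    push_cast
    ring
  refine op_ext_inner fun ζ ζ' => ?_
  obtain ⟨S, hS, hSY⟩ := exists_shear_Y n lam
  rw [inner_vecSlice, ← hS.inner_map_map, ← ContinuousLinearMap.comp_apply, L2.inner_def]
  have hae : (fun z : Pt n × Pt n => ⟪S (tmulL2 ζ ξ) z, (S.comp (Yop n lam)) (tmulL2 ζ' η) z⟫_ℂ)
      =ᵐ[volume] fun z => (Set.Iic (0 : ℝ)).indicator (fun s =>
        ((Real.exp s * (ex lam s ^ n) ^ 2 : ℝ) : ℂ) *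
      (flowDeriv lam f (ex lam s • z.2.1, ex lam s • z.2.2.1, z.1.2.2 - s) *
        e (eta lam (z.1.2.2 - s) * beta (ex lam s • z.2.1) (ex lam s • z.2.2.1)))) z.2.2.2 *
      (ebar (eta lam z.1.2.2 * beta z.2.1 z.1.2.1) * ζ' (z.1.1 - z.2.1, z.1.2.1 - z.2.2.1, z.1.2.2) *
        conj (ζ z.1)) := by
    filter_upwards [hS.coeFn (tmulL2 ζ ξ), hS.choose.qmp.ae (coeFn_tmulL2 ζ ξ),
      hS.choose.qmp.ae (ae_snd_of_ae (α := Pt n) hξae), hSY.coeFn (tmulL2 ζ' η),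
      hSY.choose.qmp.ae (coeFn_tmulL2 ζ' η),
      hSY.choose.qmp.ae (ae_snd_of_ae (α := Pt n) hηae)] with z h1 h2 h3 h4 h5 h6
    rw [RCLike.inner_apply, h1, h2, h3, h4, h5, h6]
    by_cases hz : z.2.2.2 ≤ 0
    · have hz' : -z.2.2.2 ∈ Set.Ici (0 : ℝ) := neg_nonneg.2 hz
      rw [Set.indicator_of_mem (show z.2.2.2 ∈ Set.Iic (0 : ℝ) from hz),
        Set.indicator_of_mem hz', neg_neg]
      -- The weights of the straightening map and of its product with Y combine to e^{2nλs}, the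
      -- Jacobian factor in `flowFun`; their common phase cancels.
      have hw : conj (wph n (ex lam z.2.2.2) (eta lam z.2.2.2 * beta z.2.1 z.2.2.1)) *
          wph n (ex lam z.2.2.2) (eta lam z.2.2.2 * beta z.2.1 z.2.2.1
            + eta lam z.1.2.2 * beta z.2.1 z.1.2.1) =
          (((ex lam z.2.2.2 ^ n) ^ 2 : ℝ) : ℂ) * ebar (eta lam z.1.2.2 * beta z.2.1 z.1.2.1) := by
        rw [conj_wph, wph_mul, wph, neg_add_cancel_left, mul_pow, sq]
      -- Both vectors are evaluated at the same scaled and reflected arguments, so the decay factors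
      -- cancel exactly.
      have hg : (((1 + ‖-(ex lam z.2.2.2 • z.2.1)‖) ^ m * (1 + ‖-(ex lam z.2.2.2 • z.2.2.1)‖) ^ m :
          ℝ) : ℂ) * ((((1 + ‖-(ex lam z.2.2.2 • z.2.1)‖) ^ m *
            (1 + ‖-(ex lam z.2.2.2 • z.2.2.1)‖) ^ m)⁻¹ : ℝ) : ℂ) = 1 := by
        rw [← Complex.ofReal_mul, mul_inv_cancel₀ (by positivity), Complex.ofReal_one]
      simp only [flowQuot, neg_neg, map_mul, Complex.conj_conj, Complex.conj_ofReal]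
      have hb : beta (-(ex lam z.2.2.2 • z.2.1)) (-(ex lam z.2.2.2 • z.2.2.1)) =
        beta (ex lam z.2.2.2 • z.2.1) (ex lam z.2.2.2 • z.2.2.1) := by simp
      rw [hb, Complex.ofReal_mul (Real.exp _)]
      linear_combination (ζ' (z.1.1 - z.2.1, z.1.2.1 - z.2.2.1, z.1.2.2) * conj (ζ z.1) *
        ((Real.exp z.2.2.2 : ℝ) : ℂ) * (flowDeriv lam f
          (ex lam z.2.2.2 • z.2.1, ex lam z.2.2.2 • z.2.2.1, z.1.2.2 - z.2.2.2) *
        e (eta lam (z.1.2.2 - z.2.2.2) * beta (ex lam z.2.2.2 • z.2.1) (ex lam z.2.2.2 • z.2.2.1)))) *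
        (hw + conj (wph n (ex lam z.2.2.2) (eta lam z.2.2.2 * beta z.2.1 z.2.2.1)) *
          wph n (ex lam z.2.2.2) (eta lam z.2.2.2 * beta z.2.1 z.2.2.1
            + eta lam z.1.2.2 * beta z.2.1 z.1.2.1) * hg)
    · have hz' : -z.2.2.2 ∉ Set.Ici (0 : ℝ) := fun h => hz (neg_nonneg.1 h)
      rw [Set.indicator_of_notMem (show z.2.2.2 ∉ Set.Iic (0 : ℝ) from hz),
        Set.indicator_of_notMem hz']
      simp
  have hi := (L2.integrable_inner (𝕜 := ℂ) (S (tmulL2 ζ ξ))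
    ((S.comp (Yop n lam)) (tmulL2 ζ' η))).congr hae
  rw [L2.inner_def, integral_congr_ae hae]
  refine Eq.trans (integral_congr_ae ?_) (integral_prod _ hi).symm
  filter_upwards [coeFn_kernelOp (isSchur_L lam f).choose_spec.choose_spec ζ',
    hi.prod_right_ae] with p hp hpi
  rw [integral_pt hpi, RCLike.inner_apply, Lrep, hp, ← integral_mul_const]
  refine integral_congr_ae (Eventually.of_forall fun q => ?_)
  simp only
  rw [integral_mul_const, integral_indicator measurableSet_Iic,
    integral_flow hf (q.1, q.2, p.2.2), twist, kL, tL]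
  -- The phase built into `twist` is the discrepancy between the cocycle in the kernel of L_f and
  -- the phase delivered by Y.
  have hb : e (eta lam p.2.2 * beta q.1 q.2) * ebar (eta lam p.2.2 * beta q.1 p.2.1) =
      ebar (eta lam p.2.2 * beta q.1 (p.2.1 - q.2)) := by
    rw [ebar, ebar, ← e_add, beta_sub_right]
    congr 1
    ring
  rw [← hb]
  ring

theorem Lrep_mem (n : ℕ) (lam : ℝ) {f : 𝓢(Pt n, ℂ)} (hf : f ∈ FunAlg n) :
    Lrep lam f ∈ sliceSpan (Yop n lam) := by
  obtain ⟨R, hR⟩ := hf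
  rw [Lrep_eq_vecSlice hR (Nat.lt_succ_self _)]
  exact vecSlice_mem _ _ _

end LrepMem

end

end QDouble

/-! ### The antipode of the quantum double -/

theorem mainTheorem11 (n : ℕ) (lam : ℝ) :
    -- the conjugate-linear operator `Ĵ_D = J ⊗ Ĵ` is involutive
    (QDouble.JDhat n lam).comp (QDouble.JDhat n lam) = ContinuousLinearMap.id ℂ _ ∧
    -- `A_D` is a C*-algebra of operators, and `S_D` is an anti-automorphism of it
    (∃ B : NonUnitalStarSubalgebra ℂ (QDouble.Op (QDouble.Pt n × QDouble.Pt n)),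
      (B : Set (QDouble.Op (QDouble.Pt n × QDouble.Pt n))) = QDouble.AD n lam ∧
      ∃ Φ : B ≃⋆ₐ[ℂ] Bᵐᵒᵖ, ∀ x : B,
        ((Φ x).unop : QDouble.Op (QDouble.Pt n × QDouble.Pt n)) = QDouble.SD n lam x) ∧
    -- its values on the dense subalgebra of functions
    (∀ φ ∈ QDouble.FunAlg n, ∀ f ∈ QDouble.FunAlg n,
      QDouble.PiD lam φ f ∈ QDouble.AD n lam ∧
      QDouble.SD n lam (QDouble.PiD lam φ f) =
        QDouble.piA n lam (QDouble.S n lam (QDouble.Lrep lam f)) *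
          QDouble.piAhat n (QDouble.Shat n lam (QDouble.lamRep lam φ))) ∧
    -- `S_D(S_D(x)^*)^* = x`
    (∀ x ∈ QDouble.AD n lam,
      star (QDouble.SD n lam (star (QDouble.SD n lam x))) = x) ∧
    -- `(S_D ⊗ S_D)(Δ_D(x)) = Δ_D^cop(S_D(x))`
    (∀ x ∈ QDouble.AD n lam,
      QDouble.SDtensorSD n lam (QDouble.DeltaD n lam x) =
        QDouble.DeltaDcop n lam (QDouble.SD n lam x)) := by
  open QDouble in
  refine ⟨?_, ⟨ADsub n lam, coe_ADsub n lam, antipodeD n lam, fun _ => rfl⟩,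
    fun φ hφ f hf => ⟨?_, ?_⟩, fun x _ => ?_, fun x hx => ?_⟩
  · exact ContinuousLinearMap.ext fun ξ => (isConjugation_JDhat n lam).apply_apply ξ
  · rw [← coe_ADsub]
    exact piAhat_mul_piA_mem n lam (Lrep_mem n lam hf) (lamRep_mem n lam hφ)
  · rw [PiD, SD_mul, SD_piA, SD_piAhat]
  · rw [SD_star, star_star, SD_SD]
  · rw [← coe_ADsub] at hx
    exact (isMultiplicativeUnitary_VD n lam).antiConj_coproduct (isConjugation_JDhat n lam)
      (isConjugation_KD n lam) (antiConj_VD n lam) hx
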